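/- Let $\xi=\zeta_9$, $E=\mathbb{Q}(\xi)$ with complex conjugation $\alpha\mapsto\bar\alpha$, $\pi=1-\xi$, and let $E_\pi$ be the $\pi$-adic completion of $E$, with ring of integers $\mathcal{O}_{E_\pi}$ and with the continuous extension of complex conjugation. Let $\Gamma=PU_3(\mathbb{Z}[\xi,\tfrac13])$ be the quotient by its center of the group $U_3(\mathbb{Z}[\xi,\tfrac13])$ of all $g\in GL_3(E)$ with $g^*g=I$ and all entries in $\mathbb{Z}[\xi,\tfrac13]$. Let $\mathcal{B}$ be the Bruhat–Tits building of $GL_3(E_\pi)$: its vertices are the cosets in $GL_3(E_\pi)/E_\pi^\times GL_3(\mathcal{O}_{E_\pi})$, and three vertices form a triangle iff they have representatives $g_1,g_2,g_3$ with $\pi g_3\mathcal{O}_{E_\pi}^3<g_1\mathcal{O}_{E_\pi}^3<g_2\mathcal{O}_{E_\pi}^3<g_3\mathcal{O}_{E_\pi}^3$. The map $g\mapsto (g^*)^{-1}$ induces an involution $\#$ of $\mathcal{B}$, and $\mathcal{T}$ denotes its fixed section, which is the Bruhat–Tits tree of $U_3(E_\pi)$: its vertices are the vertices of $\mathcal{B}$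 fixed by $\#$ and the midpoints of the edges of $\mathcal{B}$ reflected by $\#$, and a fixed vertex $x$ is adjacent to the midpoint of a reflected edge $\{y,z\}$ iff $\{x,y,z\}$ is a triangle of $\mathcal{B}$. The group $\Gamma$ acts on $\mathcal{T}$. Let $v_0$ be the vertex of the identity coset, and let $$H=\frac1{\sqrt{-3}}\begin{pmatrix}1&1&1\\1&\zeta_3&\bar\zeta_3\\1&\bar\zeta_3&\zeta_3\end{pmatrix}\in\Gamma,\qquad \zeta_3=\xi^3.$$ Then there is exactly one path in $\mathcal{T}$ from $v_0$ to $Hv_0$; it has length $6$, say $v_0,v_1,\dots,v_6=Hv_0$. Put $C_0=\mathrm{Stab}_\Gamma(v_0)$, $C_3=\mathrm{Stab}_\Gamma(v_3)$, and let $C_D$ be the pointwise stabilizer in $\Gamma$ of the path $D=(v_0,v_1,v_2,v_3)$. Then $C_D=C_0\cap C_3$, the orders are $|C_0|=1944$, $|C_3|=216$, $|C_D|=54$, and $\Gamma$ is the amalgamated free product $$\Gamma=C_0 *_{C_D} C_3,$$ that is, the homomorphism $C_0*_{C_D}C_3\to\Gamma$ induced by the inclusions is an isomorphism. -/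

import Mathlib

open scoped Pointwise

noncomputable section

namespace BruhatTits

open Matrix

/-! ### The building of `GL₃` and the fixed tree of a unitary involution

`K` is a field with an involution `star`, `O` a discrete valuation ring of `K` that is stable under
the involution, and `ϖ` a generator of its maximal ideal. -/

/-- The valuation ring `O` is stable under the involution of the field. -/
class StarStable {K : Type*} [Field K] [StarRing K] (O : ValuationSubring K) : Prop where
  star_mem : ∀ {x : K}, x ∈ O → star x ∈ O

variable {K : Type*} [Field K]

/-- The subgroup `Kˣ · GL₃(O)` of `GL₃(K)`. -/
def scalarMaximal (O : ValuationSubring K) : Subgroup (GL (Fin 3) K) :=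
  (GeneralLinearGroup.scalar (Fin 3) : Kˣ →* GL (Fin 3) K).range ⊔
    (GeneralLinearGroup.map (n := Fin 3) O.subtype).range

/-- The vertices of the building of `GL₃(K)`: the cosets `GL₃(K) / Kˣ GL₃(O)`. -/
abbrev Vertex (O : ValuationSubring K) : Type _ := GL (Fin 3) K ⧸ scalarMaximal O

/-- The lattice `g O³` in `K³`: the `O`-span of the columns of `g`. -/
def lattice (O : ValuationSubring K) (g : GL (Fin 3) K) : Submodule O (Fin 3 → K) :=
  Submodule.span O (Set.range fun j : Fin 3 => fun i : Fin 3 => (g : Matrix (Fin 3) (Fin 3) K) i j)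

/-- The triangles of the building, as sets of vertices: they come from the strict chains
`ϖ g₃ O³ < g₁ O³ < g₂ O³ < g₃ O³`, where the `gᵢ` run through all representatives of the cosets. -/
def IsTriangle (O : ValuationSubring K) (ϖ : K) (S : Set (Vertex O)) : Prop :=
  ∃ g₁ g₂ g₃ : GL (Fin 3) K, S = {(g₁ : Vertex O), (g₂ : Vertex O), (g₃ : Vertex O)} ∧
    ϖ • lattice O g₃ < lattice O g₁ ∧ lattice O g₁ < lattice O g₂ ∧ lattice O g₂ < lattice O g₃

/-- Two vertices span an edge of the building: they are distinct and lie in a common triangle. -/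
def IsEdge (O : ValuationSubring K) (ϖ : K) (x y : Vertex O) : Prop :=
  x ≠ y ∧ ∃ S, IsTriangle O ϖ S ∧ x ∈ S ∧ y ∈ S

theorem lattice_mul (O : ValuationSubring K) (h g : GL (Fin 3) K) :
    lattice O (h * g) = (lattice O g).map
      ((Matrix.mulVecLin (h : Matrix (Fin 3) (Fin 3) K)).restrictScalars O) := by
  unfold lattice
  rw [Submodule.map_span, ← Set.range_comp]
  congr 2

theorem lattice_mul_lt (O : ValuationSubring K) (h : GL (Fin 3) K) {L M : Submodule O (Fin 3 → K)}
    (hLM : L < M) :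
    L.map ((Matrix.mulVecLin (h : Matrix (Fin 3) (Fin 3) K)).restrictScalars O) <
      M.map ((Matrix.mulVecLin (h : Matrix (Fin 3) (Fin 3) K)).restrictScalars O) := by
  refine Submodule.map_strictMono_of_injective ?_ hLM
  intro x y hxy
  have := congrArg (fun v => ((h⁻¹ : GL (Fin 3) K) : Matrix (Fin 3) (Fin 3) K) *ᵥ v)
    (show (h : Matrix (Fin 3) (Fin 3) K) *ᵥ x = (h : Matrix (Fin 3) (Fin 3) K) *ᵥ y from hxy)
  simpa only [Matrix.mulVec_mulVec, Units.inv_mul, Matrix.one_mulVec] using this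

theorem IsTriangle.smul {O : ValuationSubring K} {ϖ : K} {S : Set (Vertex O)}
    (hS : IsTriangle O ϖ S) (h : GL (Fin 3) K) : IsTriangle O ϖ (h • S) := by
  obtain ⟨g₁, g₂, g₃, rfl, h₁, h₂, h₃⟩ := hS
  refine ⟨h * g₁, h * g₂, h * g₃, ?_, ?_, ?_, ?_⟩
  · simp only [← Set.image_smul, Set.image_insert_eq, Set.image_singleton]
    rfl
  · rw [lattice_mul, lattice_mul]
    convert lattice_mul_lt O h h₁ using 1
    ext v
    simp only [Submodule.mem_smul_pointwise_iff_exists, Submodule.mem_map,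
      LinearMap.restrictScalars_apply, Matrix.mulVecLin_apply]
    constructor
    · rintro ⟨_, ⟨b, hb, rfl⟩, rfl⟩
      exact ⟨ϖ • b, ⟨b, hb, rfl⟩, Matrix.mulVec_smul _ _ _⟩
    · rintro ⟨_, ⟨b, hb, rfl⟩, rfl⟩
      exact ⟨_, ⟨b, hb, rfl⟩, (Matrix.mulVec_smul _ _ _).symm⟩
  · rw [lattice_mul, lattice_mul]; exact lattice_mul_lt O h h₂
  · rw [lattice_mul, lattice_mul]; exact lattice_mul_lt O h h₃

theorem IsEdge.smul {O : ValuationSubring K} {ϖ : K} {x y : Vertex O}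
    (hxy : IsEdge O ϖ x y) (h : GL (Fin 3) K) : IsEdge O ϖ (h • x) (h • y) := by
  obtain ⟨hne, S, hS, hx, hy⟩ := hxy
  exact ⟨fun e => hne (smul_left_cancel h e), h • S, hS.smul h,
    Set.smul_mem_smul_set hx, Set.smul_mem_smul_set hy⟩

variable [StarRing K]

/-- The involution `g ↦ g^# = (g*)⁻¹` of `GL₃(K)`, for the standard Hermitian form. -/
def sharp : GL (Fin 3) K →* GL (Fin 3) K where
  toFun g := (star g)⁻¹
  map_one' := by simp
  map_mul' a b := by rw [star_mul, _root_.mul_inv_rev]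

/-- The unitary group `U₃(K)`: the fixed points of `#`. -/
def fixedGroup (K : Type*) [Field K] [StarRing K] : Subgroup (GL (Fin 3) K) where
  carrier := {g | sharp g = g}
  one_mem' := map_one sharp
  mul_mem' {a b} ha hb := by
    change sharp (a * b) = a * b
    rw [map_mul, show sharp a = a from ha, show sharp b = b from hb]
  inv_mem' {a} ha := by
    change sharp a⁻¹ = a⁻¹
    rw [map_inv, show sharp a = a from ha]

theorem sharp_mem (O : ValuationSubring K) [StarStable O] {g : GL (Fin 3) K}
    (hg : g ∈ scalarMaximal O) : sharp g ∈ scalarMaximal O := by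
  suffices h : scalarMaximal O ≤ (scalarMaximal O).comap sharp from h hg
  refine sup_le ?_ ?_
  · rintro _ ⟨u, rfl⟩
    refine Subgroup.mem_sup_left ⟨(star u)⁻¹, ?_⟩
    rw [map_inv]
    refine congrArg (fun a : GL (Fin 3) K => a⁻¹) ?_
    ext i j
    simp [Matrix.star_apply, Matrix.scalar_apply, Matrix.diagonal_apply, eq_comm, apply_ite star]
  · rintro _ ⟨A, rfl⟩
    refine Subgroup.mem_sup_right ?_
    have key : ∀ A : GL (Fin 3) O,
        star (GeneralLinearGroup.map (n := Fin 3) O.subtype A) ∈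
          (GeneralLinearGroup.map (n := Fin 3) O.subtype).range := by
      intro A
      let s : O →+* O := ((starRingEnd K).comp O.subtype).codRestrict O
        (fun x => StarStable.star_mem x.2)
      refine ⟨⟨((A : Matrix (Fin 3) (Fin 3) O).map s)ᵀ,
        (((A⁻¹ : GL (Fin 3) O) : Matrix (Fin 3) (Fin 3) O).map s)ᵀ, ?_, ?_⟩, ?_⟩
      · rw [← Matrix.transpose_mul, ← Matrix.map_mul, Units.inv_mul,
          Matrix.map_one s (map_zero s) (map_one s), Matrix.transpose_one]
      · rw [← Matrix.transpose_mul, ← Matrix.map_mul, Units.mul_inv,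
          Matrix.map_one s (map_zero s) (map_one s), Matrix.transpose_one]
      · ext i j
        rfl
    exact Subgroup.inv_mem _ (key A)

/-- The involution of the vertices of the building induced by `#`: `g Kˣ GL₃(O) ↦ g^# Kˣ GL₃(O)`. -/
def vertexSharp (O : ValuationSubring K) [StarStable O] : Vertex O → Vertex O :=
  Quotient.map' sharp fun a b hab => by
    rw [QuotientGroup.leftRel_apply] at *
    rw [← map_inv, ← map_mul]
    exact sharp_mem O hab

theorem vertexSharp_smul (O : ValuationSubring K) [StarStable O] (g : fixedGroup K)
    (x : Vertex O) : vertexSharp O ((g : GL (Fin 3) K) • x) =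
      (g : GL (Fin 3) K) • vertexSharp O x := by
  obtain ⟨a, rfl⟩ := QuotientGroup.mk_surjective x
  change ((sharp ((g : GL (Fin 3) K) * a) : GL (Fin 3) K) : Vertex O) =
    (((g : GL (Fin 3) K) * sharp a : GL (Fin 3) K) : Vertex O)
  have hg : sharp (g : GL (Fin 3) K) = g := g.2
  rw [map_mul, hg]

/-- The first kind of vertices of the fixed tree: the vertices of the building fixed by `#`,
written as singletons. -/
def fixedVertices (O : ValuationSubring K) [StarStable O] : Set (Set (Vertex O)) :=
  {s | ∃ x, vertexSharp O x = x ∧ s = {x}}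

/-- The second kind of vertices of the fixed tree: the midpoints of the edges of the building
that `#` reflects, a midpoint being written as the set of the two endpoints of its edge. -/
def reflectedEdges (O : ValuationSubring K) (ϖ : K) [StarStable O] : Set (Set (Vertex O)) :=
  {s | ∃ x y, IsEdge O ϖ x y ∧ vertexSharp O x = y ∧ vertexSharp O y = x ∧ s = {x, y}}

/-- The vertices of the Bruhat-Tits tree of `U₃(K)`, the fixed section of `#` in the building. -/
def TreeVertex (O : ValuationSubring K) (ϖ : K) [StarStable O] : Type _ :=
  {s : Set (Vertex O) // s ∈ fixedVertices O ∨ s ∈ reflectedEdges O ϖ}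

/-- The Bruhat-Tits tree of `U₃(K)`: in a triangle `{x, y, z}` of the building with `x` fixed and
`y`, `z` exchanged by `#`, the fixed section is the segment from `x` to the midpoint of `yz`. -/
def tree (O : ValuationSubring K) (ϖ : K) [StarStable O] : SimpleGraph (TreeVertex O ϖ) where
  Adj s t := ((s.1 ∈ fixedVertices O ∧ t.1 ∈ reflectedEdges O ϖ) ∨
      (s.1 ∈ reflectedEdges O ϖ ∧ t.1 ∈ fixedVertices O)) ∧ IsTriangle O ϖ (s.1 ∪ t.1)
  symm := ⟨fun s t h => ⟨h.1.symm.imp And.symm And.symm, Set.union_comm s.1 t.1 ▸ h.2⟩⟩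
  loopless := ⟨fun s h => by
    have h' : s.1 ∈ fixedVertices O ∧ s.1 ∈ reflectedEdges O ϖ := h.1.elim id And.symm
    obtain ⟨⟨x, -, hx⟩, ⟨y, z, hyz, -, -, hs⟩⟩ := h'
    rw [hx] at hs
    have hy : y = x := by
      have : y ∈ ({x} : Set (Vertex O)) := hs ▸ Set.mem_insert y {z}
      exact this
    have hz : z = x := by
      have : z ∈ ({x} : Set (Vertex O)) := hs ▸ Set.mem_insert_of_mem y rfl
      exact this
    exact hyz.1 (hy.trans hz.symm)⟩

/-- `U₃(K)` acts on the vertices of the tree. -/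
instance (O : ValuationSubring K) (ϖ : K) [StarStable O] :
    MulAction (fixedGroup K) (TreeVertex O ϖ) where
  smul g s := ⟨(g : GL (Fin 3) K) • s.1, by
    rcases s.2 with ⟨x, hx, hs⟩ | ⟨x, y, hxy, hx, hy, hs⟩
    · refine Or.inl ⟨(g : GL (Fin 3) K) • x, ?_, ?_⟩
      · rw [vertexSharp_smul, hx]
      · rw [hs, Set.smul_set_singleton]
    · refine Or.inr ⟨(g : GL (Fin 3) K) • x, (g : GL (Fin 3) K) • y, hxy.smul _, ?_, ?_, ?_⟩
      · rw [vertexSharp_smul, hx]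
      · rw [vertexSharp_smul, hy]
      · rw [hs]
        simp only [← Set.image_smul, Set.image_insert_eq, Set.image_singleton]⟩
  one_smul s := Subtype.ext (one_smul (GL (Fin 3) K) s.1)
  mul_smul g h s := Subtype.ext (mul_smul (g : GL (Fin 3) K) (h : GL (Fin 3) K) s.1)

theorem coe_smul_treeVertex {O : ValuationSubring K} {ϖ : K} [StarStable O] (g : fixedGroup K)
    (s : TreeVertex O ϖ) : (g • s).1 = (g : GL (Fin 3) K) • s.1 := rfl

/-- The vertex of the tree given by the coset `Kˣ GL₃(O)` itself. -/
def baseVertex (O : ValuationSubring K) (ϖ : K) [StarStable O] : TreeVertex O ϖ :=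
  ⟨{((1 : GL (Fin 3) K) : Vertex O)}, Or.inl ⟨_, by
    change ((sharp 1 : GL (Fin 3) K) : Vertex O) = _
    rw [map_one], rfl⟩⟩

end BruhatTits

/-- `D` is a common subgroup of `A` and `B`, and the natural homomorphism from the amalgamated free
product (the pushout of the two inclusions of `D`) to the ambient group is an isomorphism. -/
def IsAmalgamatedProduct {G : Type*} [Group G] (A B D : Subgroup G) : Prop :=
  ∃ h : ∀ i, D ≤ (![A, B] : Fin 2 → Subgroup G) i,
    Function.Bijective
      (Monoid.PushoutI.lift (φ := fun i => Subgroup.inclusion (h i))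
        (fun i => ((![A, B] : Fin 2 → Subgroup G) i).subtype) D.subtype (fun _ => rfl))

namespace Qutrit

open Matrix NumberField IsDedekindDomain BruhatTits

/-- The field `E = ℚ(ζ₉)`. -/
def E : Type := CyclotomicField 9 ℚ

instance : Field E := inferInstanceAs (Field (CyclotomicField 9 ℚ))

instance : NumberField E := inferInstanceAs (NumberField (CyclotomicField 9 ℚ))

instance : IsCyclotomicExtension {9} ℚ E := CyclotomicField.isCyclotomicExtension 9 ℚ

/-- `E` is a CM field, so it carries the complex conjugation as its `star`. -/
instance : IsCMField E :=
  IsCyclotomicExtension.Rat.isCMField E (S := {9}) ⟨9, rfl, by norm_num⟩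

/-- The primitive ninth root of unity `ξ = ζ₉`. -/
def ξ : E := IsCyclotomicExtension.zeta 9 ℚ E

theorem ξ_spec : IsPrimitiveRoot ξ 9 := IsCyclotomicExtension.zeta_spec 9 ℚ E

theorem star_ξ : star ξ = ξ⁻¹ := by
  let φ : E →+* ℂ := Classical.choice inferInstance
  apply φ.injective
  have h1 : φ (star ξ) = starRingEnd ℂ (φ ξ) := IsCMField.complexEmbedding_complexConj E φ ξ
  rw [h1, map_inv₀]
  have h9 : φ ξ ^ 9 = 1 := by rw [← map_pow, ξ_spec.pow_eq_one, map_one]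
  have hn : ‖φ ξ‖ = 1 := Complex.norm_eq_one_of_pow_eq_one h9 (by norm_num)
  rw [Complex.inv_def, Complex.normSq_eq_norm_sq, hn]
  simp

/-- `ξ` as an element of the ring of integers `𝓞 E = ℤ[ξ]`. -/
def ξInt : 𝓞 E := ξ_spec.toInteger

/-- The prime ideal `(π)` of `𝓞 E`, where `π = 1 - ξ`; it is the prime above `3`. -/
def primeπ : HeightOneSpectrum (𝓞 E) where
  asIdeal := Ideal.span {1 - ξInt}
  isPrime := by
    have : Fact (Nat.Prime 3) := ⟨Nat.prime_three⟩
    have : IsCyclotomicExtension {3 ^ (1 + 1)} ℚ E :=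
      (inferInstance : IsCyclotomicExtension {9} ℚ E)
    have h : IsPrimitiveRoot ξ (3 ^ (1 + 1)) := ξ_spec
    have h2 : Prime (1 - ξInt) := by
      have := h.zeta_sub_one_prime.neg
      rwa [neg_sub] at this
    exact (Ideal.span_singleton_prime h2.ne_zero).2 h2
  ne_bot := by
    rw [Ne, Ideal.span_singleton_eq_bot, sub_eq_zero]
    intro h
    have h3 := congrArg (fun x : 𝓞 E => (x : E)) h
    exact ξ_spec.ne_one (by norm_num) (h3.symm : ξ = 1)

theorem star_mem_pow (n : ℕ) {x : 𝓞 E} (hx : x ∈ primeπ.asIdeal ^ n) :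
    IsCMField.ringOfIntegersComplexConj E x ∈ primeπ.asIdeal ^ n := by
  have hI : primeπ.asIdeal.map (IsCMField.ringOfIntegersComplexConj E) ≤ primeπ.asIdeal := by
    rw [primeπ, Ideal.map_span, Set.image_singleton, Ideal.span_singleton_le_span_singleton]
    refine ⟨-ξInt ^ 8, RingOfIntegers.ext ?_⟩
    have h9 : ξ ^ 9 = 1 := ξ_spec.pow_eq_one
    have hinv : ξ⁻¹ = ξ ^ 8 :=
      (eq_inv_of_mul_eq_one_left (by rw [← pow_succ]; exact h9)).symm
    have h1 : IsCMField.complexConj E ξ = ξ⁻¹ := star_ξ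
    have h2 : ((ξInt : 𝓞 E) : E) = ξ := rfl
    simp only [map_sub, map_one, IsCMField.coe_ringOfIntegersComplexConj, map_mul, map_neg,
      map_pow, h2, h1, hinv]
    linear_combination -h9
  have h := Ideal.mem_map_of_mem (IsCMField.ringOfIntegersComplexConj E) hx
  rw [Ideal.map_pow] at h
  exact Ideal.pow_right_mono hI n h

theorem intValuation_conj_le (x : 𝓞 E) :
    primeπ.intValuation (IsCMField.ringOfIntegersComplexConj E x) ≤ primeπ.intValuation x := by
  rcases eq_or_ne x 0 with rfl | hx
  · simp
  · have h := primeπ.intValuation_if_neg hx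
    rw [h, HeightOneSpectrum.intValuation_le_pow_iff_mem]
    apply star_mem_pow
    rw [← HeightOneSpectrum.intValuation_le_pow_iff_mem, h]

theorem valuation_star_le (x : E) : primeπ.valuation E (star x) ≤ primeπ.valuation E x := by
  have hconj : ∀ y : 𝓞 E, primeπ.intValuation (IsCMField.ringOfIntegersComplexConj E y) =
      primeπ.intValuation y := by
    intro y
    refine le_antisymm (intValuation_conj_le y) ?_
    have h := intValuation_conj_le (IsCMField.ringOfIntegersComplexConj E y)
    have h2 : IsCMField.ringOfIntegersComplexConj E
        (IsCMField.ringOfIntegersComplexConj E y) = y := by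
      apply RingOfIntegers.ext
      simp
    rwa [h2] at h
  obtain ⟨a, b, -, rfl⟩ := IsFractionRing.div_surjective (A := 𝓞 E) x
  have hs : ∀ y : 𝓞 E, star (algebraMap (𝓞 E) E y) =
      algebraMap (𝓞 E) E (IsCMField.ringOfIntegersComplexConj E y) := fun y => rfl
  rw [star_div₀, hs, hs, map_div₀, map_div₀]
  simp only [HeightOneSpectrum.valuation_of_algebraMap, hconj, le_refl]

/-- The completion `E_π` of `E` at `π`. -/
def Eπ : Type := primeπ.adicCompletion E

instance : Field Eπ := inferInstanceAs (Field (primeπ.adicCompletion E))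

instance : Algebra E Eπ := inferInstanceAs (Algebra E (primeπ.adicCompletion E))

/-- The ring `O_{E_π}` of `π`-adic integers. -/
def Oπ : ValuationSubring Eπ := primeπ.adicCompletionIntegers E

/-- Complex conjugation, as an endomorphism of `E` with its `π`-adic topology. -/
def conjWithVal : WithVal (primeπ.valuation E) →+* WithVal (primeπ.valuation E) :=
  WithVal.map _ _ (starRingEnd E)

theorem continuous_conjWithVal : Continuous conjWithVal := by
  refine continuous_of_continuousAt_zero conjWithVal ?_
  rw [ContinuousAt, map_zero,
    (Valued.hasBasis_nhds_zero (WithVal (primeπ.valuation E)) (WithZero (Multiplicative ℤ))).tendsto_iff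
      (Valued.hasBasis_nhds_zero (WithVal (primeπ.valuation E)) (WithZero (Multiplicative ℤ)))]
  intro γ _
  refine ⟨γ, trivial, fun x hx => ?_⟩
  have h : Valued.v (conjWithVal x) ≤ Valued.v x := valuation_star_le x.ofVal
  exact lt_of_le_of_lt ((Valuation.restrict_le_iff _).2 h) hx

/-- The continuous extension of complex conjugation to `E_π`. -/
def conjπ : Eπ →+* Eπ :=
  ((HeightOneSpectrum.adicCompletion.equiv E primeπ).symm.toRingHom.comp
    (UniformSpace.Completion.mapRingHom conjWithVal continuous_conjWithVal)).comp
      (HeightOneSpectrum.adicCompletion.equiv E primeπ).toRingHom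

theorem conjWithVal_comp : conjWithVal.comp conjWithVal = RingHom.id _ :=
  RingHom.ext fun x => WithVal.ofVal_injective _ (star_star x.ofVal)

theorem conjπ_conjπ (x : Eπ) : conjπ (conjπ x) = x := by
  have h : ∀ y : (primeπ.valuation E).Completion,
      UniformSpace.Completion.mapRingHom conjWithVal continuous_conjWithVal
        (UniformSpace.Completion.mapRingHom conjWithVal continuous_conjWithVal y) = y := by
    intro y
    rw [← RingHom.comp_apply, UniformSpace.Completion.mapRingHom_comp]
    simp only [conjWithVal_comp]
    exact RingHom.congr_fun UniformSpace.Completion.mapRingHom_id y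
  exact HeightOneSpectrum.adicCompletion.ext E primeπ (h (HeightOneSpectrum.adicCompletion.toCompletion x))

/-- `E_π` carries the extended complex conjugation as its `star`. -/
instance : StarRing Eπ where
  star := conjπ
  star_involutive := conjπ_conjπ
  star_mul x y := by rw [map_mul, mul_comm]
  star_add x y := map_add conjπ x y

theorem algebraMap_star (x : E) : algebraMap E Eπ (star x) = star (algebraMap E Eπ x) := by
  refine HeightOneSpectrum.adicCompletion.ext E primeπ ?_
  exact (UniformSpace.Completion.mapRingHom_coe continuous_conjWithVal
    (WithVal.toVal (primeπ.valuation E) x)).symm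

instance : StarStable Oπ where
  star_mem {x} hx := by
    let U : Set (primeπ.valuation E).Completion := {y | Valued.v y ≤ 1}
    have hU : IsClopen U := Valued.isClopen_integer (primeπ.valuation E).Completion
    let f := UniformSpace.Completion.mapRingHom conjWithVal continuous_conjWithVal
    have hf : Continuous f := UniformSpace.Completion.continuous_map
    have hsub : U ∩ Set.range (fun y : WithVal (primeπ.valuation E) =>
        (y : (primeπ.valuation E).Completion)) ⊆ f ⁻¹' U := by
      rintro _ ⟨hy, y, rfl⟩
      have h1 : f (y : (primeπ.valuation E).Completion) = ((conjWithVal y : WithVal (primeπ.valuation E)) :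
          (primeπ.valuation E).Completion) :=
        UniformSpace.Completion.mapRingHom_coe continuous_conjWithVal y
      rw [Set.mem_preimage, h1]
      change Valued.v ((conjWithVal y : WithVal (primeπ.valuation E)) :
        (primeπ.valuation E).Completion) ≤ 1
      rw [Valued.valuedCompletion_apply]
      have hy' : Valued.v (y : (primeπ.valuation E).Completion) ≤ 1 := hy
      rw [Valued.valuedCompletion_apply] at hy'
      exact (valuation_star_le y.ofVal).trans hy'
    have hd : DenseRange (fun y : WithVal (primeπ.valuation E) =>
        (y : (primeπ.valuation E).Completion)) := UniformSpace.Completion.denseRange_coe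
    have key : U ⊆ f ⁻¹' U :=
      (hd.open_subset_closure_inter hU.isOpen).trans
        (closure_minimal hsub (hU.isClosed.preimage hf))
    exact key (a := HeightOneSpectrum.adicCompletion.toCompletion x) hx

/-! ### The arithmetic group -/

/-- The ring `ℤ[ζ₉, 1/3]`. -/
def R : Subalgebra ℤ E := Algebra.adjoin ℤ {ξ, 1 / 3}

theorem ξ_mem : ξ ∈ R := Algebra.subset_adjoin (Set.mem_insert _ _)

theorem third_mem : (1 / 3 : E) ∈ R := Algebra.subset_adjoin (Set.mem_insert_of_mem _ rfl)

theorem star_mem_R {x : E} (hx : x ∈ R) : star x ∈ R := by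
  let f : E →ₐ[ℤ] E := (starRingEnd E).toIntAlgHom
  suffices h : R ≤ R.comap f from h hx
  refine Algebra.adjoin_le ?_
  rintro y (rfl | rfl)
  · change star ξ ∈ R
    have h9 : ξ ^ 9 = 1 := ξ_spec.pow_eq_one
    have hinv : ξ⁻¹ = ξ ^ 8 :=
      (eq_inv_of_mul_eq_one_left (by rw [← pow_succ]; exact h9)).symm
    rw [star_ξ, hinv]
    exact pow_mem ξ_mem 8
  · change (starRingEnd E) (1 / 3) ∈ R
    rw [map_div₀, map_one, map_ofNat]
    exact third_mem

/-- The group `U₃(ℤ[ζ₉, 1/3])` of the unitary matrices with entries in `ℤ[ζ₉, 1/3]`. -/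
def U₃R : Subgroup (Matrix.unitaryGroup (Fin 3) E) where
  carrier := {g | ∀ i j, (g : Matrix (Fin 3) (Fin 3) E) i j ∈ R}
  one_mem' i j := by
    change (1 : Matrix (Fin 3) (Fin 3) E) i j ∈ R
    rw [Matrix.one_apply]
    split_ifs
    · exact one_mem R
    · exact zero_mem R
  mul_mem' {a b} ha hb i j := by
    change ((a : Matrix (Fin 3) (Fin 3) E) * (b : Matrix (Fin 3) (Fin 3) E)) i j ∈ R
    rw [Matrix.mul_apply]
    exact sum_mem fun k _ => mul_mem (ha i k) (hb k j)
  inv_mem' {a} ha i j := star_mem_R (ha j i)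

/-- The projective group `Γ = PU₃(ℤ[ζ₉, 1/3])`: the quotient of `U₃(ℤ[ζ₉, 1/3])` by its center. -/
abbrev Γ : Type := U₃R ⧸ Subgroup.center U₃R

/-- The embedding of `U₃(ℤ[ζ₉, 1/3])` in the `π`-adic group `U₃(E_π)`. -/
def toLocal : U₃R →* fixedGroup Eπ :=
  MonoidHom.codRestrict
    (((GeneralLinearGroup.map (n := Fin 3) (algebraMap E Eπ)).comp
      (Unitary.toUnits (R := Matrix (Fin 3) (Fin 3) E))).comp U₃R.subtype) _ <| by
    intro g
    change (star _)⁻¹ = _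
    rw [inv_eq_iff_mul_eq_one]
    apply Units.ext
    have h : star (g.1 : Matrix (Fin 3) (Fin 3) E) * (g.1 : Matrix (Fin 3) (Fin 3) E) = 1 := g.1.2.1
    have h2 := congrArg (algebraMap E Eπ).mapMatrix h
    rw [map_mul, map_one] at h2
    have h3 : (algebraMap E Eπ).mapMatrix (star (g.1 : Matrix (Fin 3) (Fin 3) E)) =
        star ((algebraMap E Eπ).mapMatrix (g.1 : Matrix (Fin 3) (Fin 3) E)) := by
      ext i j
      exact algebraMap_star _
    rw [h3] at h2
    exact h2

/-- The uniformizer `π = 1 - ξ` of `E_π`. -/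
def π : Eπ := algebraMap E Eπ (1 - ξ)

/-- The vertices of the Bruhat-Tits tree of `U₃(E_π)`. -/
abbrev TVertex : Type := TreeVertex Oπ π

/-- The Bruhat-Tits tree of `U₃(E_π)`. -/
abbrev T : SimpleGraph TVertex := tree Oπ π

/-- The vertex of the coset `E_πˣ GL₃(O_{E_π})`. -/
abbrev v₀ : TVertex := baseVertex Oπ π

theorem coe_toLocal_apply (g : U₃R) (i j : Fin 3) :
    ((toLocal g : GL (Fin 3) Eπ) : Matrix (Fin 3) (Fin 3) Eπ) i j =
      algebraMap E Eπ ((g.1 : Matrix (Fin 3) (Fin 3) E) i j) := rfl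

/-- The action of `U₃(ℤ[ζ₉, 1/3])` on the tree, as a homomorphism to the permutations. -/
def actionHom : U₃R →* Equiv.Perm TVertex :=
  (MulAction.toPermHom (fixedGroup Eπ) TVertex).comp toLocal

/-- The element of `U₃(ℤ[ζ₉, 1/3])` with a given matrix. -/
def mkU₃R (M : Matrix (Fin 3) (Fin 3) E) (h : star M * M = 1) (hR : ∀ i j, M i j ∈ R) : U₃R :=
  ⟨⟨M, Matrix.mem_unitaryGroup_iff'.2 h⟩, hR⟩

theorem center_isScalar {z : U₃R} (hz : z ∈ Subgroup.center U₃R) :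
    (z.1 : Matrix (Fin 3) (Fin 3) E) =
      Matrix.scalar (Fin 3) ((z.1 : Matrix (Fin 3) (Fin 3) E) 0 0) := by
  set Z : Matrix (Fin 3) (Fin 3) E := (z.1 : Matrix (Fin 3) (Fin 3) E) with hZ
  have comm : ∀ (M : Matrix (Fin 3) (Fin 3) E), star M * M = 1 → (∀ i j, M i j ∈ R) →
      M * Z = Z * M := by
    intro M h hR
    have := Subgroup.mem_center_iff.1 hz (mkU₃R M h hR)
    exact congrArg (fun a : U₃R => (a.1 : Matrix (Fin 3) (Fin 3) E)) this
  have hd : ∀ a : Fin 3, Matrix.diagonal (fun i => if i = a then (-1 : E) else 1) * Z =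
      Z * Matrix.diagonal (fun i => if i = a then (-1 : E) else 1) := by
    intro a
    apply comm
    · rw [Matrix.star_eq_conjTranspose, Matrix.diagonal_conjTranspose, Matrix.diagonal_mul_diagonal,
        ← Matrix.diagonal_one]
      congr 1
      funext i
      by_cases h : i = a <;> simp [h]
    · intro i j
      rw [Matrix.diagonal_apply]
      split_ifs
      · exact neg_mem (one_mem R)
      · exact one_mem R
      · exact zero_mem R
  have hp : ∀ σ : Equiv.Perm (Fin 3), (σ.permMatrix E) * Z = Z * σ.permMatrix E := by
    intro σ
    apply comm
    · rw [Matrix.star_eq_conjTranspose, Matrix.conjTranspose_permMatrix, ← Matrix.permMatrix_mul]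
      simp
    · intro i j
      rw [Equiv.Perm.permMatrix, PEquiv.toMatrix_apply]
      split_ifs
      · exact one_mem R
      · exact zero_mem R
  ext i j
  rw [Matrix.scalar_apply, Matrix.diagonal_apply]
  split_ifs with hij
  · subst hij
    have h := congrFun (congrFun (hp (Equiv.swap 0 i)) 0) i
    rw [Equiv.Perm.permMatrix, PEquiv.toMatrix_toPEquiv_mul, PEquiv.mul_toMatrix_toPEquiv] at h
    simpa using h
  · have h := congrFun (congrFun (hd i) i) j
    rw [Matrix.diagonal_mul, Matrix.mul_diagonal] at h
    have hji : j ≠ i := fun e => hij e.symm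
    simp only [if_true, if_neg hji, mul_one, neg_mul, one_mul] at h
    exact self_eq_neg.1 h.symm

theorem center_le_ker : Subgroup.center U₃R ≤ actionHom.ker := by
  intro z hz
  have hs := center_isScalar hz
  set c : E := (z.1 : Matrix (Fin 3) (Fin 3) E) 0 0 with hc
  have hc0 : c ≠ 0 := by
    intro h0
    have h : star (z.1 : Matrix (Fin 3) (Fin 3) E) * (z.1 : Matrix (Fin 3) (Fin 3) E) = 1 := z.1.2.1
    rw [hs, h0, map_zero, mul_zero] at h
    exact zero_ne_one h
  have hu : IsUnit (algebraMap E Eπ c) := IsUnit.map (algebraMap E Eπ) hc0.isUnit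
  have hloc : (toLocal z : GL (Fin 3) Eπ) = GeneralLinearGroup.scalar (Fin 3) hu.unit := by
    ext i j
    rw [coe_toLocal_apply, hs]
    simp [Matrix.scalar_apply, Matrix.diagonal_apply, apply_ite (algebraMap E Eπ)]
  have htriv : ∀ x : Vertex Oπ, (toLocal z : GL (Fin 3) Eπ) • x = x := by
    intro x
    obtain ⟨a, rfl⟩ := QuotientGroup.mk_surjective x
    change (((toLocal z : GL (Fin 3) Eπ) * a : GL (Fin 3) Eπ) : Vertex Oπ) = (a : Vertex Oπ)
    refine (QuotientGroup.eq.2 ?_).symm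
    refine Subgroup.mem_sup_left (MonoidHom.mem_range.2 ⟨hu.unit, ?_⟩)
    rw [hloc, eq_inv_mul_iff_mul_eq]
    ext i j
    simp [Matrix.scalar_apply, mul_comm]
  rw [MonoidHom.mem_ker]
  ext s : 1
  refine Subtype.ext ?_
  change (toLocal z : GL (Fin 3) Eπ) • s.1 = s.1
  rw [← Set.image_smul]
  simp only [htriv, Set.image_id']

/-- `Γ` acts on the vertices of the tree, since the center of `U₃(ℤ[ζ₉, 1/3])` acts trivially. -/
instance : MulAction Γ TVertex :=
  MulAction.compHom TVertex (QuotientGroup.lift (Subgroup.center U₃R) actionHom center_le_ker)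

/-- `√-3 = 1 + 2ζ₃`, where `ζ₃ = ξ³`. -/
def sqrtNegThree : E := 1 + 2 * ξ ^ 3

theorem ζ₃_eq : (ξ ^ 3) ^ 2 + ξ ^ 3 + 1 = 0 := by
  have h : IsPrimitiveRoot (ξ ^ 3) 3 := ξ_spec.pow (by norm_num) (by norm_num)
  have h3 : (ξ ^ 3) ^ 3 = 1 := h.pow_eq_one
  have h1 : ξ ^ 3 - 1 ≠ 0 := sub_ne_zero.2 (h.ne_one (by norm_num))
  refine mul_left_cancel₀ h1 ?_
  linear_combination h3

theorem star_ζ₃ : star (ξ ^ 3) = ξ ^ 6 := by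
  have h9 : ξ ^ 9 = 1 := ξ_spec.pow_eq_one
  have hinv : (ξ ^ 3)⁻¹ = ξ ^ 6 :=
    (eq_inv_of_mul_eq_one_left (by rw [← pow_add]; exact h9)).symm
  rw [star_pow, star_ξ, inv_pow, hinv]

theorem inv_sqrtNegThree : sqrtNegThree⁻¹ = -(1 / 3) * sqrtNegThree := by
  refine inv_eq_of_mul_eq_one_left ?_
  unfold sqrtNegThree
  linear_combination (-4 / 3 : E) * ζ₃_eq

/-- The matrix `H = (1/√-3) (ζ₃^(ij))`. -/
def matH : Matrix (Fin 3) (Fin 3) E :=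
  sqrtNegThree⁻¹ • !![1, 1, 1; 1, ξ ^ 3, ξ ^ 6; 1, ξ ^ 6, ξ ^ 3]

theorem star_mul_matH : star matH * matH = 1 := by
  have h9 : ξ ^ 9 = 1 := ξ_spec.pow_eq_one
  have h6 : star (ξ ^ 6) = ξ ^ 3 := by rw [← star_ζ₃, star_star]
  have hz : ξ ^ 6 = -1 - ξ ^ 3 := by linear_combination ζ₃_eq
  have hs : star sqrtNegThree = -sqrtNegThree := by
    unfold sqrtNegThree
    rw [star_add, star_mul', star_one, star_ofNat, star_ζ₃]
    linear_combination 2 * ζ₃_eq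
  have hc : star sqrtNegThree⁻¹ * sqrtNegThree⁻¹ = 1 / 3 := by
    rw [star_inv₀, hs, inv_neg, inv_sqrtNegThree]
    unfold sqrtNegThree
    linear_combination (-4 / 9 : E) * ζ₃_eq
  have hw : star (!![1, 1, 1; 1, ξ ^ 3, ξ ^ 6; 1, ξ ^ 6, ξ ^ 3] : Matrix (Fin 3) (Fin 3) E) =
      !![1, 1, 1; 1, ξ ^ 6, ξ ^ 3; 1, ξ ^ 3, ξ ^ 6] := by
    ext i j
    fin_cases i <;> fin_cases j <;> simp [Matrix.star_apply, -star_pow, star_ζ₃, h6]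
  rw [matH, star_smul, hw, smul_mul_smul_comm, hc]
  have hq := ζ₃_eq
  ext i j
  fin_cases i <;> fin_cases j <;>
    simp [Matrix.mul_apply, Fin.sum_univ_three] <;> grind

theorem matH_mem (i j : Fin 3) : matH i j ∈ R := by
  have hc : sqrtNegThree⁻¹ ∈ R := by
    rw [inv_sqrtNegThree]
    refine mul_mem (neg_mem third_mem) (add_mem (one_mem R) (mul_mem ?_ (pow_mem ξ_mem 3)))
    exact ofNat_mem R 2
  have h1 : (1 : E) ∈ R := one_mem R
  have h3 := pow_mem ξ_mem 3
  have h6 := pow_mem ξ_mem 6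
  rw [matH, Matrix.smul_apply, smul_eq_mul]
  refine mul_mem hc ?_
  fin_cases i <;> fin_cases j <;> simp <;> assumption

/-- The class of `H` in `Γ`. -/
def H : Γ := QuotientGroup.mk (mkU₃R matH star_mul_matH matH_mem)

end Qutrit

end

/-! Vertices of the fixed tree are turned into lattices. Each vertex is represented by exactly one
lattice `L` in `E_π³` that is either self-dual or satisfies `π L < L^# < L`, and adjacency is the
chain `M^# < L < M`. The valuation of the determinant (`vol`) is 0 for the first kind and -1 for the
second, and comparing volumes replaces all index computations. With `expo L` the least `k` such that
`π^k L ≤ O³`, the function `expo L + expo L^#` is the distance from `v₀`: every other vertex has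
exactly one neighbour where it is smaller, obtained by adding a suitable `π^k O³`
(`isRootedTree_tree`). So paths are unique.

An element of `Γ` fixes `v₀` iff its matrix is integral at `π`, hence has entries in `ℤ[ξ]`. It is
then unitary at all six embeddings, and the inequality between arithmetic and geometric means,
applied to norms, leaves one nonzero entry in each column. Thus `C₀` consists of the monomial
matrices over the 18th roots of unity modulo scalars, and has order `6 · 18³ / 18 = 1944`. The same
estimate with the denominator `1 - ξ`, whose norm 3 is still small enough, shows that no translate
of `v₀` lies at distance 1, 2 or 3 from it (`smul_base_eq_of_radius_le`).

In the basis `(1,1,1), (1,-1,0), (1,0,0)` the matrix `H` is monomial up to corrections at the middle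
vector, and it reflects a piece of an apartment about `v₃`. The path to `H v₀` is therefore the
segment `v₀, v₁, v₂, v₃` followed by its image under `H`, reversed. The residue field is `F₃`, so
each vertex of the segment has four neighbours, and explicit diagonal matrices, together with `H` at
`v₃`, permute them transitively in the sense required by `IsSegmentAction`: the segment is a
fundamental domain (`isSegmentAction`).

For such an action, walking away from the root shows that `C₀` and `C₃` generate. Ping-pong on the
branch beyond `v₃` shows that there are no further relations: `C₀ \ C₃` moves the branch off itself
and `C₃ \ C₀` moves its complement into it (`pushout_lift_bijective`). Counting orbits along the
segment gives `|C₀| = 4 · 3 · 3 · |C_D|` and `|C₃| = 4 · |C_D|`. -/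

open scoped Pointwise

noncomputable section

namespace BruhatTits

open Matrix

/-! ### Lattices over a discrete valuation ring -/

section Lattices

variable {K : Type*} [Field K] {O : ValuationSubring K} {ϖ : K}

/-- `ϖ` generates the maximal ideal of the discrete valuation ring `O`. -/
structure IsUniformizer (O : ValuationSubring K) (ϖ : K) : Prop where
  ne_zero : ϖ ≠ 0
  lt_one : O.valuation ϖ < 1
  exists_zpow : ∀ x : K, x ≠ 0 → ∃ n : ℤ, O.valuation x = O.valuation ϖ ^ n

namespace IsUniformizer

variable (hϖ : IsUniformizer O ϖ)
include hϖ

theorem pos : 0 < O.valuation ϖ := by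
  rw [zero_lt_iff]
  exact (Valuation.ne_zero_iff _).2 hϖ.ne_zero

theorem zpow_le_zpow_iff {m n : ℤ} : O.valuation ϖ ^ m ≤ O.valuation ϖ ^ n ↔ n ≤ m :=
  (zpow_right_strictAnti₀ hϖ.pos hϖ.lt_one).le_iff_ge

theorem zpow_inj {m n : ℤ} : O.valuation ϖ ^ m = O.valuation ϖ ^ n ↔ m = n :=
  (zpow_right_strictAnti₀ hϖ.pos hϖ.lt_one).injective.eq_iff

theorem zpow_mem_iff {n : ℤ} : ϖ ^ n ∈ O ↔ 0 ≤ n := by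
  rw [← O.valuation_le_one_iff, map_zpow₀, ← zpow_zero (O.valuation ϖ), hϖ.zpow_le_zpow_iff]

theorem mem : ϖ ∈ O := by
  simpa using (hϖ.zpow_mem_iff (n := 1)).2 (by norm_num)

theorem inv_notMem : ϖ⁻¹ ∉ O := by
  have := (hϖ.zpow_mem_iff (n := -1)).not.2 (by norm_num)
  simpa using this

end IsUniformizer

/-- The normalized additive valuation of `K` with valuation ring `O`. -/
def ord (hϖ : IsUniformizer O ϖ) (x : K) : ℤ :=
  open Classical in if hx : x = 0 then 0 else (hϖ.exists_zpow x hx).choose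

variable (hϖ : IsUniformizer O ϖ)

theorem valuation_eq_zpow_ord {x : K} (hx : x ≠ 0) :
    O.valuation x = O.valuation ϖ ^ ord hϖ x := by
  rw [ord, dif_neg hx]
  exact (hϖ.exists_zpow x hx).choose_spec

theorem ord_eq_iff {x : K} (hx : x ≠ 0) {n : ℤ} :
    ord hϖ x = n ↔ O.valuation x = O.valuation ϖ ^ n := by
  rw [valuation_eq_zpow_ord hϖ hx, hϖ.zpow_inj]

theorem mem_iff_ord_nonneg {x : K} (hx : x ≠ 0) : x ∈ O ↔ 0 ≤ ord hϖ x := by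
  rw [← O.valuation_le_one_iff, valuation_eq_zpow_ord hϖ hx, ← zpow_zero (O.valuation ϖ),
    hϖ.zpow_le_zpow_iff]

theorem ord_mul {x y : K} (hx : x ≠ 0) (hy : y ≠ 0) : ord hϖ (x * y) = ord hϖ x + ord hϖ y := by
  rw [ord_eq_iff hϖ (mul_ne_zero hx hy), map_mul, valuation_eq_zpow_ord hϖ hx,
    valuation_eq_zpow_ord hϖ hy, zpow_add₀ hϖ.pos.ne']

theorem ord_zpow (n : ℤ) : ord hϖ (ϖ ^ n) = n := by
  rw [ord_eq_iff hϖ (zpow_ne_zero n hϖ.ne_zero), map_zpow₀]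

theorem ord_one : ord hϖ (1 : K) = 0 := by
  simpa using ord_zpow hϖ 0

theorem ord_inv {x : K} (hx : x ≠ 0) : ord hϖ x⁻¹ = - ord hϖ x := by
  have h := ord_mul hϖ hx (inv_ne_zero hx)
  rw [mul_inv_cancel₀ hx, ord_one] at h
  omega

theorem exists_ord_eq {x : K} (hx : x ≠ 0) :
    ∃ u, O.valuation u = 1 ∧ x = ϖ ^ ord hϖ x * u := by
  refine ⟨(ϖ ^ ord hϖ x)⁻¹ * x, ?_, ?_⟩
  · rw [map_mul, map_inv₀, map_zpow₀, ← valuation_eq_zpow_ord hϖ hx, inv_mul_cancel₀]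
    exact (Valuation.ne_zero_iff _).2 hx
  · rw [mul_inv_cancel_left₀ (zpow_ne_zero _ hϖ.ne_zero)]

/-- The additive valuation of the determinant. -/
def vol (g : GL (Fin 3) K) : ℤ := ord hϖ (g : Matrix (Fin 3) (Fin 3) K).det

theorem det_ne_zero (g : GL (Fin 3) K) : (g : Matrix (Fin 3) (Fin 3) K).det ≠ 0 :=
  (GeneralLinearGroup.det g).ne_zero

theorem vol_mul (g h : GL (Fin 3) K) : vol hϖ (g * h) = vol hϖ g + vol hϖ h := by
  rw [vol, Units.val_mul, Matrix.det_mul, ord_mul hϖ (det_ne_zero g) (det_ne_zero h)]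
  rfl

theorem vol_one : vol hϖ 1 = 0 := by
  rw [vol, Units.val_one, Matrix.det_one, ord_one]

theorem vol_inv (g : GL (Fin 3) K) : vol hϖ g⁻¹ = - vol hϖ g := by
  have := vol_mul hϖ g g⁻¹
  rw [mul_inv_cancel, vol_one] at this
  omega

theorem vol_scalar (a : Kˣ) : vol hϖ (GeneralLinearGroup.scalar (Fin 3) a) = 3 * ord hϖ (a : K) := by
  have h : ((GeneralLinearGroup.scalar (Fin 3) a : GL (Fin 3) K) : Matrix (Fin 3) (Fin 3) K).det =
      (a : K) * ((a : K) * a) := by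
    change (Matrix.scalar (Fin 3) (a : K)).det = _
    rw [Matrix.scalar_apply, Matrix.det_diagonal, Fin.prod_univ_three, mul_assoc]
  rw [vol, h, ord_mul hϖ a.ne_zero (mul_ne_zero a.ne_zero a.ne_zero),
    ord_mul hϖ a.ne_zero a.ne_zero]
  ring

theorem mem_lattice {g : GL (Fin 3) K} {x : Fin 3 → K} :
    x ∈ lattice O g ↔ ∀ i, (((g⁻¹ : GL (Fin 3) K) : Matrix (Fin 3) (Fin 3) K) *ᵥ x) i ∈ O := by
  have key : ∀ c : Fin 3 → O, (∑ j, c j • fun i => (g : Matrix (Fin 3) (Fin 3) K) i j) =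
      (g : Matrix (Fin 3) (Fin 3) K) *ᵥ (fun j => (c j : K)) := by
    intro c
    ext i
    simp only [Finset.sum_apply, Pi.smul_apply, Matrix.mulVec, dotProduct]
    exact Finset.sum_congr rfl fun j _ => mul_comm _ _
  rw [lattice, Submodule.mem_span_range_iff_exists_fun]
  constructor
  · rintro ⟨c, rfl⟩ i
    rw [key, Matrix.mulVec_mulVec, Units.inv_mul, Matrix.one_mulVec]
    exact (c i).2
  · intro h
    refine ⟨fun i => ⟨_, h i⟩, ?_⟩
    rw [key, Matrix.mulVec_mulVec, Units.mul_inv, Matrix.one_mulVec]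

theorem mem_lattice_one {x : Fin 3 → K} : x ∈ lattice O (1 : GL (Fin 3) K) ↔ ∀ i, x i ∈ O := by
  rw [mem_lattice, inv_one, Units.val_one, Matrix.one_mulVec]

theorem col_mem_lattice (g : GL (Fin 3) K) (j : Fin 3) :
    (fun i => (g : Matrix (Fin 3) (Fin 3) K) i j) ∈ lattice O g :=
  Submodule.subset_span ⟨j, rfl⟩

theorem lattice_le_iff {g g' : GL (Fin 3) K} : lattice O g ≤ lattice O g' ↔
    ∀ i j, ((g'⁻¹ * g : GL (Fin 3) K) : Matrix (Fin 3) (Fin 3) K) i j ∈ O := by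
  rw [lattice, Submodule.span_le]
  constructor
  · intro h i j
    exact mem_lattice.1 (h ⟨j, rfl⟩) i
  · rintro h _ ⟨j, rfl⟩
    exact mem_lattice.2 fun i => h i j

theorem exists_map_of_mem {A : Matrix (Fin 3) (Fin 3) K} (h : ∀ i j, A i j ∈ O) :
    ∃ B : Matrix (Fin 3) (Fin 3) O, A = O.subtype.mapMatrix B :=
  ⟨fun i j => ⟨A i j, h i j⟩, rfl⟩

theorem det_mem_of_mem {A : Matrix (Fin 3) (Fin 3) K} (h : ∀ i j, A i j ∈ O) : A.det ∈ O := by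
  obtain ⟨B, rfl⟩ := exists_map_of_mem h
  rw [← RingHom.map_det]
  exact B.det.2

/-- A matrix over `O` is invertible over `O` as soon as its determinant is a unit. -/
theorem inv_mem_of_mem {g : GL (Fin 3) K}
    (h : ∀ i j, (g : Matrix (Fin 3) (Fin 3) K) i j ∈ O)
    (hd : O.valuation (g : Matrix (Fin 3) (Fin 3) K).det = 1) :
    ∃ B : GL (Fin 3) O, g = GeneralLinearGroup.map (n := Fin 3) O.subtype B := by
  obtain ⟨B, hB⟩ := exists_map_of_mem h
  have hu : IsUnit B.det := by
    rw [hB, ← RingHom.map_det] at hd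
    exact (O.valuation_eq_one_iff _).2 hd
  refine ⟨(Matrix.isUnit_iff_isUnit_det B).2 hu |>.unit, ?_⟩
  ext i j
  exact congrFun (congrFun hB i) j

theorem lattice_map (B : GL (Fin 3) O) (g : GL (Fin 3) K) :
    lattice O (g * GeneralLinearGroup.map (n := Fin 3) O.subtype B) = lattice O g := by
  have h1 : ∀ (B : GL (Fin 3) O) (g : GL (Fin 3) K),
      lattice O (g * GeneralLinearGroup.map (n := Fin 3) O.subtype B) ≤ lattice O g := by
    intro B g
    rw [lattice_le_iff, inv_mul_cancel_left]
    exact fun i j => ((B : Matrix (Fin 3) (Fin 3) O) i j).2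
  refine le_antisymm (h1 B g) ?_
  have h2 := h1 B⁻¹ (g * GeneralLinearGroup.map (n := Fin 3) O.subtype B)
  rwa [map_inv, mul_inv_cancel_right] at h2

theorem vol_le_of_le {g g' : GL (Fin 3) K} (h : lattice O g ≤ lattice O g') :
    vol hϖ g' ≤ vol hϖ g := by
  have h1 := det_mem_of_mem (lattice_le_iff.1 h)
  rw [mem_iff_ord_nonneg hϖ (det_ne_zero _)] at h1
  have h2 := vol_mul hϖ g'⁻¹ g
  rw [vol_inv] at h2
  change 0 ≤ vol hϖ _ at h1
  omega

/-- The transition matrix is integral with unit determinant. Most equalities of lattices below are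
proved in this way, from one inclusion and a comparison of volumes. -/
theorem lattice_eq_of_le_of_vol_le {g g' : GL (Fin 3) K} (h : lattice O g ≤ lattice O g')
    (hv : vol hϖ g ≤ vol hϖ g') : lattice O g = lattice O g' := by
  have h2 := vol_mul hϖ g'⁻¹ g
  rw [vol_inv, show -vol hϖ g' + vol hϖ g = 0 by have := vol_le_of_le hϖ h; omega] at h2
  obtain ⟨B, hB⟩ := inv_mem_of_mem (lattice_le_iff.1 h) (by
    rw [valuation_eq_zpow_ord hϖ (det_ne_zero _), ← vol, h2, zpow_zero])
  rw [inv_mul_eq_iff_eq_mul] at hB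
  rw [hB, lattice_map]

theorem vol_lt_of_lt {g g' : GL (Fin 3) K} (h : lattice O g < lattice O g') :
    vol hϖ g' < vol hϖ g := by
  by_contra hv
  exact h.ne (lattice_eq_of_le_of_vol_le hϖ h.le (not_lt.1 hv))

theorem vol_eq_of_lattice_eq {g g' : GL (Fin 3) K} (h : lattice O g = lattice O g') :
    vol hϖ g = vol hϖ g' :=
  le_antisymm (vol_le_of_le hϖ h.ge) (vol_le_of_le hϖ h.le)

theorem mem_smul_iff {a : K} (ha : a ≠ 0) {L : Submodule O (Fin 3 → K)} {x : Fin 3 → K} :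
    x ∈ a • L ↔ a⁻¹ • x ∈ L := by
  rw [Submodule.mem_smul_pointwise_iff_exists]
  constructor
  · rintro ⟨b, hb, rfl⟩
    rwa [inv_smul_smul₀ ha]
  · exact fun h => ⟨_, h, smul_inv_smul₀ ha x⟩

theorem smul_le_smul_iff {a : K} (ha : a ≠ 0) {L M : Submodule O (Fin 3 → K)} :
    a • L ≤ a • M ↔ L ≤ M := by
  constructor
  · intro h x hx
    have := h (Submodule.smul_mem_pointwise_smul x a L hx)
    rwa [mem_smul_iff ha, inv_smul_smul₀ ha] at this
  · exact fun h => Submodule.map_mono h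

theorem smul_lt_smul_iff {a : K} (ha : a ≠ 0) {L M : Submodule O (Fin 3 → K)} :
    a • L < a • M ↔ L < M := by
  rw [lt_iff_le_not_ge, lt_iff_le_not_ge, smul_le_smul_iff ha, smul_le_smul_iff ha]

theorem smul_le_self {a : K} (ha : a ∈ O) (L : Submodule O (Fin 3 → K)) : a • L ≤ L := by
  intro x hx
  obtain ⟨b, hb, rfl⟩ := (Submodule.mem_smul_pointwise_iff_exists _ _ _).1 hx
  exact L.smul_mem ⟨a, ha⟩ hb

theorem smul_eq_self {a : K} (ha : O.valuation a = 1) (L : Submodule O (Fin 3 → K)) :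
    a • L = L := by
  have h0 : a ≠ 0 := by
    rintro rfl
    simp at ha
  refine le_antisymm (smul_le_self ((O.valuation_le_one_iff _).1 ha.le) L) ?_
  intro x hx
  rw [mem_smul_iff h0]
  exact L.smul_mem ⟨a⁻¹, (O.valuation_le_one_iff _).1 (by rw [map_inv₀, ha, inv_one])⟩ hx

theorem lattice_scalar_mul (a : Kˣ) (g : GL (Fin 3) K) :
    lattice O (GeneralLinearGroup.scalar (Fin 3) a * g) = (a : K) • lattice O g := by
  ext x
  have h : ((a : K)⁻¹ • x) = ((GeneralLinearGroup.scalar (Fin 3) a⁻¹ : GL (Fin 3) K) :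
      Matrix (Fin 3) (Fin 3) K) *ᵥ x := by
    rw [← Units.val_inv_eq_inv_val]
    ext i
    exact (Matrix.mulVec_diagonal (fun _ => ((a⁻¹ : Kˣ) : K)) x i).symm
  rw [mem_smul_iff a.ne_zero, mem_lattice, mem_lattice, _root_.mul_inv_rev, h, ← map_inv,
    Matrix.mulVec_mulVec, Units.val_mul]

theorem scalar_comm (a : Kˣ) (g : GL (Fin 3) K) :
    GeneralLinearGroup.scalar (Fin 3) a * g = g * GeneralLinearGroup.scalar (Fin 3) a := by
  ext i j
  simp [Matrix.scalar_apply, mul_comm]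

/-- Two cosets agree if and only if the lattices are homothetic. -/
theorem vertex_eq_iff (hϖ : IsUniformizer O ϖ) {g h : GL (Fin 3) K} :
    (g : Vertex O) = (h : Vertex O) ↔ ∃ a : Kˣ, lattice O h = (a : K) • lattice O g := by
  have hn : (GeneralLinearGroup.scalar (Fin 3) : Kˣ →* GL (Fin 3) K).range.Normal := by
    refine ⟨?_⟩
    rintro _ ⟨a, rfl⟩ g
    rw [← scalar_comm, mul_inv_cancel_right]
    exact ⟨a, rfl⟩
  rw [QuotientGroup.eq]
  constructor
  · intro hm
    -- The scalars are normal, so an element of the join is a scalar times a matrix in `GL₃(O)`.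
    rw [scalarMaximal, Subgroup.mem_sup_of_normal_left] at hm
    obtain ⟨_, ⟨a, rfl⟩, _, ⟨B, rfl⟩, hab⟩ := hm
    refine ⟨a, ?_⟩
    rw [eq_inv_mul_iff_mul_eq, ← mul_assoc] at hab
    rw [← hab, lattice_map, ← scalar_comm, lattice_scalar_mul]
  · rintro ⟨a, ha⟩
    rw [← lattice_scalar_mul] at ha
    obtain ⟨B, hB⟩ := inv_mem_of_mem (lattice_le_iff.1 ha.le) (by
      rw [valuation_eq_zpow_ord hϖ (det_ne_zero _), ← vol, vol_mul, vol_inv,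
        vol_eq_of_lattice_eq hϖ ha, neg_add_cancel, zpow_zero])
    rw [inv_mul_eq_iff_eq_mul] at hB
    rw [hB, scalar_comm, mul_assoc, inv_mul_cancel_left]
    exact mul_mem (Subgroup.mem_sup_left ⟨a, rfl⟩) (Subgroup.mem_sup_right ⟨B, rfl⟩)

end Lattices

end BruhatTits

/-! ### Sums and duals of lattices -/

namespace BruhatTits

open Matrix

section Duality

variable {K : Type*} [Field K] {O : ValuationSubring K} {ϖ : K}

/-- The sum is finitely generated, torsion free and of full rank over the principal ideal ring `O`,
hence free of rank 3; the columns of `k` are a basis. -/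
theorem exists_lattice_sup [IsPrincipalIdealRing O] (g h : GL (Fin 3) K) :
    ∃ k : GL (Fin 3) K, lattice O k = lattice O g ⊔ lattice O h := by
  have isl : ∀ g : GL (Fin 3) K, Submodule.IsLattice K (lattice O g) := by
    intro g
    refine ⟨Submodule.fg_span (Set.finite_range _), ?_⟩
    rw [eq_top_iff]
    rintro x -
    have hx : x = ∑ j, (((g⁻¹ : GL (Fin 3) K) : Matrix (Fin 3) (Fin 3) K) *ᵥ x) j •
        (fun i => (g : Matrix (Fin 3) (Fin 3) K) i j) := by
      have h1 : x = (g : Matrix (Fin 3) (Fin 3) K) *ᵥ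
          (((g⁻¹ : GL (Fin 3) K) : Matrix (Fin 3) (Fin 3) K) *ᵥ x) := by
        rw [Matrix.mulVec_mulVec, Units.mul_inv, Matrix.one_mulVec]
      conv_lhs => rw [h1]
      ext i
      rw [Finset.sum_apply]
      simp only [Matrix.mulVec, dotProduct, Pi.smul_apply, smul_eq_mul]
      exact Finset.sum_congr rfl fun j _ => mul_comm ((g : Matrix (Fin 3) (Fin 3) K) i j) _
    rw [hx]
    exact Submodule.sum_mem _ fun j _ =>
      Submodule.smul_mem _ _ (Submodule.subset_span (col_mem_lattice g j))
  have h1 := isl g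
  have h2 := isl h
  set M : Submodule O (Fin 3 → K) := lattice O g ⊔ lattice O h with hM
  have hlat : Submodule.IsLattice K M := Submodule.IsLattice.sup K _ _
  let b : Module.Basis (Fin 3) O M := Module.finBasisOfFinrankEq O M (by
    rw [Submodule.IsLattice.finrank_of_pi K M, Fintype.card_fin])
  let c : Module.Basis (Fin 3) K (Fin 3 → K) := b.extendOfIsLattice K
  have hc : ∀ j, c j = (b j : Fin 3 → K) := fun j => b.extendOfIsLattice_apply K j
  let A : Matrix (Fin 3) (Fin 3) K := (Pi.basisFun K (Fin 3)).toMatrix c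
  have hA : IsUnit A := by
    have := (Pi.basisFun K (Fin 3)).invertibleToMatrix c
    exact isUnit_of_invertible A
  refine ⟨hA.unit, ?_⟩
  have hcol : (fun j : Fin 3 => fun i : Fin 3 => (hA.unit : Matrix (Fin 3) (Fin 3) K) i j) =
      M.subtype ∘ b := by
    funext j
    exact hc j
  rw [lattice, hcol, Set.range_comp, ← Submodule.map_span, b.span_eq, Submodule.map_top,
    Submodule.range_subtype]

variable [StarRing K]

/-- The dual of a lattice for the standard Hermitian form. -/
def dual (L : Submodule O (Fin 3 → K)) : Submodule O (Fin 3 → K) where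
  carrier := {x | ∀ y ∈ L, star y ⬝ᵥ x ∈ O}
  zero_mem' y _ := by simp
  add_mem' ha hb y hy := by
    rw [dotProduct_add]
    exact add_mem (ha y hy) (hb y hy)
  smul_mem' c x hx y hy := by
    change star y ⬝ᵥ ((c : K) • x) ∈ O
    rw [dotProduct_smul]
    exact mul_mem c.2 (hx y hy)

theorem mem_dual {L : Submodule O (Fin 3 → K)} {x : Fin 3 → K} :
    x ∈ dual L ↔ ∀ y ∈ L, star y ⬝ᵥ x ∈ O := Iff.rfl

theorem dual_anti {L M : Submodule O (Fin 3 → K)} (h : L ≤ M) : dual M ≤ dual L :=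
  fun _ hx y hy => hx y (h hy)

theorem sharp_inv_coe (g : GL (Fin 3) K) :
    (((sharp g)⁻¹ : GL (Fin 3) K) : Matrix (Fin 3) (Fin 3) K) =
      star (g : Matrix (Fin 3) (Fin 3) K) := by
  change (((star g)⁻¹⁻¹ : GL (Fin 3) K) : Matrix (Fin 3) (Fin 3) K) = _
  rw [inv_inv]
  rfl

theorem sharp_sharp (g : GL (Fin 3) K) : sharp (sharp g) = g := by
  change (star (star g)⁻¹)⁻¹ = g
  rw [star_inv, star_star, inv_inv]

variable [StarStable O]

theorem star_mem_iff {x : K} : star x ∈ O ↔ x ∈ O :=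
  ⟨fun h => star_star x ▸ StarStable.star_mem h, fun h => StarStable.star_mem h⟩

/-- The inverse of `g^#` is `g*`, so the coordinates of `x` in the columns of `g^#` are the
Hermitian products of the columns of `g` with `x`. -/
theorem lattice_sharp (g : GL (Fin 3) K) : lattice O (sharp g) = dual (lattice O g) := by
  ext x
  rw [mem_lattice, mem_dual, sharp_inv_coe]
  constructor
  · intro h y hy
    refine Submodule.span_induction ?_ ?_ ?_ ?_ hy
    · rintro _ ⟨j, rfl⟩
      exact h j
    · simp
    · intro y z _ _ hy hz
      rw [star_add, add_dotProduct]
      exact add_mem hy hz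
    · intro c y _ hy
      change star ((c : K) • y) ⬝ᵥ x ∈ O
      rw [star_smul, smul_dotProduct]
      exact mul_mem (StarStable.star_mem c.2) hy
  · intro h j
    exact h _ (col_mem_lattice g j)

theorem dual_dual_lattice (g : GL (Fin 3) K) : dual (dual (lattice O g)) = lattice O g := by
  rw [← lattice_sharp, ← lattice_sharp, sharp_sharp]

omit [StarStable O] in
theorem dual_sup (L M : Submodule O (Fin 3 → K)) : dual (L ⊔ M) = dual L ⊓ dual M := by
  refine le_antisymm (le_inf (dual_anti le_sup_left) (dual_anti le_sup_right)) ?_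
  rintro x ⟨h1, h2⟩ y hy
  obtain ⟨a, ha, b, hb, rfl⟩ := Submodule.mem_sup.1 hy
  rw [star_add, add_dotProduct]
  exact add_mem (h1 a ha) (h2 b hb)

omit [StarStable O] in
theorem dual_smul {a : K} (ha : a ≠ 0) (L : Submodule O (Fin 3 → K)) :
    dual (a • L) = (star a)⁻¹ • dual L := by
  have hs : star a ≠ 0 := star_ne_zero.2 ha
  ext x
  rw [mem_smul_iff (inv_ne_zero hs), inv_inv, mem_dual, mem_dual]
  constructor
  · intro h y hy
    have := h _ (Submodule.smul_mem_pointwise_smul y a L hy)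
    rwa [star_smul, smul_dotProduct, ← dotProduct_smul] at this
  · intro h y hy
    rw [mem_smul_iff ha] at hy
    have := h _ hy
    rwa [dotProduct_smul, ← smul_dotProduct, star_smul, star_inv₀, smul_smul,
      mul_inv_cancel₀ hs, one_smul] at this

omit [StarRing K] [StarStable O] in
theorem valuation_eq_one_iff_mem {u : K} (h0 : u ≠ 0) :
    O.valuation u = 1 ↔ u ∈ O ∧ u⁻¹ ∈ O := by
  have hpos : 0 < O.valuation u := zero_lt_iff.2 ((Valuation.ne_zero_iff _).2 h0)
  rw [← O.valuation_le_one_iff, ← O.valuation_le_one_iff, map_inv₀, inv_le_one₀ hpos,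
    le_antisymm_iff]

theorem valuation_star_eq_one {u : K} (hu : O.valuation u = 1) : O.valuation (star u) = 1 := by
  have h0 : u ≠ 0 := by
    rintro rfl
    simp at hu
  rw [valuation_eq_one_iff_mem h0] at hu
  rw [valuation_eq_one_iff_mem (star_ne_zero.2 h0), ← star_inv₀, star_mem_iff, star_mem_iff]
  exact hu

variable (hϖ : IsUniformizer O ϖ)

/-- Conjugation preserves the units of `O`, so it multiplies `ord` by the constant `n = ord (star
ϖ)`. Being an involution it forces `n² = 1`, and `n ≥ 0` because it preserves `O`. -/
theorem ord_star {x : K} (hx : x ≠ 0) : ord hϖ (star x) = ord hϖ x := by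
  set n := ord hϖ (star ϖ) with hn
  have hs0 : star ϖ ≠ 0 := star_ne_zero.2 hϖ.ne_zero
  have key : ∀ x : K, x ≠ 0 → ord hϖ (star x) = n * ord hϖ x := by
    intro x hx
    obtain ⟨u, hu, hxu⟩ := exists_ord_eq hϖ hx
    obtain ⟨w, hw, hsw⟩ := exists_ord_eq hϖ hs0
    rw [ord_eq_iff hϖ (star_ne_zero.2 hx)]
    conv_lhs => rw [hxu]
    rw [star_mul', star_zpow₀, map_mul, valuation_star_eq_one hu, map_zpow₀,
      valuation_eq_zpow_ord hϖ hs0, mul_one, _root_.zpow_mul]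
  have h1 : n * n = 1 := by
    have h2 := key _ hs0
    have h3 := ord_zpow hϖ 1
    rw [zpow_one] at h3
    rw [star_star, h3] at h2
    exact h2.symm
  have h4 : 0 ≤ n := (mem_iff_ord_nonneg hϖ hs0).1 (StarStable.star_mem hϖ.mem)
  rw [key x hx, show n = 1 by nlinarith, one_mul]

theorem vol_sharp (g : GL (Fin 3) K) : vol hϖ (sharp g) = - vol hϖ g := by
  have h := vol_inv hϖ (sharp g)
  have h2 : vol hϖ (sharp g)⁻¹ = vol hϖ g := by
    rw [vol, sharp_inv_coe, Matrix.star_eq_conjTranspose, Matrix.det_conjTranspose,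
      ord_star hϖ (det_ne_zero g)]
    rfl
  omega

omit [StarRing K] [StarStable O] in
theorem smul_eq_smul_of_ord_eq {a b : K} (ha : a ≠ 0) (hb : b ≠ 0) (h : ord hϖ a = ord hϖ b)
    (L : Submodule O (Fin 3 → K)) : a • L = b • L := by
  have hu : O.valuation (b⁻¹ * a) = 1 := by
    rw [map_mul, map_inv₀, valuation_eq_zpow_ord hϖ ha, h, ← valuation_eq_zpow_ord hϖ hb,
      inv_mul_cancel₀ ((Valuation.ne_zero_iff _).2 hb)]
  conv_rhs => rw [← smul_eq_self hu L]
  rw [smul_smul, mul_inv_cancel_left₀ hb]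

end Duality

end BruhatTits

/-! ### The vertices of the fixed tree as lattices -/

namespace BruhatTits

open Matrix

section Dictionary

variable {K : Type*} [Field K] [StarRing K] {O : ValuationSubring K} {ϖ : K}

/-- The lattices that represent the vertices of the fixed tree: the self-dual lattices, and the
lattices strictly between their dual `L^#` and `ϖ⁻¹ L^#`. -/
def IsAdmissible (ϖ : K) (L : Submodule O (Fin 3 → K)) : Prop :=
  (∃ g, L = lattice O g) ∧ (dual L = L ∨ ϖ • L < dual L ∧ dual L < L)

/-- The homothety classes of a lattice and of its dual. -/
def classes (L : Submodule O (Fin 3 → K)) : Set (Vertex O) :=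
  {x | ∃ g : GL (Fin 3) K, x = (g : Vertex O) ∧ (lattice O g = L ∨ lattice O g = dual L)}

omit [StarRing K] in
theorem vertex_eq_of_lattice_eq (hϖ : IsUniformizer O ϖ) {g h : GL (Fin 3) K}
    (hgh : lattice O g = lattice O h) : (g : Vertex O) = (h : Vertex O) :=
  (vertex_eq_iff hϖ).2 ⟨1, by rw [Units.val_one, one_smul, hgh]⟩

omit [StarRing K] in
theorem vertex_scalar_mul (hϖ : IsUniformizer O ϖ) (a : Kˣ) (g : GL (Fin 3) K) :
    ((GeneralLinearGroup.scalar (Fin 3) a * g : GL (Fin 3) K) : Vertex O) = (g : Vertex O) :=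
  ((vertex_eq_iff hϖ).2 ⟨a, lattice_scalar_mul a g⟩).symm

variable [StarStable O]

theorem classes_lattice (hϖ : IsUniformizer O ϖ) (g : GL (Fin 3) K) :
    classes (lattice O g) = {(g : Vertex O), ((sharp g : GL (Fin 3) K) : Vertex O)} := by
  ext x
  simp only [classes, Set.mem_ofPred_eq, Set.mem_insert_iff, Set.mem_singleton_iff]
  constructor
  · rintro ⟨h, rfl, hh | hh⟩
    · exact Or.inl (vertex_eq_of_lattice_eq hϖ hh)
    · rw [← lattice_sharp] at hh
      exact Or.inr (vertex_eq_of_lattice_eq hϖ hh)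
  · rintro (rfl | rfl)
    · exact ⟨g, rfl, Or.inl rfl⟩
    · exact ⟨sharp g, rfl, Or.inr (lattice_sharp g)⟩

theorem vertexSharp_coe (g : GL (Fin 3) K) :
    vertexSharp O (g : Vertex O) = ((sharp g : GL (Fin 3) K) : Vertex O) := rfl

theorem vol_of_selfDual (hϖ : IsUniformizer O ϖ) {g : GL (Fin 3) K}
    (h : dual (lattice O g) = lattice O g) : vol hϖ g = 0 := by
  rw [← lattice_sharp] at h
  have := vol_eq_of_lattice_eq hϖ h
  rw [vol_sharp] at this
  omega

/-- If `v` is the volume, the two strict inclusions say `-v < 3 + v` and `v < -v`. -/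
theorem vol_of_strict (hϖ : IsUniformizer O ϖ) {g : GL (Fin 3) K}
    (h₁ : ϖ • lattice O g < dual (lattice O g)) (h₂ : dual (lattice O g) < lattice O g) :
    vol hϖ g = -1 := by
  rw [← lattice_sharp] at h₁ h₂
  rw [show ϖ = (Units.mk0 ϖ hϖ.ne_zero : Kˣ) from rfl, ← lattice_scalar_mul] at h₁
  have h3 := vol_lt_of_lt hϖ h₁
  have h4 := vol_lt_of_lt hϖ h₂
  have h5 := ord_zpow hϖ 1
  rw [zpow_one] at h5
  rw [vol_mul, vol_scalar, Units.val_mk0, h5, vol_sharp] at h3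
  rw [vol_sharp] at h4
  omega

omit [StarRing K] [StarStable O] in
/-- Triangles may be rotated: any given vertex is the middle of the chain. -/
theorem IsTriangle.exists_middle (hϖ : IsUniformizer O ϖ) {S : Set (Vertex O)}
    (hS : IsTriangle O ϖ S) {g : GL (Fin 3) K} (hg : (g : Vertex O) ∈ S) :
    ∃ g₁ g₃ : GL (Fin 3) K, S = {(g₁ : Vertex O), (g : Vertex O), (g₃ : Vertex O)} ∧
      ϖ • lattice O g₃ < lattice O g₁ ∧ lattice O g₁ < lattice O g ∧ lattice O g < lattice O g₃ := by
  have key : ∃ g₁ g₂ g₃ : GL (Fin 3) K, S = {(g₁ : Vertex O), (g₂ : Vertex O), (g₃ : Vertex O)} ∧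
      (ϖ • lattice O g₃ < lattice O g₁ ∧ lattice O g₁ < lattice O g₂ ∧
        lattice O g₂ < lattice O g₃) ∧ (g₂ : Vertex O) = (g : Vertex O) := by
    obtain ⟨g₁, g₂, g₃, rfl, h₁, h₂, h₃⟩ := hS
    let c : GL (Fin 3) K := GeneralLinearGroup.scalar (Fin 3) (Units.mk0 ϖ hϖ.ne_zero)
    have hc : ∀ g : GL (Fin 3) K, lattice O (c * g) = ϖ • lattice O g :=
      fun g => lattice_scalar_mul _ g
    have hv : ∀ g : GL (Fin 3) K, ((c * g : GL (Fin 3) K) : Vertex O) = (g : Vertex O) :=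
      fun g => vertex_scalar_mul hϖ _ g
    -- The chain continues periodically under multiplication by `ϖ`, so a shift puts any of its
    -- three members in the middle.
    rcases hg with hg | hg | hg
    · refine ⟨c * g₃, g₁, g₂, ?_, ⟨?_, ?_, h₂⟩, hg.symm⟩
      · rw [hv]
        ext x
        simp only [Set.mem_insert_iff, Set.mem_singleton_iff]
        tauto
      · rw [hc]
        exact (smul_lt_smul_iff hϖ.ne_zero).2 h₃
      · rwa [hc]
    · exact ⟨g₁, g₂, g₃, rfl, ⟨h₁, h₂, h₃⟩, hg.symm⟩
    · refine ⟨c * g₂, c * g₃, g₁, ?_, ⟨?_, ?_, ?_⟩, ?_⟩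
      · rw [hv, hv]
        ext x
        simp only [Set.mem_insert_iff, Set.mem_singleton_iff]
        tauto
      · rw [hc]
        exact (smul_lt_smul_iff hϖ.ne_zero).2 h₂
      · rw [hc, hc]
        exact (smul_lt_smul_iff hϖ.ne_zero).2 h₃
      · rwa [hc]
      · rw [hv]
        exact (Set.mem_singleton_iff.1 hg).symm
  obtain ⟨g₁, g₂, g₃, hS', ⟨h₁, h₂, h₃⟩, hgg⟩ := key
  obtain ⟨a, ha⟩ := (vertex_eq_iff hϖ).1 hgg
  refine ⟨GeneralLinearGroup.scalar (Fin 3) a * g₁, GeneralLinearGroup.scalar (Fin 3) a * g₃,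
    ?_, ?_, ?_, ?_⟩
  · rw [hS', vertex_scalar_mul hϖ, vertex_scalar_mul hϖ, hgg]
  · rw [lattice_scalar_mul, lattice_scalar_mul, smul_comm]
    exact (smul_lt_smul_iff a.ne_zero).2 h₁
  · rw [lattice_scalar_mul, ha]
    exact (smul_lt_smul_iff a.ne_zero).2 h₂
  · rw [lattice_scalar_mul, ha]
    exact (smul_lt_smul_iff a.ne_zero).2 h₃

omit [StarRing K] [StarStable O] in
theorem IsEdge.exists_chain (hϖ : IsUniformizer O ϖ) {x y : Vertex O} (h : IsEdge O ϖ x y) :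
    ∃ g k : GL (Fin 3) K, x = (g : Vertex O) ∧ y = (k : Vertex O) ∧
      ϖ • lattice O k < lattice O g ∧ lattice O g < lattice O k := by
  obtain ⟨hne, S, hS, hx, hy⟩ := h
  obtain ⟨g, rfl⟩ := QuotientGroup.mk_surjective x
  obtain ⟨g₁, g₃, rfl, h₁, h₂, h₃⟩ := hS.exists_middle hϖ hx
  rcases hy with rfl | rfl | rfl
  · let c : GL (Fin 3) K := GeneralLinearGroup.scalar (Fin 3) (Units.mk0 ϖ hϖ.ne_zero)⁻¹
    have hc : lattice O (c * g₁) = ϖ⁻¹ • lattice O g₁ := lattice_scalar_mul _ g₁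
    refine ⟨g, c * g₁, rfl, (vertex_scalar_mul hϖ _ g₁).symm, ?_, ?_⟩
    · rwa [hc, smul_smul, mul_inv_cancel₀ hϖ.ne_zero, one_smul]
    · rw [hc, ← smul_lt_smul_iff hϖ.ne_zero, smul_smul, mul_inv_cancel₀ hϖ.ne_zero, one_smul]
      exact ((smul_lt_smul_iff hϖ.ne_zero).2 h₃).trans h₁
  · exact absurd rfl hne
  · exact ⟨g, g₃, rfl, rfl, h₁.trans h₂, h₃⟩

/-- If `L = a L^#`, comparing volumes gives `2 vol L = 3 ord a`. So `ord a = 2m` is even, and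
scaling `L` by `ϖ^(-m)` makes it self-dual. -/
theorem exists_selfDual (hϖ : IsUniformizer O ϖ) {x : Vertex O} (hx : vertexSharp O x = x) :
    ∃ g : GL (Fin 3) K, x = (g : Vertex O) ∧ dual (lattice O g) = lattice O g := by
  obtain ⟨g, rfl⟩ := QuotientGroup.mk_surjective x
  obtain ⟨a, ha⟩ := (vertex_eq_iff hϖ).1 hx
  have hv := vol_eq_of_lattice_eq hϖ (ha.trans (lattice_scalar_mul a (sharp g)).symm)
  rw [vol_mul, vol_scalar, vol_sharp] at hv
  obtain ⟨m, hm⟩ : ∃ m, ord hϖ (a : K) = 2 * m := ⟨ord hϖ (a : K) / 2, by omega⟩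
  let b : Kˣ := Units.mk0 (ϖ ^ (-m)) (zpow_ne_zero _ hϖ.ne_zero)
  have hb : ord hϖ (b : K) = -m := ord_zpow hϖ (-m)
  refine ⟨GeneralLinearGroup.scalar (Fin 3) b * g, (vertex_scalar_mul hϖ b g).symm, ?_⟩
  have hs : star (b : K) ≠ 0 := star_ne_zero.2 b.ne_zero
  rw [lattice_scalar_mul, dual_smul b.ne_zero, ← lattice_sharp, ha, smul_smul]
  refine smul_eq_smul_of_ord_eq hϖ (inv_ne_zero hs) (mul_ne_zero b.ne_zero a.ne_zero) ?_ _
  rw [ord_inv hϖ hs, ord_star hϖ b.ne_zero, ord_mul hϖ b.ne_zero a.ne_zero]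
  omega

/-- Here `L^#` is homothetic to the other lattice of the chain, by a factor `a`. For even `ord a` a
multiple of the larger lattice `k` has the required form, for odd `ord a` a multiple of the smaller
lattice `g`. -/
theorem exists_strict (hϖ : IsUniformizer O ϖ) {x y : Vertex O} (hxy : IsEdge O ϖ x y)
    (hx : vertexSharp O x = y) :
    ∃ g : GL (Fin 3) K, ({x, y} : Set (Vertex O)) = classes (lattice O g) ∧
      ϖ • lattice O g < dual (lattice O g) ∧ dual (lattice O g) < lattice O g := by
  obtain ⟨g, k, rfl, rfl, h₁, h₂⟩ := hxy.exists_chain hϖ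
  obtain ⟨a, ha⟩ := (vertex_eq_iff hϖ).1 hx
  have hv := vol_eq_of_lattice_eq hϖ (ha.trans (lattice_scalar_mul a (sharp g)).symm)
  rw [vol_mul, vol_scalar, vol_sharp] at hv
  have hv1 : vol hϖ g < 3 + vol hϖ k := by
    rw [show ϖ = (Units.mk0 ϖ hϖ.ne_zero : Kˣ) from rfl, ← lattice_scalar_mul] at h₁
    have := vol_lt_of_lt hϖ h₁
    have h5 := ord_zpow hϖ 1
    rw [zpow_one] at h5
    rwa [vol_mul, vol_scalar, Units.val_mk0, h5, mul_one] at this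
  have hv2 := vol_lt_of_lt hϖ h₂
  have hdk : dual (lattice O g) = (a : K)⁻¹ • lattice O k := by
    rw [ha, smul_smul, inv_mul_cancel₀ a.ne_zero, one_smul, lattice_sharp]
  have hdg : dual (lattice O k) = (star (a : K))⁻¹ • lattice O g := by
    rw [ha, dual_smul a.ne_zero, lattice_sharp, dual_dual_lattice]
  have hsa : star (a : K) ≠ 0 := star_ne_zero.2 a.ne_zero
  rcases Int.even_or_odd' (ord hϖ (a : K)) with ⟨m, hm | hm⟩
  · let b : Kˣ := Units.mk0 (ϖ ^ (-m)) (zpow_ne_zero _ hϖ.ne_zero)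
    have hb : ord hϖ (b : K) = -m := ord_zpow hϖ (-m)
    have hs : star (b : K) ≠ 0 := star_ne_zero.2 b.ne_zero
    have hd : dual (lattice O (GeneralLinearGroup.scalar (Fin 3) b * k)) = (b : K) • lattice O g := by
      rw [lattice_scalar_mul, dual_smul b.ne_zero, hdg, smul_smul]
      refine smul_eq_smul_of_ord_eq hϖ (mul_ne_zero (inv_ne_zero hs) (inv_ne_zero hsa)) b.ne_zero
        ?_ _
      rw [ord_mul hϖ (inv_ne_zero hs) (inv_ne_zero hsa), ord_inv hϖ hs, ord_inv hϖ hsa,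
        ord_star hϖ b.ne_zero, ord_star hϖ a.ne_zero]
      omega
    refine ⟨GeneralLinearGroup.scalar (Fin 3) b * k, ?_, ?_, ?_⟩
    · rw [classes_lattice hϖ, vertex_scalar_mul hϖ, ← vertexSharp_coe, vertex_scalar_mul hϖ,
        Set.pair_comm]
      congr 1
      rw [← hx, vertexSharp_coe, vertexSharp_coe, sharp_sharp]
    · rw [hd, lattice_scalar_mul, smul_comm]
      exact (smul_lt_smul_iff b.ne_zero).2 h₁
    · rw [hd, lattice_scalar_mul]
      exact (smul_lt_smul_iff b.ne_zero).2 h₂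
  · let b : Kˣ := Units.mk0 (ϖ ^ (-m - 1)) (zpow_ne_zero _ hϖ.ne_zero)
    have hb : ord hϖ (b : K) = -m - 1 := ord_zpow hϖ (-m - 1)
    have hs : star (b : K) ≠ 0 := star_ne_zero.2 b.ne_zero
    have h5 := ord_zpow hϖ 1
    rw [zpow_one] at h5
    have hd : dual (lattice O (GeneralLinearGroup.scalar (Fin 3) b * g)) =
        (b : K) • ϖ • lattice O k := by
      rw [lattice_scalar_mul, dual_smul b.ne_zero, hdk, smul_smul, smul_smul]
      refine smul_eq_smul_of_ord_eq hϖ (mul_ne_zero (inv_ne_zero hs) (inv_ne_zero a.ne_zero))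
        (mul_ne_zero b.ne_zero hϖ.ne_zero) ?_ _
      rw [ord_mul hϖ (inv_ne_zero hs) (inv_ne_zero a.ne_zero), ord_inv hϖ hs,
        ord_inv hϖ a.ne_zero, ord_star hϖ b.ne_zero, ord_mul hϖ b.ne_zero hϖ.ne_zero]
      omega
    refine ⟨GeneralLinearGroup.scalar (Fin 3) b * g, ?_, ?_, ?_⟩
    · rw [classes_lattice hϖ, vertex_scalar_mul hϖ, ← vertexSharp_coe, vertex_scalar_mul hϖ, hx]
    · rw [hd, lattice_scalar_mul, smul_comm]
      exact (smul_lt_smul_iff b.ne_zero).2 ((smul_lt_smul_iff hϖ.ne_zero).2 h₂)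
    · rw [hd, lattice_scalar_mul]
      exact (smul_lt_smul_iff b.ne_zero).2 h₁

omit [StarRing K] [StarStable O] in
theorem isEdge_of_chain (hϖ : IsUniformizer O ϖ) {g₁ g₂ g₃ : GL (Fin 3) K}
    (h₁ : ϖ • lattice O g₃ < lattice O g₁) (h₂ : lattice O g₁ < lattice O g₂)
    (h₃ : lattice O g₂ < lattice O g₃) : IsEdge O ϖ (g₃ : Vertex O) (g₁ : Vertex O) := by
  refine ⟨?_, _, ⟨g₁, g₂, g₃, rfl, h₁, h₂, h₃⟩, by simp, by simp⟩
  intro h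
  obtain ⟨a, ha⟩ := (vertex_eq_iff hϖ).1 h
  have hv := vol_eq_of_lattice_eq hϖ (ha.trans (lattice_scalar_mul a g₃).symm)
  rw [show ϖ = (Units.mk0 ϖ hϖ.ne_zero : Kˣ) from rfl, ← lattice_scalar_mul] at h₁
  have h4 := vol_lt_of_lt hϖ h₁
  have h5 := ord_zpow hϖ 1
  rw [zpow_one] at h5
  rw [vol_mul, vol_scalar] at h4 hv
  rw [Units.val_mk0, h5] at h4
  have := vol_lt_of_lt hϖ h₂
  have := vol_lt_of_lt hϖ h₃
  omega

/-- The self-dual lattice `L` lies strictly between `M^#` and `M`. -/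
def Incident (ϖ : K) (L M : Submodule O (Fin 3 → K)) : Prop :=
  dual L = L ∧ ϖ • M < dual M ∧ dual M < L ∧ L < M

/-- A homothety changes the volume by a multiple of 3, while admissible lattices and their duals
have volumes 0, -1 or 1, which are distinct modulo 3. Hence homothetic ones coincide. -/
theorem classes_injective (hϖ : IsUniformizer O ϖ) {L M : Submodule O (Fin 3 → K)}
    (hL : IsAdmissible ϖ L) (hM : IsAdmissible ϖ M) (h : classes L = classes M) : L = M := by
  obtain ⟨⟨g, rfl⟩, hL⟩ := hL
  obtain ⟨⟨m, rfl⟩, hM⟩ := hM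
  have hg : vol hϖ g = 0 ∧ dual (lattice O g) = lattice O g ∨ vol hϖ g = -1 :=
    hL.imp (fun h => ⟨vol_of_selfDual hϖ h, h⟩) (fun h => vol_of_strict hϖ h.1 h.2)
  have hm : vol hϖ m = 0 ∧ dual (lattice O m) = lattice O m ∨ vol hϖ m = -1 :=
    hM.imp (fun h => ⟨vol_of_selfDual hϖ h, h⟩) (fun h => vol_of_strict hϖ h.1 h.2)
  have h1 : (g : Vertex O) ∈ classes (lattice O m) := h ▸ ⟨g, rfl, Or.inl rfl⟩
  obtain ⟨k, hgk, hk⟩ := h1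
  have hvk : vol hϖ k = vol hϖ m ∨ vol hϖ k = - vol hϖ m := by
    refine hk.imp (vol_eq_of_lattice_eq hϖ) fun hk => ?_
    rw [← lattice_sharp] at hk
    rw [vol_eq_of_lattice_eq hϖ hk, vol_sharp]
  obtain ⟨a, ha⟩ := (vertex_eq_iff hϖ).1 hgk
  have hv := vol_eq_of_lattice_eq hϖ (ha.trans (lattice_scalar_mul a g).symm)
  rw [vol_mul, vol_scalar] at hv
  have ha0 : ord hϖ (a : K) = 0 := by omega
  have hgk : lattice O k = lattice O g := by
    have := smul_eq_smul_of_ord_eq hϖ a.ne_zero one_ne_zero (ha0.trans (ord_one hϖ).symm)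
      (lattice O g)
    rwa [one_smul, ← ha] at this
  have hvg := vol_eq_of_lattice_eq hϖ hgk
  rcases hk with hk | hk
  · rw [← hgk, hk]
  · rcases hm with hm | hm
    · rw [← hgk, hk, hm.2]
    · rw [← lattice_sharp] at hk
      have := vol_eq_of_lattice_eq hϖ hk
      rw [vol_sharp] at this
      omega

theorem exists_admissible (hϖ : IsUniformizer O ϖ) (s : TreeVertex O ϖ) :
    ∃ L : Submodule O (Fin 3 → K), IsAdmissible ϖ L ∧ s.1 = classes L := by
  rcases s.2 with ⟨x, hx, hs⟩ | ⟨x, y, hxy, hx, -, hs⟩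
  · obtain ⟨g, rfl, hg⟩ := exists_selfDual hϖ hx
    refine ⟨_, ⟨⟨g, rfl⟩, Or.inl hg⟩, ?_⟩
    rw [classes_lattice hϖ, ← vertexSharp_coe, hx, Set.pair_eq_singleton, hs]
  · obtain ⟨g, h1, h2, h3⟩ := exists_strict hϖ hxy hx
    exact ⟨_, ⟨⟨g, rfl⟩, Or.inr ⟨h2, h3⟩⟩, hs.trans h1⟩

/-- The admissible lattice of a vertex of the fixed tree. -/
def top (hϖ : IsUniformizer O ϖ) (s : TreeVertex O ϖ) : Submodule O (Fin 3 → K) :=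
  (exists_admissible hϖ s).choose

theorem top_admissible (hϖ : IsUniformizer O ϖ) (s : TreeVertex O ϖ) :
    IsAdmissible ϖ (top hϖ s) := (exists_admissible hϖ s).choose_spec.1

theorem classes_top (hϖ : IsUniformizer O ϖ) (s : TreeVertex O ϖ) : s.1 = classes (top hϖ s) :=
  (exists_admissible hϖ s).choose_spec.2

theorem top_injective (hϖ : IsUniformizer O ϖ) : Function.Injective (top hϖ (O := O)) := by
  intro s t h
  refine Subtype.ext ?_
  rw [classes_top hϖ s, classes_top hϖ t, h]

theorem top_eq_of_classes (hϖ : IsUniformizer O ϖ) {s : TreeVertex O ϖ}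
    {L : Submodule O (Fin 3 → K)} (hL : IsAdmissible ϖ L) (h : s.1 = classes L) :
    top hϖ s = L :=
  classes_injective hϖ (top_admissible hϖ s) hL ((classes_top hϖ s).symm.trans h)

theorem mem_fixedVertices_of_selfDual (hϖ : IsUniformizer O ϖ) {g : GL (Fin 3) K}
    (hg : dual (lattice O g) = lattice O g) : classes (lattice O g) ∈ fixedVertices O := by
  have h : vertexSharp O (g : Vertex O) = (g : Vertex O) :=
    vertex_eq_of_lattice_eq hϖ (by rw [lattice_sharp, hg])
  exact ⟨_, h, by rw [classes_lattice hϖ, ← vertexSharp_coe, h, Set.pair_eq_singleton]⟩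

theorem selfDual_of_mem_fixedVertices (hϖ : IsUniformizer O ϖ) {s : TreeVertex O ϖ}
    (hs : s.1 ∈ fixedVertices O) : dual (top hϖ s) = top hϖ s := by
  obtain ⟨x, hx, hs⟩ := hs
  obtain ⟨g, rfl, hg⟩ := exists_selfDual hϖ hx
  rw [top_eq_of_classes hϖ (L := lattice O g) ⟨⟨g, rfl⟩, Or.inl hg⟩ ?_, hg]
  rw [classes_lattice hϖ, ← vertexSharp_coe, hx, Set.pair_eq_singleton, hs]

theorem strict_of_mem_reflectedEdges (hϖ : IsUniformizer O ϖ) {s : TreeVertex O ϖ}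
    (hs : s.1 ∈ reflectedEdges O ϖ) :
    ϖ • top hϖ s < dual (top hϖ s) ∧ dual (top hϖ s) < top hϖ s := by
  obtain ⟨x, y, hxy, hx, -, hs⟩ := hs
  obtain ⟨g, h1, h2, h3⟩ := exists_strict hϖ hxy hx
  rw [top_eq_of_classes hϖ (L := lattice O g) ⟨⟨g, rfl⟩, Or.inr ⟨h2, h3⟩⟩ (hs.trans h1)]
  exact ⟨h2, h3⟩

theorem mem_reflectedEdges_of_incident (hϖ : IsUniformizer O ϖ) {l m : GL (Fin 3) K}
    (h : Incident ϖ (lattice O l) (lattice O m)) :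
    classes (lattice O m) ∈ reflectedEdges O ϖ := by
  obtain ⟨h1, h2, h3, h4⟩ := h
  refine ⟨(m : Vertex O), ((sharp m : GL (Fin 3) K) : Vertex O), ?_, rfl, ?_,
    classes_lattice hϖ m⟩
  · rw [← lattice_sharp] at h2 h3
    exact isEdge_of_chain hϖ h2 h3 h4
  · rw [vertexSharp_coe, sharp_sharp]

theorem isTriangle_of_incident (hϖ : IsUniformizer O ϖ) {l m : GL (Fin 3) K}
    (h : Incident ϖ (lattice O l) (lattice O m)) :
    IsTriangle O ϖ (classes (lattice O l) ∪ classes (lattice O m)) := by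
  obtain ⟨h1, h2, h3, h4⟩ := h
  rw [← lattice_sharp] at h2 h3
  refine ⟨sharp m, l, m, ?_, h2, h3, h4⟩
  have hl : ((sharp l : GL (Fin 3) K) : Vertex O) = (l : Vertex O) :=
    vertex_eq_of_lattice_eq hϖ (by rw [lattice_sharp, h1])
  rw [classes_lattice hϖ, classes_lattice hϖ, hl]
  ext x
  simp only [Set.mem_union, Set.mem_insert_iff, Set.mem_singleton_iff]
  tauto

/-- With the self-dual lattice in the middle of the chain, the volume of `g₃` can only be -1. Among
`l`, `m` and their duals only `m` has this volume modulo 3, so the largest lattice of the chain is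
the one generated by `m`. -/
theorem incident_of_isTriangle (hϖ : IsUniformizer O ϖ) {s t : TreeVertex O ϖ}
    (hs : s.1 ∈ fixedVertices O) (ht : t.1 ∈ reflectedEdges O ϖ)
    (h : IsTriangle O ϖ (s.1 ∪ t.1)) : Incident ϖ (top hϖ s) (top hϖ t) := by
  have hL := selfDual_of_mem_fixedVertices hϖ hs
  have hM := strict_of_mem_reflectedEdges hϖ ht
  obtain ⟨⟨l, hl⟩, -⟩ := top_admissible hϖ s
  obtain ⟨⟨m, hm⟩, -⟩ := top_admissible hϖ t
  have hcs := classes_top hϖ s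
  have hct := classes_top hϖ t
  rw [hl] at hL hcs ⊢
  rw [hm] at hM hct ⊢
  have hlS : (l : Vertex O) ∈ s.1 ∪ t.1 := Or.inl (hcs ▸ ⟨l, rfl, Or.inl rfl⟩)
  obtain ⟨g₁, g₃, hS, h₁, h₂, h₃⟩ := h.exists_middle hϖ hlS
  have hvl := vol_of_selfDual hϖ hL
  have hvm := vol_of_strict hϖ hM.1 hM.2
  have h5 := ord_zpow hϖ 1
  rw [zpow_one] at h5
  rw [show ϖ = (Units.mk0 ϖ hϖ.ne_zero : Kˣ) from rfl, ← lattice_scalar_mul] at h₁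
  have e₁ := vol_lt_of_lt hϖ h₁
  have e₂ := vol_lt_of_lt hϖ h₂
  have e₃ := vol_lt_of_lt hϖ h₃
  rw [vol_mul, vol_scalar, Units.val_mk0, h5] at e₁
  have hg : (g₃ : Vertex O) ∈ s.1 ∪ t.1 := by
    rw [hS]
    simp
  have key : ∀ k : GL (Fin 3) K, (g₃ : Vertex O) = (k : Vertex O) →
      ∃ a : Kˣ, lattice O g₃ = (a : K) • lattice O k ∧
        vol hϖ g₃ = 3 * ord hϖ (a : K) + vol hϖ k := by
    intro k hk
    obtain ⟨a, ha⟩ := (vertex_eq_iff hϖ).1 hk.symm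
    have hv := vol_eq_of_lattice_eq hϖ (ha.trans (lattice_scalar_mul a k).symm)
    rw [vol_mul, vol_scalar] at hv
    exact ⟨a, ha, hv⟩
  have hle : lattice O l < lattice O m := by
    rw [hcs, hct, classes_lattice hϖ, classes_lattice hϖ] at hg
    rcases hg with (hg | hg) | hg | hg
    · obtain ⟨a, -, ha⟩ := key _ hg
      omega
    · obtain ⟨a, -, ha⟩ := key _ hg
      rw [vol_sharp] at ha
      omega
    · obtain ⟨a, ha, hv⟩ := key _ hg
      rw [smul_eq_smul_of_ord_eq hϖ a.ne_zero one_ne_zero (by rw [ord_one]; omega), one_smul] at ha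
      rwa [← ha]
    · obtain ⟨a, -, ha⟩ := key _ hg
      rw [vol_sharp] at ha
      omega
  refine ⟨hL, hM.1, lt_of_le_of_ne ?_ ?_, hle⟩
  · exact (dual_anti hle.le).trans hL.le
  · intro h
    rw [← lattice_sharp] at h
    have := vol_eq_of_lattice_eq hϖ h
    rw [vol_sharp] at this
    omega

theorem adj_iff (hϖ : IsUniformizer O ϖ) {s t : TreeVertex O ϖ} :
    (tree O ϖ).Adj s t ↔
      Incident ϖ (top hϖ s) (top hϖ t) ∨ Incident ϖ (top hϖ t) (top hϖ s) := by
  have mp : ∀ s t : TreeVertex O ϖ, Incident ϖ (top hϖ s) (top hϖ t) → (tree O ϖ).Adj s t := by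
    intro s t h
    obtain ⟨l, hl⟩ := (top_admissible hϖ s).1
    obtain ⟨m, hm⟩ := (top_admissible hϖ t).1
    rw [hl, hm] at h
    refine ⟨Or.inl ⟨?_, ?_⟩, ?_⟩
    · rw [classes_top hϖ s, hl]
      exact mem_fixedVertices_of_selfDual hϖ h.1
    · rw [classes_top hϖ t, hm]
      exact mem_reflectedEdges_of_incident hϖ h
    · rw [classes_top hϖ s, classes_top hϖ t, hl, hm]
      exact isTriangle_of_incident hϖ h
  constructor
  · rintro ⟨⟨hs, ht⟩ | ⟨hs, ht⟩, h⟩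
    · exact Or.inl (incident_of_isTriangle hϖ hs ht h)
    · rw [Set.union_comm] at h
      exact Or.inr (incident_of_isTriangle hϖ ht hs h)
  · rintro (h | h)
    · exact mp s t h
    · exact (mp t s h).symm

theorem exists_top_eq_of_selfDual (hϖ : IsUniformizer O ϖ) {g : GL (Fin 3) K}
    (hg : dual (lattice O g) = lattice O g) : ∃ s : TreeVertex O ϖ, top hϖ s = lattice O g :=
  ⟨⟨classes (lattice O g), Or.inl (mem_fixedVertices_of_selfDual hϖ hg)⟩,
    top_eq_of_classes hϖ ⟨⟨g, rfl⟩, Or.inl hg⟩ rfl⟩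

theorem exists_top_eq_of_incident (hϖ : IsUniformizer O ϖ) {l m : GL (Fin 3) K}
    (h : Incident ϖ (lattice O l) (lattice O m)) : ∃ t : TreeVertex O ϖ, top hϖ t = lattice O m :=
  ⟨⟨classes (lattice O m), Or.inr (mem_reflectedEdges_of_incident hϖ h)⟩,
    top_eq_of_classes hϖ ⟨⟨m, rfl⟩, Or.inr ⟨h.2.1, h.2.2.1.trans h.2.2.2⟩⟩ rfl⟩

theorem top_baseVertex (hϖ : IsUniformizer O ϖ) : top hϖ (baseVertex O ϖ) = lattice O 1 := by
  have h : dual (lattice O (1 : GL (Fin 3) K)) = lattice O 1 := by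
    rw [← lattice_sharp, map_one]
  refine top_eq_of_classes hϖ ⟨⟨1, rfl⟩, Or.inl h⟩ ?_
  rw [classes_lattice hϖ, map_one, Set.pair_eq_singleton]
  rfl

/-- The image of a lattice under a matrix. -/
def act (g : GL (Fin 3) K) (L : Submodule O (Fin 3 → K)) : Submodule O (Fin 3 → K) :=
  L.map ((Matrix.mulVecLin (g : Matrix (Fin 3) (Fin 3) K)).restrictScalars O)

omit [StarRing K] [StarStable O] in
theorem act_lattice (g h : GL (Fin 3) K) : act g (lattice O h) = lattice O (g * h) :=
  (lattice_mul O g h).symm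

theorem top_smul (hϖ : IsUniformizer O ϖ) (g : fixedGroup K) (s : TreeVertex O ϖ) :
    top hϖ (g • s) = act (g : GL (Fin 3) K) (top hϖ s) := by
  obtain ⟨⟨l, hl⟩, hL⟩ := top_admissible hϖ s
  have hcs := classes_top hϖ s
  have hg : sharp (g : GL (Fin 3) K) = g := g.2
  rw [hl] at hL hcs ⊢
  rw [act_lattice]
  refine top_eq_of_classes hϖ ⟨⟨_, rfl⟩, ?_⟩ ?_
  · rw [← lattice_sharp] at hL ⊢
    rw [map_mul, hg]
    refine hL.imp (fun h => ?_) (fun h => ?_)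
    · rw [← act_lattice, h, act_lattice]
    · rw [show ϖ = (Units.mk0 ϖ hϖ.ne_zero : Kˣ) from rfl, ← lattice_scalar_mul] at h ⊢
      rw [← mul_assoc, scalar_comm, mul_assoc, lattice_mul O (g : GL (Fin 3) K) (_ * l),
        lattice_mul O (g : GL (Fin 3) K) (sharp l), lattice_mul O (g : GL (Fin 3) K) l]
      exact ⟨lattice_mul_lt O _ h.1, lattice_mul_lt O _ h.2⟩
  · rw [coe_smul_treeVertex, hcs, classes_lattice hϖ, classes_lattice hϖ, map_mul, hg,
      ← Set.image_smul, Set.image_pair]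
    rfl

end Dictionary

end BruhatTits

/-! ### Exponents of lattices relative to the standard lattice -/

namespace BruhatTits

open Matrix

/-- The function `r` is the distance from the root `v` in a tree: there is one step towards the
root from every other vertex, and all other steps lead away from it. -/
structure IsRootedTree {V : Type*} (T : SimpleGraph V) (r : V → ℕ) (v : V) : Prop where
  root : ∀ x, r x = 0 ↔ x = v
  adj : ∀ x y, T.Adj x y → r x = r y + 1 ∨ r y = r x + 1
  parent : ∀ x, x ≠ v → ∃! y, T.Adj x y ∧ r y < r x

section Radius

variable {K : Type*} [Field K] {O : ValuationSubring K} {ϖ : K}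

theorem exists_zpow_smul_mem (hϖ : IsUniformizer O ϖ) (x : K) : ∃ k : ℕ, ϖ ^ k * x ∈ O := by
  rcases eq_or_ne x 0 with rfl | hx
  · exact ⟨0, by simp⟩
  · refine ⟨(-ord hϖ x).toNat, ?_⟩
    have h1 := ord_zpow hϖ ((-ord hϖ x).toNat : ℤ)
    rw [zpow_natCast] at h1
    rw [mem_iff_ord_nonneg hϖ (mul_ne_zero (pow_ne_zero _ hϖ.ne_zero) hx),
      ord_mul hϖ (pow_ne_zero _ hϖ.ne_zero) hx, h1]
    omega

theorem pow_smul_le_of_le (hϖ : IsUniformizer O ϖ) {L M : Submodule O (Fin 3 → K)} {m n : ℕ}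
    (h : ϖ ^ m • L ≤ M) (hmn : m ≤ n) : ϖ ^ n • L ≤ M := by
  obtain ⟨d, rfl⟩ := Nat.exists_eq_add_of_le hmn
  rw [add_comm, pow_add, mul_smul]
  exact (smul_le_self (pow_mem hϖ.mem d) _).trans h

theorem exists_pow_smul_le (hϖ : IsUniformizer O ϖ) (g : GL (Fin 3) K) :
    ∃ k : ℕ, ϖ ^ k • lattice O g ≤ lattice O 1 := by
  choose f hf using fun i j => exists_zpow_smul_mem hϖ ((g : Matrix (Fin 3) (Fin 3) K) i j)
  refine ⟨∑ i, ∑ j, f i j, ?_⟩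
  rw [← Units.val_mk0 (pow_ne_zero _ hϖ.ne_zero), ← lattice_scalar_mul, lattice_le_iff]
  intro i j
  have h1 : f i j ≤ ∑ i, ∑ j, f i j :=
    (Finset.single_le_sum (fun j _ => Nat.zero_le (f i j)) (Finset.mem_univ j)).trans
      (Finset.single_le_sum (f := fun i => ∑ j, f i j) (fun i _ => Nat.zero_le _)
        (Finset.mem_univ i))
  obtain ⟨d, hd⟩ := Nat.exists_eq_add_of_le h1
  rw [inv_one, one_mul, scalar_comm]
  have : ((g * GeneralLinearGroup.scalar (Fin 3) (Units.mk0 (ϖ ^ ∑ i, ∑ j, f i j)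
      (pow_ne_zero _ hϖ.ne_zero)) : GL (Fin 3) K) : Matrix (Fin 3) (Fin 3) K) i j =
      ϖ ^ d * (ϖ ^ f i j * (g : Matrix (Fin 3) (Fin 3) K) i j) := by
    rw [← mul_assoc, ← pow_add, add_comm, ← hd]
    simp [Matrix.scalar_apply, mul_comm]
  rw [this]
  exact mul_mem (pow_mem hϖ.mem d) (hf i j)

/-- The least `k` such that `ϖ^k L` is contained in the standard lattice. -/
def expo (ϖ : K) (L : Submodule O (Fin 3 → K)) : ℕ := sInf {k | ϖ ^ k • L ≤ lattice O 1}

theorem expo_le_iff (hϖ : IsUniformizer O ϖ) (g : GL (Fin 3) K) {k : ℕ} :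
    expo ϖ (lattice O g) ≤ k ↔ ϖ ^ k • lattice O g ≤ lattice O 1 := by
  have hne : {k | ϖ ^ k • lattice O g ≤ lattice O 1}.Nonempty := exists_pow_smul_le hϖ g
  exact ⟨fun h => pow_smul_le_of_le hϖ (Nat.sInf_mem hne) h, fun h => Nat.sInf_le h⟩

variable [StarRing K] [StarStable O]

omit [StarRing K] [StarStable O] in
theorem pow_smul_le_iff (hϖ : IsUniformizer O ϖ) {k : ℕ} {L M : Submodule O (Fin 3 → K)} :
    ϖ ^ k • L ≤ M ↔ L ≤ (ϖ ^ k)⁻¹ • M := by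
  have h0 := pow_ne_zero k hϖ.ne_zero
  rw [← smul_le_smul_iff h0 (L := L), smul_smul, mul_inv_cancel₀ h0, one_smul]

theorem dual_pow_smul (hϖ : IsUniformizer O ϖ) (k : ℕ) (L : Submodule O (Fin 3 → K)) :
    dual (ϖ ^ k • L) = (ϖ ^ k)⁻¹ • dual L := by
  have h0 := pow_ne_zero k hϖ.ne_zero
  have hs := star_ne_zero.2 h0
  rw [dual_smul h0]
  refine smul_eq_smul_of_ord_eq hϖ (inv_ne_zero hs) (inv_ne_zero h0) ?_ _
  rw [ord_inv hϖ hs, ord_inv hϖ h0, ord_star hϖ h0]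

theorem dual_lattice_one : dual (lattice O (1 : GL (Fin 3) K)) = lattice O 1 := by
  rw [← lattice_sharp, map_one]

theorem pow_smul_le_one_iff (hϖ : IsUniformizer O ϖ) (g : GL (Fin 3) K) {k : ℕ} :
    ϖ ^ k • lattice O g ≤ lattice O 1 ↔ ϖ ^ k • lattice O 1 ≤ dual (lattice O g) := by
  constructor
  · intro h
    have := dual_anti h
    rwa [dual_lattice_one, dual_pow_smul hϖ, ← pow_smul_le_iff hϖ] at this
  · intro h
    have := dual_anti h
    rwa [dual_dual_lattice, dual_pow_smul hϖ, dual_lattice_one, ← pow_smul_le_iff hϖ] at this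

theorem expo_le_iff_dual (hϖ : IsUniformizer O ϖ) (g : GL (Fin 3) K) {k : ℕ} :
    expo ϖ (lattice O g) ≤ k ↔ ϖ ^ k • lattice O 1 ≤ dual (lattice O g) :=
  (expo_le_iff hϖ g).trans (pow_smul_le_one_iff hϖ g)

theorem expo_dual_le_iff (hϖ : IsUniformizer O ϖ) (g : GL (Fin 3) K) {k : ℕ} :
    expo ϖ (dual (lattice O g)) ≤ k ↔ ϖ ^ k • lattice O 1 ≤ lattice O g := by
  rw [← lattice_sharp, expo_le_iff_dual hϖ, ← lattice_sharp, sharp_sharp]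

omit [StarRing K] [StarStable O] in
theorem pow_smul_one_le_inv (hϖ : IsUniformizer O ϖ) (j k : ℕ) :
    ϖ ^ j • lattice O (1 : GL (Fin 3) K) ≤ (ϖ ^ k)⁻¹ • lattice O 1 := by
  rw [← pow_smul_le_iff hϖ, smul_smul, ← pow_add]
  exact smul_le_self (pow_mem hϖ.mem _) _

omit [StarRing K] [StarStable O] in
theorem vol_smul_sharp_lt (hϖ : IsUniformizer O ϖ) (g : GL (Fin 3) K) :
    ∃ c : GL (Fin 3) K, lattice O c = ϖ • lattice O g ∧ vol hϖ c = 3 + vol hϖ g := by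
  refine ⟨GeneralLinearGroup.scalar (Fin 3) (Units.mk0 ϖ hϖ.ne_zero) * g,
    lattice_scalar_mul _ g, ?_⟩
  have h5 := ord_zpow hϖ 1
  rw [zpow_one] at h5
  rw [vol_mul, vol_scalar, Units.val_mk0, h5, mul_one]

omit [StarRing K] [StarStable O] in
theorem exists_sup_pow [IsPrincipalIdealRing O] (hϖ : IsUniformizer O ϖ) (g : GL (Fin 3) K)
    (k : ℕ) : ∃ m : GL (Fin 3) K, lattice O m = lattice O g ⊔ ϖ ^ k • lattice O 1 := by
  obtain ⟨m, hm⟩ := exists_lattice_sup (O := O) g (GeneralLinearGroup.scalar (Fin 3)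
    (Units.mk0 (ϖ ^ k) (pow_ne_zero k hϖ.ne_zero)) * 1)
  exact ⟨m, by rw [hm, lattice_scalar_mul, Units.val_mk0]⟩

/-- The exponents of a strictly modular lattice and of its dual differ by one. -/
theorem expo_of_strict [IsPrincipalIdealRing O] (hϖ : IsUniformizer O ϖ) {g : GL (Fin 3) K}
    (h₁ : ϖ • lattice O g < dual (lattice O g)) (h₂ : dual (lattice O g) < lattice O g) :
    expo ϖ (lattice O g) = expo ϖ (dual (lattice O g)) + 1 := by
  have hv := vol_of_strict hϖ h₁ h₂
  set k := expo ϖ (lattice O g) with hk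
  have hk1 := (expo_le_iff hϖ g).1 hk.ge
  have hk2 := (expo_le_iff_dual hϖ g).1 hk.ge
  have hle : expo ϖ (dual (lattice O g)) ≤ k := by
    rw [expo_dual_le_iff hϖ]
    exact hk2.trans h₂.le
  have hge : k ≤ expo ϖ (dual (lattice O g)) + 1 := by
    rw [hk, expo_le_iff hϖ, pow_succ, mul_smul, ← lattice_sharp]
    refine le_trans ?_ ((expo_le_iff hϖ (sharp g)).1 le_rfl)
    rw [lattice_sharp]
    exact (smul_le_smul_iff (pow_ne_zero _ hϖ.ne_zero)).2 h₁.le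
  rcases hle.lt_or_eq with hlt | heq
  · omega
  -- Suppose both exponents equal `k`. For `k = 0` this gives `L ≤ O³ ≤ L^#`. Otherwise `N = ϖL +
  -- ϖ^k O³` lies strictly above `ϖL` and inside `L^#`, and these have volumes 2 and 1, so `N =
  -- L^#`. But all products of vectors of `N` are divisible by `ϖ`, that is `N ≤ ϖ N^#`, which now
  -- reads `L^# ≤ ϖL`.
  exfalso
  rcases Nat.eq_zero_or_pos k with h0 | hpos
  · rw [h0, pow_zero, one_smul] at hk1 hk2
    exact h₂.not_ge (hk1.trans hk2)
  · obtain ⟨j, hj⟩ : ∃ j, k = j + 1 := ⟨k - 1, by omega⟩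
    have hnot : ¬ ϖ ^ j • lattice O 1 ≤ lattice O g := by
      rw [← expo_dual_le_iff hϖ]
      omega
    obtain ⟨c, hc, hvc⟩ := vol_smul_sharp_lt hϖ g
    obtain ⟨n, hn⟩ := exists_sup_pow hϖ c k
    have hcn : lattice O c < lattice O n := by
      refine lt_of_le_of_ne (hn ▸ le_sup_left) fun h => hnot ?_
      have : ϖ ^ k • lattice O 1 ≤ lattice O c := by
        rw [h, hn]
        exact le_sup_right
      rwa [hc, hj, pow_succ', mul_smul, smul_le_smul_iff hϖ.ne_zero] at this
    have hnd : lattice O n = lattice O (sharp g) := by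
      refine lattice_eq_of_le_of_vol_le hϖ ?_ ?_
      · rw [hn, hc, lattice_sharp]
        exact sup_le h₁.le hk2
      · have := vol_lt_of_lt hϖ hcn
        rw [vol_sharp]
        omega
    refine h₁.not_ge ?_
    have hd : lattice O n ≤ ϖ • dual (lattice O n) := by
      have e1 : dual (lattice O n) =
          (ϖ ^ 1)⁻¹ • dual (lattice O g) ⊓ (ϖ ^ k)⁻¹ • lattice O 1 := by
        rw [hn, hc, dual_sup, dual_pow_smul hϖ, dual_lattice_one, ← dual_pow_smul hϖ, pow_one]
      have key : (ϖ ^ 1)⁻¹ • lattice O n ≤ dual (lattice O n) := by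
        rw [← smul_le_smul_iff (pow_ne_zero 1 hϖ.ne_zero), smul_smul,
          mul_inv_cancel₀ (pow_ne_zero 1 hϖ.ne_zero), one_smul, e1, hn, hc, pow_one]
        have e3 : ϖ ^ k • lattice O (1 : GL (Fin 3) K) = ϖ • ϖ ^ j • lattice O 1 := by
          rw [hj, pow_succ', mul_smul]
        rw [e3, ← Submodule.smul_sup']
        refine (smul_le_smul_iff hϖ.ne_zero).2 (sup_le (le_inf ?_ ?_) (le_inf ?_ ?_))
        · rw [← pow_one ϖ, ← pow_smul_le_iff hϖ, pow_one]
          exact h₁.le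
        · exact (pow_smul_le_iff hϖ).1 hk1
        · rw [← pow_one ϖ, ← pow_smul_le_iff hϖ, pow_one, ← e3]
          exact hk2
        · exact pow_smul_one_le_inv hϖ _ _
      rw [← smul_le_smul_iff hϖ.ne_zero, smul_smul, pow_one, mul_inv_cancel₀ hϖ.ne_zero,
        one_smul] at key
      exact key
    rwa [hnd, lattice_sharp, dual_dual_lattice] at hd

end Radius

end BruhatTits

/-! ### The fixed tree is a rooted tree -/

namespace BruhatTits

open Matrix

section Rooted

variable {K : Type*} [Field K] {O : ValuationSubring K} {ϖ : K} [StarRing K] [StarStable O]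

theorem Incident.expo (hϖ : IsUniformizer O ϖ) [IsPrincipalIdealRing O] {l m : GL (Fin 3) K}
    (h : Incident ϖ (lattice O l) (lattice O m)) :
    expo ϖ (lattice O m) = expo ϖ (dual (lattice O m)) + 1 ∧
      (expo ϖ (lattice O l) = expo ϖ (dual (lattice O m)) ∨
        expo ϖ (lattice O l) = expo ϖ (dual (lattice O m)) + 1) := by
  obtain ⟨h1, h2, h3, h4⟩ := h
  have hm := expo_of_strict hϖ h2 (h3.trans h4)
  refine ⟨hm, ?_⟩
  have e1 : BruhatTits.expo ϖ (lattice O l) ≤ BruhatTits.expo ϖ (lattice O m) := by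
    rw [expo_le_iff hϖ]
    exact ((smul_le_smul_iff (pow_ne_zero _ hϖ.ne_zero)).2 h4.le).trans
      ((expo_le_iff hϖ m).1 le_rfl)
  have e2 : BruhatTits.expo ϖ (dual (lattice O m)) ≤ BruhatTits.expo ϖ (lattice O l) := by
    rw [expo_dual_le_iff hϖ]
    refine ((expo_le_iff_dual hϖ l).1 le_rfl).trans ?_
    rw [h1]
    exact h4.le
  omega

/-- A self-dual lattice other than the standard one has a neighbour closer to the standard one. -/
theorem exists_incident_of_selfDual [IsPrincipalIdealRing O] (hϖ : IsUniformizer O ϖ)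
    {l : GL (Fin 3) K} (hl : dual (lattice O l) = lattice O l) {k : ℕ}
    (hk : expo ϖ (lattice O l) = k + 1) :
    ∃ m, lattice O m = lattice O l ⊔ ϖ ^ k • lattice O 1 ∧
      Incident ϖ (lattice O l) (lattice O m) := by
  obtain ⟨m, hm⟩ := exists_sup_pow hϖ l k
  refine ⟨m, hm, hl, ?_⟩
  have hnot : ¬ ϖ ^ k • lattice O 1 ≤ lattice O l := by
    rw [← hl, ← expo_le_iff_dual hϖ]
    omega
  have hlt : lattice O l < lattice O m := by
    refine lt_of_le_of_ne (hm ▸ le_sup_left) fun h => hnot ?_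
    rw [h, hm]
    exact le_sup_right
  have hdl : dual (lattice O m) < lattice O l := by
    refine lt_of_le_of_ne ((dual_anti hlt.le).trans hl.le) fun h => hlt.ne ?_
    rw [← dual_dual_lattice m, h, hl]
  refine ⟨lt_of_le_of_ne ?_ ?_, hdl, hlt⟩
  · have e1 : dual (lattice O m) = lattice O l ⊓ (ϖ ^ k)⁻¹ • lattice O 1 := by
      rw [hm, dual_sup, dual_pow_smul hϖ, dual_lattice_one, hl]
    have h1 := (expo_le_iff hϖ l).1 hk.le
    have h2 := (pow_smul_le_one_iff hϖ l).1 h1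
    rw [hl, pow_succ', mul_smul] at h2
    rw [pow_succ, mul_smul] at h1
    rw [e1, hm, Submodule.smul_sup']
    refine sup_le (le_inf (smul_le_self hϖ.mem _) ?_) (le_inf h2 ?_)
    · rwa [← pow_smul_le_iff hϖ]
    · rw [smul_smul, ← pow_succ']
      exact pow_smul_one_le_inv hϖ _ _
  -- Equality would give `3 + vol m = -vol m`, impossible by parity.
  · intro h
    obtain ⟨c, hc, hvc⟩ := vol_smul_sharp_lt hϖ m
    rw [← hc, ← lattice_sharp] at h
    have := vol_eq_of_lattice_eq hϖ h
    rw [vol_sharp] at this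
    omega

/-- The lattice `M^# + ϖ^a O³`, with `a` the exponent of `M^#`, is contained in its dual, so its
volume is at least 0. It is strictly larger than `M^#`, because `M` has exponent `a + 1`, so its
volume is less than 1. Volume 0 makes it self-dual. -/
theorem exists_incident_of_strict [IsPrincipalIdealRing O] (hϖ : IsUniformizer O ϖ)
    {m : GL (Fin 3) K} (h₁ : ϖ • lattice O m < dual (lattice O m))
    (h₂ : dual (lattice O m) < lattice O m) :
    ∃ l, lattice O l = dual (lattice O m) ⊔ ϖ ^ expo ϖ (dual (lattice O m)) • lattice O 1 ∧
      Incident ϖ (lattice O l) (lattice O m) := by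
  have hv := vol_of_strict hϖ h₁ h₂
  have he := expo_of_strict hϖ h₁ h₂
  set a := expo ϖ (dual (lattice O m)) with ha
  obtain ⟨l, hl⟩ := exists_sup_pow hϖ (sharp m) a
  rw [lattice_sharp] at hl
  have h3 := (expo_dual_le_iff hϖ m).1 ha.ge
  have h4 : ϖ ^ a • dual (lattice O m) ≤ lattice O 1 := by
    rw [← lattice_sharp, ← expo_le_iff hϖ, lattice_sharp]
  have hlm : lattice O l ≤ lattice O m := hl ▸ sup_le h₂.le h3
  have hlt : dual (lattice O m) < lattice O l := by
    refine lt_of_le_of_ne (hl ▸ le_sup_left) fun h => ?_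
    have : ϖ ^ a • lattice O 1 ≤ dual (lattice O m) := by
      rw [h, hl]
      exact le_sup_right
    rw [← expo_le_iff_dual hϖ] at this
    omega
  have hdl : lattice O l ≤ dual (lattice O l) := by
    have e1 : dual (lattice O l) = lattice O m ⊓ (ϖ ^ a)⁻¹ • lattice O 1 := by
      rw [hl, dual_sup, dual_pow_smul hϖ, dual_lattice_one, dual_dual_lattice]
    rw [e1, hl]
    exact sup_le (le_inf h₂.le ((pow_smul_le_iff hϖ).1 h4))
      (le_inf h3 (pow_smul_one_le_inv hϖ _ _))
  have hvl : vol hϖ l = 0 := by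
    rw [← lattice_sharp] at hlt hdl
    have h5 := vol_lt_of_lt hϖ hlt
    have h6 := vol_le_of_le hϖ hdl
    rw [vol_sharp] at h5 h6
    omega
  refine ⟨l, hl, ?_, h₁, hlt, lt_of_le_of_ne hlm fun h => ?_⟩
  · rw [← lattice_sharp] at hdl ⊢
    refine (lattice_eq_of_le_of_vol_le hϖ hdl ?_).symm
    rw [vol_sharp]
    omega
  · have := vol_eq_of_lattice_eq hϖ h
    omega

/-- The distance from the base vertex. -/
def radius (hϖ : IsUniformizer O ϖ) (s : TreeVertex O ϖ) : ℕ :=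
  expo ϖ (top hϖ s) + expo ϖ (dual (top hϖ s))

theorem radius_of_incident [IsPrincipalIdealRing O] (hϖ : IsUniformizer O ϖ)
    {s t : TreeVertex O ϖ} (h : Incident ϖ (top hϖ s) (top hϖ t)) :
    radius hϖ t = 2 * expo ϖ (dual (top hϖ t)) + 1 ∧ radius hϖ s = 2 * expo ϖ (top hϖ s) ∧
      (expo ϖ (top hϖ s) = expo ϖ (dual (top hϖ t)) ∨
        expo ϖ (top hϖ s) = expo ϖ (dual (top hϖ t)) + 1) := by
  obtain ⟨l, hl⟩ := (top_admissible hϖ s).1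
  obtain ⟨m, hm⟩ := (top_admissible hϖ t).1
  rw [radius, radius]
  have hs := h.1
  rw [hl] at h hs ⊢
  rw [hm] at h ⊢
  rw [hs]
  have := h.expo hϖ
  omega

/-- Self-dual lattices have even radius, the others odd radius, and adjacent radii differ by one.
The parent is unique because any closer neighbour must contain the sum constructed in
`exists_incident_of_selfDual` or `exists_incident_of_strict`, and has the same volume as that sum.
-/
theorem isRootedTree_tree [IsPrincipalIdealRing O] (hϖ : IsUniformizer O ϖ) :
    IsRootedTree (tree O ϖ) (radius hϖ) (baseVertex O ϖ) where
  root s := by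
    rw [radius, Nat.add_eq_zero_iff]
    constructor
    · rintro ⟨h1, h2⟩
      refine top_injective hϖ ?_
      obtain ⟨⟨l, hl⟩, hs⟩ := top_admissible hϖ s
      rw [top_baseVertex]
      rw [hl] at h1 h2 hs ⊢
      rcases hs with hs | hs
      · have := (expo_le_iff hϖ l).1 h1.le
        rw [pow_zero, one_smul] at this
        refine lattice_eq_of_le_of_vol_le hϖ this ?_
        rw [vol_of_selfDual hϖ hs, vol_one]
      · have := expo_of_strict hϖ hs.1 hs.2
        omega
    · rintro rfl
      rw [top_baseVertex, dual_lattice_one, and_self, ← Nat.le_zero, expo_le_iff hϖ, pow_zero,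
        one_smul]
  adj s t h := by
    rcases (adj_iff hϖ).1 h with h | h
    · have := radius_of_incident hϖ h
      omega
    · have := radius_of_incident hϖ h
      omega
  parent s hs := by
    obtain ⟨⟨l, hl⟩, hs' | hs'⟩ := top_admissible hϖ s
    · have hne : expo ϖ (top hϖ s) ≠ 0 := by
        intro h0
        refine hs (top_injective hϖ ?_)
        rw [top_baseVertex, hl]
        rw [hl] at h0 hs'
        have := (expo_le_iff hϖ l).1 h0.le
        rw [pow_zero, one_smul] at this
        refine lattice_eq_of_le_of_vol_le hϖ this ?_
        rw [vol_of_selfDual hϖ hs', vol_one]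
      obtain ⟨k, hk⟩ := Nat.exists_eq_succ_of_ne_zero hne
      have hk' := hk
      have hs'' := hs'
      rw [hl] at hk hs'
      obtain ⟨m, hm, hlm⟩ := exists_incident_of_selfDual hϖ hs' hk
      obtain ⟨t, ht⟩ := exists_top_eq_of_incident hϖ hlm
      have hst : Incident ϖ (top hϖ s) (top hϖ t) := by rwa [hl, ht]
      refine ⟨t, ⟨(adj_iff hϖ).2 (Or.inl hst), ?_⟩, ?_⟩
      · have h1 : expo ϖ (dual (top hϖ t)) ≤ k := by
          rw [ht, expo_dual_le_iff hϖ, hm]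
          exact le_sup_right
        have := radius_of_incident hϖ hst
        omega
      · rintro t' ⟨hadj, hr⟩
        have hst' : Incident ϖ (top hϖ s) (top hϖ t') := by
          refine ((adj_iff hϖ).1 hadj).resolve_right fun h => ?_
          exact (h.2.2.1.trans h.2.2.2).ne hs''
        have h1 := radius_of_incident hϖ hst'
        obtain ⟨m', hm'⟩ := (top_admissible hϖ t').1
        have h2 : expo ϖ (dual (top hϖ t')) ≤ k := by omega
        refine top_injective hϖ ?_
        rw [hm', expo_dual_le_iff hϖ] at h2
        rw [hm', hl] at hst'
        rw [hm', ht]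
        refine (lattice_eq_of_le_of_vol_le hϖ ?_ ?_).symm
        · rw [hm]
          exact sup_le hst'.2.2.2.le h2
        · rw [vol_of_strict hϖ hlm.2.1 (hlm.2.2.1.trans hlm.2.2.2),
            vol_of_strict hϖ hst'.2.1 (hst'.2.2.1.trans hst'.2.2.2)]
    · have hs'' := hs'
      rw [hl] at hs'
      obtain ⟨m, hm, hlm⟩ := exists_incident_of_strict hϖ hs'.1 hs'.2
      obtain ⟨t, ht⟩ := exists_top_eq_of_selfDual hϖ hlm.1
      have hst : Incident ϖ (top hϖ t) (top hϖ s) := by rwa [hl, ht]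
      refine ⟨t, ⟨(adj_iff hϖ).2 (Or.inr hst), ?_⟩, ?_⟩
      · have h1 : expo ϖ (top hϖ t) ≤ expo ϖ (dual (top hϖ s)) := by
          rw [ht, expo_le_iff_dual hϖ, hlm.1, hm, hl]
          exact le_sup_right
        have := radius_of_incident hϖ hst
        omega
      · rintro t' ⟨hadj, hr⟩
        have hst' : Incident ϖ (top hϖ t') (top hϖ s) := by
          refine ((adj_iff hϖ).1 hadj).resolve_left fun h => ?_
          exact hs''.2.ne h.1
        have h1 := radius_of_incident hϖ hst'
        obtain ⟨m', hm'⟩ := (top_admissible hϖ t').1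
        have h2 : expo ϖ (top hϖ t') ≤ expo ϖ (dual (top hϖ s)) := by omega
        refine top_injective hϖ ?_
        rw [hm', expo_le_iff_dual hϖ, hl] at h2
        rw [hm', hl] at hst'
        rw [hst'.1] at h2
        rw [hm', ht]
        refine (lattice_eq_of_le_of_vol_le hϖ ?_ ?_).symm
        · rw [hm]
          exact sup_le hst'.2.2.1.le h2
        · rw [vol_of_selfDual hϖ hlm.1, vol_of_selfDual hϖ hst'.1]

end Rooted

end BruhatTits

namespace BruhatTits

/-! ### Groups acting on a rooted tree with a segment as fundamental domain -/

section RootedTree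

variable {V : Type*} {T : SimpleGraph V} {r : V → ℕ} {v : V}

namespace IsRootedTree

variable (hT : IsRootedTree T r v)
include hT

theorem root_eq : r v = 0 := (hT.root v).2 rfl

theorem unique {x y z : V} (hy : T.Adj x y) (hz : T.Adj x z) (hry : r y < r x) (hrz : r z < r x) :
    y = z := by
  have hx : x ≠ v := by
    rintro rfl
    rw [hT.root_eq] at hry
    exact Nat.not_lt_zero _ hry
  exact (hT.parent x hx).unique ⟨hy, hry⟩ ⟨hz, hrz⟩

theorem step_away {x y z : V} (hxy : T.Adj x y) (hyz : T.Adj y z) (hr : r y = r x + 1)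
    (hne : z ≠ x) : r z = r y + 1 := by
  refine (hT.adj y z hyz).resolve_left fun h => hne ?_
  exact hT.unique hyz hxy.symm (by omega) (by omega)

/-- The only step towards the root from a vertex just reached by a step away is to turn back. A path
cannot turn back, so it keeps moving away and never reaches the root. -/
theorem not_isPath_of_away {x y : V} (p : T.Walk y v) (hp : p.IsPath) (hxy : T.Adj x y)
    (hr : r x < r y) (hx : x ∉ p.support) : False := by
  induction p generalizing x with
  | nil =>
    rw [hT.root_eq] at hr
    exact Nat.not_lt_zero _ hr
  | @cons y z _ hyz p ih =>
    rw [SimpleGraph.Walk.cons_isPath_iff] at hp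
    rw [SimpleGraph.Walk.support_cons, List.mem_cons, not_or] at hx
    have hzx : z ≠ x := by
      rintro rfl
      exact hx.2 p.start_mem_support
    have h1 := hT.adj x y hxy
    have h2 := hT.step_away hxy hyz (by omega) hzx
    exact ih hT hp.1 hyz (by omega) hp.2

theorem path_unique {x : V} (p q : T.Walk x v) (hp : p.IsPath) (hq : q.IsPath) : p = q := by
  have step : ∀ {x y : V} (h : T.Adj x y) (p : T.Walk y v), (SimpleGraph.Walk.cons h p).IsPath →
      r y < r x := by
    intro x y h p hp
    rw [SimpleGraph.Walk.cons_isPath_iff] at hp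
    by_contra hlt
    have h1 := hT.adj x y h
    exact hT.not_isPath_of_away p hp.1 h (by omega) hp.2
  induction p with
  | nil =>
    cases q with
    | nil => rfl
    | cons h q =>
      have := step h q hq
      rw [hT.root_eq] at this
      omega
  | cons h p ih =>
    cases q with
    | nil =>
      have := step h p hp
      rw [hT.root_eq] at this
      omega
    | cons h' q =>
      have h1 := step h p hp
      have h2 := step h' q hq
      obtain rfl := hT.unique h h' h1 h2
      rw [ih hT q ((SimpleGraph.Walk.cons_isPath_iff _ _).1 hp).1
        ((SimpleGraph.Walk.cons_isPath_iff _ _).1 hq).1 step]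

end IsRootedTree

variable (T r) in
/-- One step towards the root. -/
def Descends (x y : V) : Prop := T.Adj x y ∧ r y < r x

variable (T r) in
/-- The vertex `x` lies beyond `w`, as seen from the root. -/
def Beyond (w x : V) : Prop := Relation.ReflTransGen (Descends T r) x w

theorem Beyond.radius_le {w x : V} (h : Beyond T r w x) : r w ≤ r x := by
  induction h with
  | refl => exact le_rfl
  | tail _ h ih => exact h.2.le.trans ih

/-- Parents are unique, so the descent from `x` meets each level at most once. -/
theorem IsRootedTree.eq_of_beyond (hT : IsRootedTree T r v) {w w' x : V} (h : Beyond T r w x)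
    (h' : Beyond T r w' x) (hr : r w = r w') : w = w' := by
  induction h using Relation.ReflTransGen.head_induction_on with
  | refl =>
    rcases Relation.ReflTransGen.cases_head h' with h' | ⟨y, hy, h'⟩
    · exact h'
    · have h1 : r w' ≤ r y := Beyond.radius_le h'
      have h2 := hy.2
      omega
  | @head x y hxy hyw ih =>
    rcases Relation.ReflTransGen.cases_head h' with h' | ⟨z, hz, h'⟩
    · have h1 : r w ≤ r y := Beyond.radius_le hyw
      have h2 := hxy.2
      rw [h'] at h2
      omega
    · obtain rfl := hT.unique hxy.1 hz.1 hxy.2 hz.2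
      exact ih h'

/-- The group `G` acts on a tree rooted at `v₀`, and the segment `v₀, v₁, v₂, v₃` is a fundamental
domain of the action. -/
structure IsSegmentAction (G : Type*) [Group G] {V : Type*} [MulAction G V] (T : SimpleGraph V)
    (r : V → ℕ) (v₀ v₁ v₂ v₃ : V) : Prop where
  tree : IsRootedTree T r v₀
  smul_adj : ∀ (g : G) (x y : V), T.Adj x y → T.Adj (g • x) (g • y)
  adj₀₁ : T.Adj v₀ v₁
  adj₁₂ : T.Adj v₁ v₂
  adj₂₃ : T.Adj v₂ v₃
  ne₁₃ : v₃ ≠ v₁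
  smul_ne₁ : ∀ g : G, g • v₀ ≠ v₁
  smul_ne₂ : ∀ g : G, g • v₀ ≠ v₂
  smul_ne₃ : ∀ g : G, g • v₀ ≠ v₃
  nbr₀ : ∀ y, T.Adj v₀ y → ∃ g : G, g • v₀ = v₀ ∧ y = g • v₁
  nbr₁ : ∀ y, T.Adj v₁ y → y ≠ v₀ → ∃ g : G, g • v₀ = v₀ ∧ g • v₁ = v₁ ∧ y = g • v₂
  nbr₂ : ∀ y, T.Adj v₂ y → y ≠ v₁ →
    ∃ g : G, g • v₀ = v₀ ∧ g • v₁ = v₁ ∧ g • v₂ = v₂ ∧ y = g • v₃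
  nbr₃ : ∀ y, T.Adj v₃ y → ∃ g : G, g • v₃ = v₃ ∧ y = g • v₂

namespace IsSegmentAction

variable {G : Type*} [Group G] [MulAction G V] {v₀ v₁ v₂ v₃ : V}
  (h : IsSegmentAction G T r v₀ v₁ v₂ v₃)
include h

theorem radius₁ : r v₁ = 1 := by
  have h0 := h.tree.root_eq
  have := h.tree.adj _ _ h.adj₀₁
  omega

theorem radius₂ : r v₂ = 2 := by
  have h0 := h.radius₁
  have := h.tree.step_away h.adj₀₁ h.adj₁₂ (by rw [h.radius₁, h.tree.root_eq])
    (fun e => h.smul_ne₂ 1 (by rw [one_smul, e]))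
  omega

theorem radius₃ : r v₃ = 3 := by
  have h0 := h.radius₂
  have := h.tree.step_away h.adj₁₂ h.adj₂₃ (by rw [h.radius₁, h.radius₂]) h.ne₁₃
  omega

/-- An element fixing the root carries the descent from `x` to a walk of the same length ending at
the root, so it does not increase `r`; neither does its inverse. -/
theorem radius_smul {g : G} (hg : g • v₀ = v₀) (x : V) : r (g • x) = r x := by
  have key : ∀ (n : ℕ) (g : G) (x : V), g • v₀ = v₀ → r x = n → r (g • x) ≤ n := by
    intro n
    induction n with
    | zero =>
      intro g x hg hx
      rw [(h.tree.root x).1 hx, hg, h.tree.root_eq]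
    | succ n ih =>
      intro g x hg hx
      obtain ⟨y, ⟨hy, hry⟩, -⟩ := h.tree.parent x (fun e => by
        rw [e, h.tree.root_eq] at hx
        omega)
      have h1 := h.tree.adj x y hy
      have h2 := ih g y hg (by omega)
      have h3 := h.tree.adj _ _ (h.smul_adj g x y hy)
      omega
  have h1 := key _ g x hg rfl
  have h2 := key _ g⁻¹ (g • x) (by rw [inv_smul_eq_iff, hg]) rfl
  rw [inv_smul_smul] at h2
  omega

theorem smul_descends {g : G} (hg : g • v₀ = v₀) {x y : V} (hxy : Descends T r x y) :
    Descends T r (g • x) (g • y) := by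
  refine ⟨h.smul_adj g x y hxy.1, ?_⟩
  rw [h.radius_smul hg, h.radius_smul hg]
  exact hxy.2

theorem smul_beyond {g : G} (hg : g • v₀ = v₀) {w x : V} (hx : Beyond T r w x) :
    Beyond T r (g • w) (g • x) :=
  Relation.ReflTransGen.lift (r := Descends T r) (fun x => g • x)
    (fun _ _ => h.smul_descends hg) _ _ hx

theorem fixes₂_of_fixes₃ {g : G} (hg : g • v₀ = v₀) (hg₃ : g • v₃ = v₃) : g • v₂ = v₂ := by
  have h3 := h.radius₃
  have h2 := h.radius₂
  refine h.tree.unique (x := v₃) ?_ h.adj₂₃.symm ?_ (by omega)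
  · have := h.smul_adj g _ _ h.adj₂₃.symm
    rwa [hg₃] at this
  · rw [h.radius_smul hg]
    omega

theorem fixes₁_of_fixes₂ {g : G} (hg : g • v₀ = v₀) (hg₂ : g • v₂ = v₂) : g • v₁ = v₁ := by
  have h1 := h.radius₁
  have h2 := h.radius₂
  refine h.tree.unique (x := v₂) ?_ h.adj₁₂.symm ?_ (by omega)
  · have := h.smul_adj g _ _ h.adj₁₂.symm
    rwa [hg₂] at this
  · rw [h.radius_smul hg]
    omega

/-- Otherwise `g • v₀` would be a neighbour of `v₁` other than `v₀`, hence a translate of `v₂`; but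
`v₂` is not in the orbit of `v₀`. `fixes₁_of_fixes₂'` repeats this argument one step further along
the segment. -/
theorem fixes₀_of_fixes₁ {g : G} (hg : g • v₁ = v₁) : g • v₀ = v₀ := by
  by_contra hne
  have h1 := h.smul_adj g _ _ h.adj₀₁.symm
  rw [hg] at h1
  obtain ⟨c, -, -, hc⟩ := h.nbr₁ _ h1 hne
  refine h.smul_ne₂ (c⁻¹ * g) ?_
  rw [mul_smul, hc, inv_smul_smul]

theorem smul₁_ne₃ (g : G) : g • v₁ ≠ v₃ := by
  intro e
  have h1 := h.smul_adj g _ _ h.adj₀₁.symm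
  rw [e] at h1
  obtain ⟨c, -, hc⟩ := h.nbr₃ _ h1
  refine h.smul_ne₂ (c⁻¹ * g) ?_
  rw [mul_smul, hc, inv_smul_smul]

theorem fixes₁_of_fixes₂' {g : G} (hg : g • v₂ = v₂) : g • v₁ = v₁ := by
  by_contra hne
  have h1 := h.smul_adj g _ _ h.adj₁₂.symm
  rw [hg] at h1
  obtain ⟨c, -, -, -, hc⟩ := h.nbr₂ _ h1 hne
  refine h.smul₁_ne₃ (c⁻¹ * g) ?_
  rw [mul_smul, hc, inv_smul_smul]

theorem fixes₀_of_fixes₂ {g : G} (hg : g • v₂ = v₂) : g • v₀ = v₀ :=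
  h.fixes₀_of_fixes₁ (h.fixes₁_of_fixes₂' hg)

-- Fixing both ends fixes the vertices between them, by uniqueness of parents.
open MulAction in
theorem iInf_stabilizer : ⨅ j : Fin 4, stabilizer G (![v₀, v₁, v₂, v₃] j) =
    stabilizer G v₀ ⊓ stabilizer G v₃ := by
  refine le_antisymm (le_inf (iInf_le _ 0) (iInf_le _ 3)) ?_
  rintro g ⟨h0, h3⟩
  have h2 := h.fixes₂_of_fixes₃ h0 h3
  have h1 := h.fixes₁_of_fixes₂ h0 h2
  rw [Subgroup.mem_iInf]
  intro j
  fin_cases j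
  · exact h0
  · exact h1
  · exact h2
  · exact h3

-- Induction on the distance from the root. The parent of `x` is a translate of a vertex of the
-- segment by the join of the two stabilizers, and each neighbour of a vertex of the segment is
-- carried back to the segment by an element of one of them.
open MulAction in
theorem exists_translate (x : V) : ∃ g ∈ stabilizer G v₀ ⊔ stabilizer G v₃,
    x = g • v₀ ∨ x = g • v₁ ∨ x = g • v₂ ∨ x = g • v₃ := by
  set P := stabilizer G v₀ ⊔ stabilizer G v₃ with hP
  have m0 : ∀ g : G, g • v₀ = v₀ → g ∈ P := fun g hg => Subgroup.mem_sup_left hg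
  have m3 : ∀ g : G, g • v₃ = v₃ → g ∈ P := fun g hg => Subgroup.mem_sup_right hg
  have key : ∀ (n : ℕ) (x : V), r x = n → ∃ g ∈ P,
      x = g • v₀ ∨ x = g • v₁ ∨ x = g • v₂ ∨ x = g • v₃ := by
    intro n
    induction n with
    | zero =>
      intro x hx
      exact ⟨1, one_mem P, Or.inl (by rw [one_smul, (h.tree.root x).1 hx])⟩
    | succ n ih =>
      intro x hx
      obtain ⟨y, ⟨hy, hry⟩, -⟩ := h.tree.parent x (fun e => by
        rw [e, h.tree.root_eq] at hx
        omega)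
      have h1 := h.tree.adj x y hy
      obtain ⟨g, hgP, hg⟩ := ih y (by omega)
      have hadj : ∀ w : V, y = g • w → T.Adj w (g⁻¹ • x) := by
        rintro w rfl
        have := h.smul_adj g⁻¹ _ _ hy.symm
        rwa [inv_smul_smul] at this
      have fin : ∀ (c : G) (w : V), c ∈ P → g⁻¹ • x = c • w → g * c ∈ P ∧ x = (g * c) • w := by
        intro c w hc hx
        exact ⟨mul_mem hgP hc, by rw [mul_smul, ← hx, smul_inv_smul]⟩
      rcases hg with hg | hg | hg | hg
      · obtain ⟨c, hc, hc'⟩ := h.nbr₀ _ (hadj _ hg)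
        obtain ⟨f1, f2⟩ := fin c _ (m0 c hc) hc'
        exact ⟨_, f1, Or.inr (Or.inl f2)⟩
      · by_cases hne : g⁻¹ • x = v₀
        · obtain ⟨f1, f2⟩ := fin 1 v₀ (one_mem P) (by rw [hne, one_smul])
          exact ⟨_, f1, Or.inl f2⟩
        · obtain ⟨c, hc, -, hc'⟩ := h.nbr₁ _ (hadj _ hg) hne
          obtain ⟨f1, f2⟩ := fin c _ (m0 c hc) hc'
          exact ⟨_, f1, Or.inr (Or.inr (Or.inl f2))⟩
      · by_cases hne : g⁻¹ • x = v₁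
        · obtain ⟨f1, f2⟩ := fin 1 v₁ (one_mem P) (by rw [hne, one_smul])
          exact ⟨_, f1, Or.inr (Or.inl f2)⟩
        · obtain ⟨c, hc, -, -, hc'⟩ := h.nbr₂ _ (hadj _ hg) hne
          obtain ⟨f1, f2⟩ := fin c _ (m0 c hc) hc'
          exact ⟨_, f1, Or.inr (Or.inr (Or.inr f2))⟩
      · obtain ⟨c, hc, hc'⟩ := h.nbr₃ _ (hadj _ hg)
        obtain ⟨f1, f2⟩ := fin c _ (m3 c hc) hc'
        exact ⟨_, f1, Or.inr (Or.inr (Or.inl f2))⟩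
  exact key _ x rfl

open MulAction in
theorem sup_stabilizer : stabilizer G v₀ ⊔ stabilizer G v₃ = ⊤ := by
  rw [eq_top_iff]
  rintro g -
  obtain ⟨c, hc, hg⟩ := h.exists_translate (g • v₀)
  have hg0 : g • v₀ = c • v₀ := by
    have e : ∀ w : V, g • v₀ = c • w → (c⁻¹ * g) • v₀ = w := by
      intro w hw
      rw [mul_smul, hw, inv_smul_smul]
    rcases hg with hg | hg | hg | hg
    · exact hg
    · exact absurd (e _ hg) (h.smul_ne₁ _)
    · exact absurd (e _ hg) (h.smul_ne₂ _)
    · exact absurd (e _ hg) (h.smul_ne₃ _)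
  have h1 : c⁻¹ * g ∈ stabilizer G v₀ := by
    rw [mem_stabilizer_iff, mul_smul, hg0, inv_smul_smul]
  rw [show g = c * (c⁻¹ * g) by group]
  exact mul_mem hc (Subgroup.mem_sup_left h1)

theorem not_beyond_root : ¬ Beyond T r v₃ v₀ := by
  intro hb
  have := hb.radius_le
  rw [h.radius₃, h.tree.root_eq] at this
  omega

/-- An element that fixes `v₀` but not `v₃` moves the branch beyond `v₃` off itself. -/
theorem not_beyond_smul {g : G} (hg : g • v₀ = v₀) (hg₃ : g • v₃ ≠ v₃) {x : V}
    (hx : Beyond T r v₃ x) : ¬ Beyond T r v₃ (g • x) := fun hx' =>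
  hg₃ (h.tree.eq_of_beyond (h.smul_beyond hg hx) hx' (h.radius_smul hg v₃))

/-- An element that fixes `v₃` but not `v₀` moves the rest of the tree into the branch beyond
`v₃`. -/
theorem beyond_smul {g : G} (hg₃ : g • v₃ = v₃) (hg : g • v₀ ≠ v₀) {x : V}
    (hx : ¬ Beyond T r v₃ x) : Beyond T r v₃ (g • x) := by
  -- A vertex outside the branch is joined to `v₂` by a walk that avoids `v₃`. Its image under `g`
  -- avoids `v₃` too and ends at `g • v₂`, a neighbour of `v₃` other than `v₂`, so in the branch.
  -- The branch can only be left through `v₃`, so the whole image lies in it.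
  let R : V → V → Prop := fun a b => T.Adj a b ∧ a ≠ v₃ ∧ b ≠ v₃
  have hself : Beyond T r v₃ v₃ := Relation.ReflTransGen.refl
  have r1 := h.radius₁
  have r2 := h.radius₂
  have r3 := h.radius₃
  have r0 := h.tree.root_eq
  have key : ∀ (n : ℕ) (x : V), r x = n → ¬ Beyond T r v₃ x → Relation.ReflTransGen R x v₂ := by
    intro n
    induction n with
    | zero =>
      intro x hx _
      obtain rfl := (h.tree.root x).1 hx
      refine Relation.ReflTransGen.head (b := v₁) ⟨h.adj₀₁, ?_, h.ne₁₃.symm⟩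
        (Relation.ReflTransGen.single ⟨h.adj₁₂, h.ne₁₃.symm, ?_⟩)
      · rintro rfl
        omega
      · rintro rfl
        omega
    | succ n ih =>
      intro x hx hxb
      obtain ⟨y, ⟨hy, hry⟩, -⟩ := h.tree.parent x (fun e => by
        rw [e, h.tree.root_eq] at hx
        omega)
      have h1 := h.tree.adj x y hy
      have hyb : ¬ Beyond T r v₃ y := fun hb => hxb (Relation.ReflTransGen.head ⟨hy, hry⟩ hb)
      refine Relation.ReflTransGen.head ⟨hy, ?_, ?_⟩ (ih y (by omega) hyb)
      · rintro rfl
        exact hxb hself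
      · rintro rfl
        exact hyb hself
  have hpath : Relation.ReflTransGen R (g • x) (g • v₂) := by
    refine Relation.ReflTransGen.lift (r := R) (fun x => g • x) (fun a b hab => ?_) _ _
      (key _ x rfl hx)
    refine ⟨h.smul_adj g a b hab.1, fun e => hab.2.1 ?_, fun e => hab.2.2 ?_⟩
    · exact smul_left_cancel g (e.trans hg₃.symm)
    · exact smul_left_cancel g (e.trans hg₃.symm)
  have hend : Beyond T r v₃ (g • v₂) := by
    have hadj : T.Adj v₃ (g • v₂) := by
      have := h.smul_adj g _ _ h.adj₂₃.symm
      rwa [hg₃] at this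
    refine Relation.ReflTransGen.single ⟨hadj.symm, ?_⟩
    have := h.tree.step_away h.adj₂₃ hadj (by omega) (fun e => hg (h.fixes₀_of_fixes₂ e))
    omega
  generalize g • x = y at hpath
  induction hpath using Relation.ReflTransGen.head_induction_on with
  | refl => exact hend
  | @head a b hab _ ih =>
    rcases h.tree.adj a b hab.1 with hr | hr
    · exact Relation.ReflTransGen.head ⟨hab.1, by omega⟩ ih
    · rcases Relation.ReflTransGen.cases_head ih with e | ⟨c, hc, hcb⟩
      · exact absurd e hab.2.2
      · rwa [h.tree.unique hab.1.symm hc.1 (by omega) hc.2]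

end IsSegmentAction

end RootedTree

end BruhatTits

/-! ### A criterion for amalgamated products -/

section PingPong

open Monoid

variable {G V : Type*} [Group G] [MulAction G V]

/-- Ping-pong: apply the letters to `v` from the right. Those of `S 1` map the complement of `X`
into `X` and those of `S 0` map `X` out of itself. The one letter not covered by this, a rightmost
letter in `S 0`, fixes `v ∉ X`. -/
theorem word_smul_mem_iff {S : Fin 2 → Subgroup G} {v : V} {X : Set V} (hv : v ∉ X)
    (hSv : ∀ g ∈ S 0, g • v = v)
    (h0 : ∀ g ∈ S 0, g ∉ S 1 → ∀ x ∈ X, g • x ∉ X)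
    (h1 : ∀ g ∈ S 1, g ∉ S 0 → ∀ x ∉ X, g • x ∈ X)
    (u : CoprodI.Word (fun i => S i))
    (hu : ∀ l ∈ u.toList, (l.2 : G) ∉ S 0 ⊓ S 1) :
    CoprodI.lift (fun i => (S i).subtype) u.prod • v ∈ X ↔ u.fstIdx = some 1 := by
  classical
  induction u using CoprodI.Word.consRecOn with
  | empty =>
    rw [CoprodI.Word.prod_empty, map_one, one_smul]
    exact iff_of_false hv (by simp [CoprodI.Word.fstIdx])
  | cons i g u hi hg ih =>
    have ih' := ih fun l hl => hu l (List.mem_cons_of_mem _ hl)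
    have hgD : (g : G) ∉ S 0 ⊓ S 1 := hu ⟨i, g⟩ List.mem_cons_self
    rw [CoprodI.Word.prod_cons, map_mul, CoprodI.lift_of, mul_smul, CoprodI.Word.fstIdx_cons,
      Option.some_inj]
    obtain rfl | rfl : i = 0 ∨ i = 1 := by omega
    · have hgA : (g : G) ∈ S 0 := g.2
      refine iff_of_false ?_ (by simp)
      by_cases hu1 : u.fstIdx = some 1
      · exact h0 _ hgA (fun hb => hgD ⟨hgA, hb⟩) _ (ih'.2 hu1)
      · have hu0 : u = .empty := by
          refine CoprodI.Word.ext ?_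
          rcases hf : u.fstIdx with _ | j
          · rwa [CoprodI.Word.fstIdx, Option.map_eq_none_iff, List.head?_eq_none_iff] at hf
          · obtain rfl | rfl : j = 0 ∨ j = 1 := by omega
            · exact absurd hf hi
            · exact absurd hf hu1
        rw [hu0, CoprodI.Word.prod_empty, map_one, one_smul]
        change ¬ ((g : G) • v ∈ X)
        rwa [hSv _ hgA]
    · have hgB : (g : G) ∈ S 1 := g.2
      exact iff_of_true (h1 _ hgB (fun ha => hgD ⟨ha, hgB⟩) _ fun hx => hi (ih'.1 hx)) rfl

/-- The value fixes `v ∉ X`, so the word does not begin in `S 1`. If it begins with a letter of `S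
0`, the rest also fixes `v` and hence is empty, and then that letter itself lies in `S 0 ⊓ S 1`,
which is excluded. -/
theorem word_eq_empty {S : Fin 2 → Subgroup G} {v : V} {X : Set V} (hv : v ∉ X)
    (hSv : ∀ g ∈ S 0, g • v = v)
    (h0 : ∀ g ∈ S 0, g ∉ S 1 → ∀ x ∈ X, g • x ∉ X)
    (h1 : ∀ g ∈ S 1, g ∉ S 0 → ∀ x ∉ X, g • x ∈ X)
    (u : CoprodI.Word (fun i => S i))
    (hu : ∀ l ∈ u.toList, (l.2 : G) ∉ S 0 ⊓ S 1)
    (hD : CoprodI.lift (fun i => (S i).subtype) u.prod ∈ S 0 ⊓ S 1) : u = .empty := by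
  classical
  have key := word_smul_mem_iff hv hSv h0 h1 u hu
  rw [hSv _ hD.1] at key
  induction u using CoprodI.Word.consRecOn with
  | empty => rfl
  | cons i g u hi hg _ =>
    exfalso
    have hgD : (g : G) ∉ S 0 ⊓ S 1 := hu ⟨i, g⟩ List.mem_cons_self
    obtain rfl | rfl : i = 0 ∨ i = 1 := by omega
    · have hgA : (g : G) ∈ S 0 := g.2
      have key' := word_smul_mem_iff hv hSv h0 h1 u
        fun l hl => hu l (List.mem_cons_of_mem _ hl)
      rw [CoprodI.Word.prod_cons, map_mul, CoprodI.lift_of] at hD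
      have hD0 : CoprodI.lift (fun i => (S i).subtype) u.prod ∈ S 0 :=
        (Subgroup.mul_mem_cancel_left _ hgA).1 hD.1
      rw [hSv _ hD0] at key'
      have hu0 : u = .empty := by
        refine CoprodI.Word.ext ?_
        rcases hf : u.fstIdx with _ | j
        · rwa [CoprodI.Word.fstIdx, Option.map_eq_none_iff, List.head?_eq_none_iff] at hf
        · obtain rfl | rfl : j = 0 ∨ j = 1 := by omega
          · exact absurd hf hi
          · exact absurd (key'.2 hf) hv
      rw [hu0, CoprodI.Word.prod_empty, map_one, mul_one] at hD
      exact hgD hD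
    · exact hv (key.2 (CoprodI.Word.fstIdx_cons ..))

theorem pushout_lift_bijective {S : Fin 2 → Subgroup G} {D : Subgroup G} (hD : D = S 0 ⊓ S 1)
    (hS : ∀ i, D ≤ S i) (hgen : S 0 ⊔ S 1 = ⊤) {v : V} {X : Set V} (hv : v ∉ X)
    (hSv : ∀ g ∈ S 0, g • v = v)
    (h0 : ∀ g ∈ S 0, g ∉ S 1 → ∀ x ∈ X, g • x ∉ X)
    (h1 : ∀ g ∈ S 1, g ∉ S 0 → ∀ x ∉ X, g • x ∈ X)
    (hf : ∀ i, (S i).subtype.comp (Subgroup.inclusion (hS i)) = D.subtype) :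
    Function.Bijective (PushoutI.lift (φ := fun i => Subgroup.inclusion (hS i))
      (fun i => (S i).subtype) D.subtype hf) := by
  have hFof : ∀ i (g : S i), PushoutI.lift (φ := fun i => Subgroup.inclusion (hS i))
      (fun i => (S i).subtype) D.subtype hf (PushoutI.of i g) = g := fun i g =>
    PushoutI.lift_of (fun i => (S i).subtype) D.subtype hf g
  have hFbase : ∀ d : D, PushoutI.lift (φ := fun i => Subgroup.inclusion (hS i))
      (fun i => (S i).subtype) D.subtype hf (PushoutI.base _ d) = d := fun d =>
    PushoutI.lift_base (fun i => (S i).subtype) D.subtype hf d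
  generalize PushoutI.lift (φ := fun i => Subgroup.inclusion (hS i))
      (fun i => (S i).subtype) D.subtype hf = F at hFof hFbase ⊢
  constructor
  · rw [injective_iff_map_eq_one]
    intro x hx
    classical
    obtain ⟨d⟩ := PushoutI.NormalWord.transversal_nonempty (fun i => Subgroup.inclusion (hS i))
      fun i => Subgroup.inclusion_injective (hS i)
    obtain ⟨w, rfl⟩ : ∃ w : PushoutI.NormalWord d, w.prod = x :=
      PushoutI.NormalWord.equiv.symm.surjective x
    have hP : F.comp PushoutI.ofCoprodI = CoprodI.lift (fun i => (S i).subtype) := by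
      refine CoprodI.ext_hom _ _ fun i => MonoidHom.ext fun g => ?_
      rw [MonoidHom.comp_apply, MonoidHom.comp_apply, PushoutI.ofCoprodI_of, hFof,
        MonoidHom.comp_apply, CoprodI.lift_of]
      rfl
    -- A letter in `D` would factor through the transversal both as itself times 1 and as 1 times
    -- itself, so it would be 1, which a reduced word does not contain.
    have hred : ∀ l ∈ w.toList, (l.2 : G) ∉ S 0 ⊓ S 1 := by
      rintro ⟨i, g⟩ hg hgD
      rw [← hD] at hgD
      have h2 : g ∈ (Subgroup.inclusion (hS i)).range := ⟨⟨g, hgD⟩, rfl⟩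
      have h3 := Function.Bijective.injective (f := fun x :
        ((Subgroup.inclusion (hS i)).range : Set (S i)) × d.set i => (x.1 : S i) * x.2) (d.compl i)
      have h4 := @h3 (⟨g, h2⟩, ⟨1, d.one_mem i⟩) (⟨1, one_mem _⟩, ⟨g, w.normalized i g hg⟩)
        (by simp)
      exact w.ne_one ⟨i, g⟩ hg (congrArg (fun p => (p.1 : S i)) h4)
    rw [PushoutI.NormalWord.prod, map_mul] at hx
    have e2 : F (PushoutI.ofCoprodI w.toWord.prod) =
        CoprodI.lift (fun i => (S i).subtype) w.toWord.prod := DFunLike.congr_fun hP _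
    rw [hFbase, e2] at hx
    have hw : w.toWord = .empty := by
      refine word_eq_empty hv hSv h0 h1 w.toWord hred ?_
      rw [← hD, ← inv_eq_of_mul_eq_one_right hx]
      exact inv_mem w.head.2
    rw [hw, CoprodI.Word.prod_empty, map_one, mul_one] at hx
    have hh : w.head = 1 := Subtype.ext hx
    rw [PushoutI.NormalWord.prod, hw, hh, CoprodI.Word.prod_empty, map_one, map_one, mul_one]
  · rw [← MonoidHom.range_eq_top, eq_top_iff, ← hgen]
    have : ∀ i, S i ≤ F.range := fun i g hg => ⟨PushoutI.of i ⟨g, hg⟩, hFof i ⟨g, hg⟩⟩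
    exact sup_le (this 0) (this 1)

end PingPong

/-! ### The amalgam and the orders of the stabilizers -/

namespace BruhatTits.IsSegmentAction

open MulAction

variable {V G : Type*} {T : SimpleGraph V} {r : V → ℕ} [Group G] [MulAction G V]
  {v₀ v₁ v₂ v₃ : V} (h : IsSegmentAction G T r v₀ v₁ v₂ v₃)
include h

theorem isAmalgamatedProduct : IsAmalgamatedProduct (stabilizer G v₀) (stabilizer G v₃)
    (stabilizer G v₀ ⊓ stabilizer G v₃) := by
  have hS : ∀ i, stabilizer G v₀ ⊓ stabilizer G v₃ ≤
      (![stabilizer G v₀, stabilizer G v₃] : Fin 2 → Subgroup G) i :=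
    Fin.forall_fin_two.2 ⟨inf_le_left, inf_le_right⟩
  refine ⟨hS, ?_⟩
  exact pushout_lift_bijective (S := ![stabilizer G v₀, stabilizer G v₃]) rfl hS h.sup_stabilizer (v := v₀) (X := {x | Beyond T r v₃ x})
    h.not_beyond_root (fun g hg => hg) (fun g hg hg' x hx => h.not_beyond_smul hg hg' hx)
    (fun g hg hg' x hx => h.beyond_smul hg hg' hx) _

omit h in
theorem card_eq_mul_ncard (A : Subgroup G) (x : V) :
    Nat.card A = Nat.card ↥(A ⊓ stabilizer G x) * {y | ∃ a ∈ A, y = a • x}.ncard := by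
  have h1 := (stabilizer A x).card_mul_index
  rw [index_stabilizer] at h1
  have h2 : orbit A x = {y | ∃ a ∈ A, y = a • x} := by
    ext y
    constructor
    · rintro ⟨a, rfl⟩
      exact ⟨a, a.2, rfl⟩
    · rintro ⟨a, ha, rfl⟩
      exact ⟨⟨a, ha⟩, rfl⟩
  have h3 : Nat.card (stabilizer A x) = Nat.card ↥(A ⊓ stabilizer G x) := by
    have : stabilizer A x = (A ⊓ stabilizer G x).subgroupOf A := by
      ext a
      rw [Subgroup.mem_subgroupOf]
      exact ⟨fun ha => ⟨a.2, ha⟩, fun ha => ha.2⟩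
    rw [this]
    exact Nat.card_congr (Subgroup.subgroupOfEquivOfLe inf_le_left).toEquiv
  rw [← h1, h2, h3]

/-- Orbit counting along the segment: 4 choices for the image of `v₁`, then 3 for `v₂` and 3 for
`v₃`, since the edge back towards the root is already fixed. -/
theorem card_stabilizer_root (h₀ : {y | T.Adj v₀ y}.ncard = 4) (h₁ : {y | T.Adj v₁ y}.ncard = 4)
    (h₂ : {y | T.Adj v₂ y}.ncard = 4) : Nat.card (stabilizer G v₀) =
      36 * Nat.card ↥(stabilizer G v₀ ⊓ stabilizer G v₃) := by
  have r₁ := h.radius₁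
  have r₂ := h.radius₂
  have r₃ := h.radius₃
  have r₀ := h.tree.root_eq
  have e₀ := card_eq_mul_ncard (stabilizer G v₀) v₁
  have e₁ := card_eq_mul_ncard (stabilizer G v₀ ⊓ stabilizer G v₁) v₂
  have e₂ := card_eq_mul_ncard (stabilizer G v₀ ⊓ stabilizer G v₁ ⊓ stabilizer G v₂) v₃
  have s₀ : {y | ∃ a ∈ stabilizer G v₀, y = a • v₁} = {y | T.Adj v₀ y} := by
    ext y
    constructor
    · rintro ⟨a, ha, rfl⟩
      have := h.smul_adj a _ _ h.adj₀₁
      rwa [show a • v₀ = v₀ from ha] at this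
    · exact h.nbr₀ y
  have s₁ : {y | ∃ a ∈ stabilizer G v₀ ⊓ stabilizer G v₁, y = a • v₂} =
      {y | T.Adj v₁ y} \ {v₀} := by
    ext y
    constructor
    · rintro ⟨a, ha, rfl⟩
      refine ⟨?_, fun e => ?_⟩
      · have := h.smul_adj a _ _ h.adj₁₂
        rwa [show a • v₁ = v₁ from ha.2] at this
      · have := h.radius_smul ha.1 v₂
        rw [show a • v₂ = v₀ from e] at this
        omega
    · rintro ⟨hy, hne⟩
      obtain ⟨a, a0, a1, hy⟩ := h.nbr₁ y hy hne
      exact ⟨a, ⟨a0, a1⟩, hy⟩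
  have s₂ : {y | ∃ a ∈ stabilizer G v₀ ⊓ stabilizer G v₁ ⊓ stabilizer G v₂, y = a • v₃} =
      {y | T.Adj v₂ y} \ {v₁} := by
    ext y
    constructor
    · rintro ⟨a, ha, rfl⟩
      refine ⟨?_, fun e => ?_⟩
      · have := h.smul_adj a _ _ h.adj₂₃
        rwa [show a • v₂ = v₂ from ha.2] at this
      · have := h.radius_smul ha.1.1 v₃
        rw [show a • v₃ = v₁ from e] at this
        omega
    · rintro ⟨hy, hne⟩
      obtain ⟨a, a0, a1, a2, hy⟩ := h.nbr₂ y hy hne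
      exact ⟨a, ⟨⟨a0, a1⟩, a2⟩, hy⟩
  have hD : stabilizer G v₀ ⊓ stabilizer G v₁ ⊓ stabilizer G v₂ ⊓ stabilizer G v₃ =
      stabilizer G v₀ ⊓ stabilizer G v₃ := by
    refine le_antisymm (le_inf (inf_le_left.trans (inf_le_left.trans inf_le_left)) inf_le_right) ?_
    rintro g ⟨g0, g3⟩
    have g2 := h.fixes₂_of_fixes₃ g0 g3
    exact ⟨⟨⟨g0, h.fixes₁_of_fixes₂ g0 g2⟩, g2⟩, g3⟩
  rw [s₀, h₀] at e₀
  rw [s₁, Set.ncard_sdiff_singleton_of_mem (show v₀ ∈ {y | T.Adj v₁ y} from h.adj₀₁.symm), h₁] at e₁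
  rw [s₂, Set.ncard_sdiff_singleton_of_mem (show v₁ ∈ {y | T.Adj v₂ y} from h.adj₁₂.symm), h₂,
    hD] at e₂
  omega

/-- An element fixing `v₂` also fixes `v₀`, so the stabilizer of `v₂` inside that of `v₃` is already
the stabilizer of the whole segment. -/
theorem card_stabilizer_third (h₃ : {y | T.Adj v₃ y}.ncard = 4) : Nat.card (stabilizer G v₃) =
    4 * Nat.card ↥(stabilizer G v₀ ⊓ stabilizer G v₃) := by
  have e₃ := card_eq_mul_ncard (stabilizer G v₃) v₂
  have s₃ : {y | ∃ a ∈ stabilizer G v₃, y = a • v₂} = {y | T.Adj v₃ y} := by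
    ext y
    constructor
    · rintro ⟨a, ha, rfl⟩
      have := h.smul_adj a _ _ h.adj₂₃.symm
      rwa [show a • v₃ = v₃ from ha] at this
    · exact h.nbr₃ y
  have hD : stabilizer G v₃ ⊓ stabilizer G v₂ = stabilizer G v₀ ⊓ stabilizer G v₃ := by
    ext g
    exact ⟨fun hg => ⟨h.fixes₀_of_fixes₂ hg.2, hg.1⟩,
      fun hg => ⟨hg.2, h.fixes₂_of_fixes₃ hg.1 hg.2⟩⟩
  rw [s₃, h₃, hD] at e₃
  omega

end BruhatTits.IsSegmentAction

namespace Qutrit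

open Matrix NumberField IsDedekindDomain BruhatTits

/-! ### The local field -/

/-- The valuation of `E_π`. -/
def vπ : Valuation Eπ (WithZero (Multiplicative ℤ)) :=
  (Valued.v : Valuation (primeπ.adicCompletion E) _)

theorem mem_Oπ_iff {x : Eπ} : x ∈ Oπ ↔ vπ x ≤ 1 :=
  HeightOneSpectrum.mem_adicCompletionIntegers ..

instance : IsPrincipalIdealRing Oπ :=
  inferInstanceAs (IsPrincipalIdealRing (primeπ.adicCompletionIntegers E))

theorem valued_algebraMap (x : E) :
    vπ (algebraMap E Eπ x) = primeπ.valuation E x :=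
  HeightOneSpectrum.valuedAdicCompletion_eq_valuation' primeπ x

theorem algebraMap_mem_Oπ_iff {x : E} : algebraMap E Eπ x ∈ Oπ ↔ primeπ.valuation E x ≤ 1 := by
  rw [mem_Oπ_iff, valued_algebraMap]

theorem coe_mem_Oπ (x : 𝓞 E) : algebraMap E Eπ x ∈ Oπ :=
  algebraMap_mem_Oπ_iff.2 (primeπ.valuation_le_one x)

theorem valuation_one_sub_ξ : primeπ.valuation E (1 - ξ) = WithZero.exp (-1 : ℤ) := by
  have h : (1 - ξ : E) = algebraMap (𝓞 E) E (1 - ξInt) := by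
    rw [map_sub, map_one]
    rfl
  rw [h, HeightOneSpectrum.valuation_of_algebraMap]
  refine primeπ.intValuation_singleton ?_ rfl
  intro h0
  refine primeπ.ne_bot ?_
  change Ideal.span {1 - ξInt} = ⊥
  rw [h0, Ideal.span_singleton_eq_bot]

theorem isEquiv_valuation : Valuation.IsEquiv vπ Oπ.valuation :=
  Valuation.isEquiv_valuation_valuationSubring (Valued.v : Valuation (primeπ.adicCompletion E) _)

theorem isUniformizer_π : IsUniformizer Oπ π where
  ne_zero := by
    rw [π, ne_eq, map_eq_zero_iff _ (algebraMap E Eπ).injective, sub_eq_zero]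
    exact fun h => ξ_spec.ne_one (by norm_num) h.symm
  lt_one := by
    rw [← isEquiv_valuation.lt_one_iff_lt_one]
    change vπ (algebraMap E Eπ (1 - ξ)) < 1
    rw [valued_algebraMap, valuation_one_sub_ξ, ← WithZero.exp_zero, WithZero.exp_lt_exp]
    norm_num
  exists_zpow x hx := by
    have hx' : vπ x ≠ 0 := (Valuation.ne_zero_iff _).2 hx
    obtain ⟨n, hn⟩ : ∃ n : ℤ, vπ x = WithZero.exp n :=
      ⟨WithZero.log (vπ x), (WithZero.exp_log hx').symm⟩
    refine ⟨-n, ?_⟩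
    rw [← map_zpow₀, ← isEquiv_valuation.eq_iff]
    rw [map_zpow₀, hn]
    change _ = (vπ (algebraMap E Eπ (1 - ξ))) ^ (-n)
    rw [valued_algebraMap, valuation_one_sub_ξ, ← WithZero.exp_zsmul]
    simp

theorem card_quotient : Nat.card (𝓞 E ⧸ primeπ.asIdeal) = 3 := by
  have : Fact (Nat.Prime 3) := ⟨Nat.prime_three⟩
  have : IsCyclotomicExtension {3 ^ (1 + 1)} ℚ E :=
    (inferInstance : IsCyclotomicExtension {9} ℚ E)
  have h : IsPrimitiveRoot ξ (3 ^ (1 + 1)) := ξ_spec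
  have h1 := h.card_quotient_toInteger_sub_one
  have h2 : Ideal.span {h.toInteger - 1} = primeπ.asIdeal := by
    change _ = Ideal.span {1 - ξInt}
    rw [← Ideal.span_singleton_neg, neg_sub]
    rfl
  rw [h2, h.norm_toInteger_sub_one_of_prime_ne_two (by norm_num)] at h1
  exact h1

theorem residue_cases (x : 𝓞 E) : ∃ c : ℤ, (c = 0 ∨ c = 1 ∨ c = -1) ∧ x - c ∈ primeπ.asIdeal := by
  classical
  have hc := card_quotient
  let Q := 𝓞 E ⧸ primeπ.asIdeal
  have : Finite Q := Nat.finite_of_card_ne_zero (by rw [hc]; norm_num)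
  have : Fintype Q := Fintype.ofFinite Q
  have hc' : Fintype.card Q = 3 := by rw [← Nat.card_eq_fintype_card, hc]
  have h3 : (3 : Q) = 0 := by
    have := card_nsmul_eq_zero (x := (1 : Q))
    rw [hc', nsmul_eq_mul, mul_one] at this
    exact_mod_cast this
  have : Nontrivial Q := Fintype.one_lt_card_iff_nontrivial.1 (by rw [hc']; norm_num)
  have h01 : (0 : Q) ≠ 1 := zero_ne_one
  have h0m : (0 : Q) ≠ -1 := by
    intro h
    exact h01 (by linear_combination -h)
  have h1m : (1 : Q) ≠ -1 := by
    intro h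
    exact h01 (by linear_combination h - h3)
  have huniv : ({0, 1, -1} : Finset Q) = Finset.univ := by
    rw [← Finset.card_eq_iff_eq_univ, hc', Finset.card_eq_three]
    exact ⟨0, 1, -1, h01, h0m, h1m, rfl⟩
  have hx : (Ideal.Quotient.mk primeπ.asIdeal x : Q) ∈ ({0, 1, -1} : Finset Q) := by
    rw [huniv]
    exact Finset.mem_univ _
  have key : ∀ c : ℤ, (Ideal.Quotient.mk primeπ.asIdeal x : Q) = (c : Q) →
      x - c ∈ primeπ.asIdeal := by
    intro c h
    rw [← Ideal.Quotient.eq, h, map_intCast]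
  simp only [Finset.mem_insert, Finset.mem_singleton] at hx
  rcases hx with hx | hx | hx
  · exact ⟨0, Or.inl rfl, key 0 (by simpa using hx)⟩
  · exact ⟨1, Or.inr (Or.inl rfl), key 1 (by simpa using hx)⟩
  · exact ⟨-1, Or.inr (Or.inr rfl), key (-1) (by simpa using hx)⟩

theorem lt_one_iff_exists {x : Eπ} : vπ x < 1 ↔
    ∃ y ∈ Oπ, x = π * y := by
  have h0 := isUniformizer_π.ne_zero
  have key : vπ x < 1 ↔
      vπ (π⁻¹ * x) ≤ 1 := by
    have h2 : vπ π = WithZero.exp (-1 : ℤ) :=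
      (valued_algebraMap _).trans valuation_one_sub_ξ
    rw [map_mul, map_inv₀, h2]
    rcases eq_or_ne (vπ x) 0 with hz | hz
    · rw [hz]
      simp
    · obtain ⟨n, hn⟩ : ∃ n : ℤ, vπ x = WithZero.exp n :=
        ⟨_, (WithZero.exp_log hz).symm⟩
      rw [hn, ← WithZero.exp_neg, ← WithZero.exp_add, ← WithZero.exp_zero, WithZero.exp_lt_exp,
        WithZero.exp_le_exp]
      omega
  rw [key, ← mem_Oπ_iff]
  constructor
  · exact fun h => ⟨_, h, by rw [mul_inv_cancel_left₀ h0]⟩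
  · rintro ⟨y, hy, rfl⟩
    rwa [inv_mul_cancel_left₀ h0]

/-- By density `x` is approximated modulo `π` by an element of `E`, then by an algebraic integer,
and the residue field of `𝓞 E` has three elements. -/
theorem local_residue_cases {x : Eπ} (hx : x ∈ Oπ) :
    ∃ c : ℤ, (c = 0 ∨ c = 1 ∨ c = -1) ∧ ∃ y ∈ Oπ, x = c + π * y := by
  obtain ⟨z, hz⟩ : ∃ z : E, vπ (x - algebraMap E Eπ z) < 1 := by
    have hd := HeightOneSpectrum.denseRange_algebraMap E primeπ
    let x' : primeπ.adicCompletion E := x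
    have ho : IsOpen {z : primeπ.adicCompletion E | Valued.v (x' - z) < 1} := by
      have := (Valued.isOpen_ball (primeπ.adicCompletion E) 1).preimage
        ((continuous_const (y := x')).sub continuous_id)
      simp only [Valuation.restrict_lt_one_iff] at this
      exact this
    exact hd.exists_mem_open ho ⟨x', by simp⟩
  have hvx : vπ x ≤ 1 := mem_Oπ_iff.1 hx
  have hz1 : primeπ.valuation E z ≤ 1 := by
    rw [← valued_algebraMap]
    have : vπ (x - (x - algebraMap E Eπ z)) ≤ 1 :=
      (Valuation.map_sub vπ _ _).trans (max_le hvx hz.le)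
    rwa [sub_sub_cancel] at this
  obtain ⟨a, ha⟩ := primeπ.exists_valuation_sub_lt_of_integer hz1 1
  obtain ⟨c, hc, hac⟩ := residue_cases a
  refine ⟨c, hc, ?_⟩
  have h1 : vπ (x - c) < 1 := by
    have e1 : vπ (algebraMap E Eπ (algebraMap (𝓞 E) E a - z)) < 1 := by
      refine (valued_algebraMap _).trans_lt ?_
      simpa using ha
    have e2 : vπ (algebraMap E Eπ (algebraMap (𝓞 E) E (a - c))) < 1 := by
      refine (valued_algebraMap _).trans_lt ?_
      rwa [HeightOneSpectrum.valuation_lt_one_iff_mem]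
    have e3 : (x - c : Eπ) = (x - algebraMap E Eπ z) - algebraMap E Eπ (algebraMap (𝓞 E) E a - z) +
        algebraMap E Eπ (algebraMap (𝓞 E) E (a - c)) := by
      simp only [map_sub, map_intCast]
      ring
    rw [e3]
    exact Valuation.map_add_lt vπ (Valuation.map_sub_lt vπ hz e1) e2
  obtain ⟨y, hy, hxy⟩ := lt_one_iff_exists.1 h1
  exact ⟨y, hy, by rw [← hxy]; ring⟩

end Qutrit

namespace Qutrit

open Matrix NumberField IsDedekindDomain BruhatTits

/-! ### Integrality away from `3` -/

theorem coe_ξInt : ((ξInt : 𝓞 E) : E) = ξ := rfl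

theorem ξ_relation : ξ ^ 6 + ξ ^ 3 + 1 = 0 := by
  linear_combination ζ₃_eq

theorem exists_pow_mul_eq {x : E} (hx : x ∈ R) : ∃ (m : ℕ) (y : 𝓞 E), (1 - ξ) ^ m * x = y := by
  induction hx using Algebra.adjoin_induction with
  | mem x hx =>
    rcases hx with rfl | rfl
    · exact ⟨0, ξInt, by rw [coe_ξInt]; ring⟩
    -- The coefficients are those of `((1 - X)⁶ - (X⁶ + X³ + 1)) / 3`.
    · refine ⟨6, -2 * ξInt + 5 * ξInt ^ 2 - 7 * ξInt ^ 3 + 5 * ξInt ^ 4 - 2 * ξInt ^ 5, ?_⟩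
      simp only [map_add, map_sub, map_mul, map_neg, map_pow, map_ofNat, coe_ξInt]
      linear_combination (1 / 3) * ξ_relation
  | algebraMap n => exact ⟨0, n, by simp⟩
  | add x y _ _ hx hy =>
    obtain ⟨m, a, ha⟩ := hx
    obtain ⟨n, b, hb⟩ := hy
    refine ⟨m + n, (1 - ξInt) ^ n * a + (1 - ξInt) ^ m * b, ?_⟩
    simp only [map_add, map_sub, map_mul, map_one, map_pow, coe_ξInt, ← ha, ← hb]
    ring
  | mul x y _ _ hx hy =>
    obtain ⟨m, a, ha⟩ := hx
    obtain ⟨n, b, hb⟩ := hy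
    refine ⟨m + n, a * b, ?_⟩
    simp only [map_mul, ← ha, ← hb]
    ring

/-- Elements of `R` have only powers of `1 - ξ` as denominators. Integrality at `π` allows these to
be cancelled one factor at a time. -/
theorem exists_coe_eq {x : E} (hx : x ∈ R) (hv : primeπ.valuation E x ≤ 1) :
    ∃ y : 𝓞 E, (y : E) = x := by
  have h0 : (1 - ξ : E) ≠ 0 := sub_ne_zero.2 (ξ_spec.ne_one (by norm_num)).symm
  obtain ⟨m, y, hy⟩ := exists_pow_mul_eq hx
  induction m generalizing y with
  | zero => exact ⟨y, by rw [← hy]; ring⟩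
  | succ m ih =>
    have hlt : primeπ.valuation E (y : E) < 1 := by
      rw [← hy, map_mul, map_pow, valuation_one_sub_ξ]
      refine mul_lt_one_of_lt_of_le ?_ hv
      refine pow_lt_one₀ zero_le ?_ (Nat.succ_ne_zero m)
      rw [← WithZero.exp_zero, WithZero.exp_lt_exp]
      norm_num
    have hmem : y ∈ primeπ.asIdeal := (primeπ.valuation_lt_one_iff_mem y).1 hlt
    obtain ⟨z, rfl⟩ := Ideal.mem_span_singleton.1 (show y ∈ Ideal.span {1 - ξInt} from hmem)
    refine ih z (mul_left_cancel₀ h0 ?_)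
    have e : (((1 - ξInt) * z : 𝓞 E) : E) = (1 - ξ) * z := by
      rw [← coe_ξInt]
      simp
    rw [← e, ← hy]
    ring

/-- At each of the six embeddings `2 |φ y| |φ z| ≤ |φ w|²`. The product over them is `2⁶ |N y| |N z|
≤ |N w|² ≤ 9`, whereas the norms of nonzero integers are at least 1. -/
theorem norm_two_ne {y z w : 𝓞 E} (hy : y ≠ 0) (hz : z ≠ 0) (hw : |Algebra.norm ℤ w| ≤ 3)
    (h : ∀ φ : E →ₐ[ℚ] ℂ, ‖φ y‖ ^ 2 + ‖φ z‖ ^ 2 ≤ ‖φ w‖ ^ 2) : False := by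
  have hN : ∀ x : 𝓞 E, ∏ φ : E →ₐ[ℚ] ℂ, ‖φ x‖ = |(Algebra.norm ℤ x : ℝ)| := by
    intro x
    have h1 := Algebra.norm_eq_prod_embeddings ℚ ℂ (x : E)
    rw [← Algebra.coe_norm_int] at h1
    rw [← norm_prod, ← h1]
    simp [Complex.norm_intCast]
  have hN1 : ∀ x : 𝓞 E, x ≠ 0 → 1 ≤ |(Algebra.norm ℤ x : ℝ)| := by
    intro x hx
    have : Algebra.norm ℤ x ≠ 0 := Algebra.norm_ne_zero_iff.2 hx
    exact_mod_cast Int.one_le_abs this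
  have hcard : Fintype.card (E →ₐ[ℚ] ℂ) = 6 := by
    rw [AlgHom.card, IsCyclotomicExtension.finrank (n := 9) E
      (Polynomial.cyclotomic.irreducible_rat (by norm_num))]
    decide
  have hp : ∏ φ : E →ₐ[ℚ] ℂ, (2 * (‖φ y‖ * ‖φ z‖)) ≤ ∏ φ : E →ₐ[ℚ] ℂ, ‖φ w‖ ^ 2 := by
    refine Finset.prod_le_prod (fun φ _ => by positivity) fun φ _ => ?_
    nlinarith [h φ, sq_nonneg (‖φ y‖ - ‖φ z‖)]
  rw [Finset.prod_mul_distrib, Finset.prod_mul_distrib, Finset.prod_const, Finset.card_univ, hcard,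
    Finset.prod_pow, hN, hN, hN] at hp
  have hw' : |(Algebra.norm ℤ w : ℝ)| ≤ 3 := by exact_mod_cast hw
  have h1 : 1 ≤ |(Algebra.norm ℤ y : ℝ)| * |(Algebra.norm ℤ z : ℝ)| :=
    one_le_mul_of_one_le_of_one_le (hN1 y hy) (hN1 z hz)
  have h2 : |(Algebra.norm ℤ w : ℝ)| ^ 2 ≤ 3 ^ 2 := pow_le_pow_left₀ (abs_nonneg _) hw' 2
  linarith

theorem abs_norm_one_sub_ξInt : |Algebra.norm ℤ (1 - ξInt)| ≤ 3 := by
  have : Fact (Nat.Prime 3) := ⟨Nat.prime_three⟩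
  have : IsCyclotomicExtension {3 ^ (1 + 1)} ℚ E :=
    (inferInstance : IsCyclotomicExtension {9} ℚ E)
  have h : IsPrimitiveRoot ξ (3 ^ (1 + 1)) := ξ_spec
  have h2 : Ideal.span {h.toInteger - 1} = Ideal.span {1 - ξInt} := by
    rw [← Ideal.span_singleton_neg, neg_sub]
    rfl
  have h1 := congrArg Ideal.absNorm h2
  rw [Ideal.absNorm_span_singleton, Ideal.absNorm_span_singleton,
    h.norm_toInteger_sub_one_of_prime_ne_two (by norm_num)] at h1
  rw [Int.abs_eq_natAbs, ← h1]
  norm_num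

theorem norm_embedding_star_mul (φ : E →ₐ[ℚ] ℂ) (x : E) : φ (star x * x) = ((‖φ x‖ ^ 2 : ℝ) : ℂ) := by
  have h1 : φ (star x) = starRingEnd ℂ (φ x) := IsCMField.complexEmbedding_complexConj E (φ : E →+* ℂ) x
  rw [map_mul, h1, Complex.conj_mul']
  push_cast
  rfl

/-- In a vector of integers of length `|w|`, with `w` of small norm, at most one entry is
nonzero. -/
theorem unique_ne_zero {y : Fin 3 → 𝓞 E} {w : 𝓞 E} (hw : |Algebra.norm ℤ w| ≤ 3)
    (h : ∑ i, star (y i : E) * y i = star (w : E) * w) {i j : Fin 3} (hi : y i ≠ 0) (hj : y j ≠ 0) :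
    i = j := by
  by_contra hij
  refine norm_two_ne hi hj hw fun φ => ?_
  have h1 := congrArg φ h
  rw [map_sum, norm_embedding_star_mul] at h1
  simp only [norm_embedding_star_mul] at h1
  have h2 : ∑ i, ‖φ (y i)‖ ^ 2 = ‖φ w‖ ^ 2 := by exact_mod_cast h1
  rw [← h2, ← Finset.sum_pair (f := fun i => ‖φ (y i)‖ ^ 2) hij]
  exact Finset.sum_le_sum_of_subset_of_nonneg (Finset.subset_univ _) fun _ _ _ => by positivity

/-! ### The integral unitary matrices -/

/-- Conjugation preserves `ord`, so `2 ord x = 0`. -/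
theorem algebraMap_mem_of_norm_one {x : E} (hx : star x * x = 1) : algebraMap E Eπ x ∈ Oπ := by
  have h0 : algebraMap E Eπ x ≠ 0 := by
    intro h
    rw [map_eq_zero_iff _ (algebraMap E Eπ).injective] at h
    rw [h, mul_zero] at hx
    exact zero_ne_one hx
  have h1 := congrArg (algebraMap E Eπ) hx
  rw [map_mul, algebraMap_star, map_one] at h1
  have h2 := congrArg (ord isUniformizer_π) h1
  rw [ord_mul _ (star_ne_zero.2 h0) h0, ord_star _ h0, ord_one] at h2
  rw [mem_iff_ord_nonneg isUniformizer_π h0]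
  omega

theorem column_norm (g : U₃R) (j : Fin 3) :
    ∑ i, star ((g.1 : Matrix (Fin 3) (Fin 3) E) i j) * (g.1 : Matrix (Fin 3) (Fin 3) E) i j = 1 := by
  have h : star (g.1 : Matrix (Fin 3) (Fin 3) E) * (g.1 : Matrix (Fin 3) (Fin 3) E) = 1 := g.1.2.1
  have h1 := congrFun (congrFun h j) j
  rwa [Matrix.mul_apply, Matrix.one_apply_eq] at h1

theorem column_orthogonal (g : U₃R) {j k : Fin 3} (hjk : j ≠ k) :
    ∑ i, star ((g.1 : Matrix (Fin 3) (Fin 3) E) i j) * (g.1 : Matrix (Fin 3) (Fin 3) E) i k = 0 := by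
  have h : star (g.1 : Matrix (Fin 3) (Fin 3) E) * (g.1 : Matrix (Fin 3) (Fin 3) E) = 1 := g.1.2.1
  have h1 := congrFun (congrFun h j) k
  rwa [Matrix.mul_apply, Matrix.one_apply_ne hjk] at h1

/-- A column of `g` whose multiple by `w` is integral is a unit times a standard basis vector. -/
theorem exists_column_support (g : U₃R) {w : 𝓞 E} (hw0 : w ≠ 0) (hw : |Algebra.norm ℤ w| ≤ 3)
    {j : Fin 3} (h : ∀ i, ∃ y : 𝓞 E, (y : E) = w * (g.1 : Matrix (Fin 3) (Fin 3) E) i j) :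
    ∃ i, star ((g.1 : Matrix (Fin 3) (Fin 3) E) i j) * (g.1 : Matrix (Fin 3) (Fin 3) E) i j = 1 ∧
      ∀ k, k ≠ i → (g.1 : Matrix (Fin 3) (Fin 3) E) k j = 0 := by
  have hw0' : (w : E) ≠ 0 := by simpa using hw0
  choose y hy using h
  have hsum : ∑ i, star (y i : E) * y i = star (w : E) * w := by
    have h1 := column_norm g j
    calc ∑ i, star (y i : E) * y i = star (w : E) * w * ∑ i,
          star ((g.1 : Matrix (Fin 3) (Fin 3) E) i j) * (g.1 : Matrix (Fin 3) (Fin 3) E) i j := by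
          rw [Finset.mul_sum]
          refine Finset.sum_congr rfl fun i _ => ?_
          rw [hy, star_mul']
          ring
      _ = _ := by rw [h1, mul_one]
  obtain ⟨i, hi⟩ : ∃ i, y i ≠ 0 := by
    by_contra! h0
    have h2 : star (w : E) * w = 0 := by
      rw [← hsum]
      simp [h0]
    exact mul_ne_zero (star_ne_zero.2 hw0') hw0' h2
  have hk : ∀ k, k ≠ i → (g.1 : Matrix (Fin 3) (Fin 3) E) k j = 0 := by
    intro k hki
    by_contra hne
    refine hki (unique_ne_zero hw hsum ?_ hi)
    intro h0
    have h3 := (hy k).symm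
    rw [h0] at h3
    exact mul_ne_zero hw0' hne (h3.trans (map_zero (algebraMap (𝓞 E) E)))
  refine ⟨i, ?_, hk⟩
  rw [← column_norm g j, Finset.sum_eq_single i]
  · intro k _ hki
    rw [hk k hki, mul_zero]
  · simp

/-- A denominator `1 - ξ` has norm 3, small enough for `exists_column_support`. So each column has a
single nonzero entry, of absolute value one, and such an entry is a local unit. This gap is what
keeps the orbit of `v₀` away from `v₁`, `v₂` and `v₃`. -/
theorem entry_mem_of_mul_mem (g : U₃R)
    (h : ∀ i j, π * algebraMap E Eπ ((g.1 : Matrix (Fin 3) (Fin 3) E) i j) ∈ Oπ) (i j : Fin 3) :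
    algebraMap E Eπ ((g.1 : Matrix (Fin 3) (Fin 3) E) i j) ∈ Oπ := by
  have hw0 : (1 - ξInt : 𝓞 E) ≠ 0 := by
    intro h0
    have h1 := congrArg (fun x : 𝓞 E => (x : E)) h0
    refine sub_ne_zero.2 (ξ_spec.ne_one (by norm_num)).symm (?_ : (1 - ξ : E) = 0)
    simpa [coe_ξInt] using h1
  obtain ⟨k, hk, hk0⟩ := exists_column_support g (j := j) hw0 abs_norm_one_sub_ξInt (fun i => by
    refine exists_coe_eq ?_ ?_
    · have : ((1 - ξInt : 𝓞 E) : E) = 1 - ξ := by simp [coe_ξInt]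
      rw [this]
      exact mul_mem (sub_mem (one_mem R) ξ_mem) (g.2 i j)
    · rw [← algebraMap_mem_Oπ_iff, map_mul]
      convert h i j
      simp [π, coe_ξInt])
  rcases eq_or_ne i k with rfl | hik
  · exact algebraMap_mem_of_norm_one hk
  · rw [hk0 i hik, map_zero]
    exact zero_mem Oπ

theorem isPrimitiveRoot_neg_ξ : IsPrimitiveRoot (-ξ) 18 := by
  rw [IsPrimitiveRoot.iff_orderOf, neg_eq_neg_one_mul,
    (Commute.all _ _).orderOf_mul_eq_mul_orderOf_of_coprime]
  · simp [← ξ_spec.eq_orderOf]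
  · simp [← ξ_spec.eq_orderOf]
    decide

theorem card_rootsOfUnity : Nat.card (rootsOfUnity 18 E) = 18 :=
  isPrimitiveRoot_neg_ξ.card_rootsOfUnity

/-- Kronecker's theorem: an algebraic integer all of whose conjugates have absolute value one is a
root of unity, and the roots of unity of `E` are the powers of `-ξ`. -/
theorem exists_rootsOfUnity {x : E} (hx : star x * x = 1) (hR : x ∈ R) :
    ∃ u : rootsOfUnity 18 E, ((u : Eˣ) : E) = x := by
  obtain ⟨y, hy⟩ := exists_coe_eq hR (algebraMap_mem_Oπ_iff.1 (algebraMap_mem_of_norm_one hx))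
  obtain ⟨n, hn, hxn⟩ := Embeddings.pow_eq_one_of_norm_eq_one E ℂ (hy ▸ y.2 : IsIntegral ℤ x)
    (fun φ => by
      have h1 : φ (star x) = starRingEnd ℂ (φ x) := IsCMField.complexEmbedding_complexConj E φ x
      have h2 := congrArg φ hx
      rw [map_mul, h1, Complex.conj_mul', map_one] at h2
      have h3 : ‖φ x‖ ^ 2 = 1 := by exact_mod_cast h2
      exact (pow_eq_one_iff_of_nonneg (norm_nonneg _) two_ne_zero).1 h3)
  obtain ⟨r, rfl⟩ := ξ_spec.exists_neg_pow_of_isOfFinOrder (by decide)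
    (isOfFinOrder_iff_pow_eq_one.2 ⟨n, hn, hxn⟩)
  refine ⟨rootsOfUnity.mkOfPowEq ((-ξ) ^ r) ?_, rfl⟩
  rw [← pow_mul, mul_comm, pow_mul, isPrimitiveRoot_neg_ξ.pow_eq_one, one_pow]

theorem coe_mem_R (u : rootsOfUnity 18 E) : ((u : Eˣ) : E) ∈ R := by
  obtain ⟨i, -, hi⟩ := isPrimitiveRoot_neg_ξ.eq_pow_of_pow_eq_one
    ((mem_rootsOfUnity' 18 (u : Eˣ)).1 u.2)
  rw [← hi]
  exact pow_mem (neg_mem ξ_mem) i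

theorem star_mul_coe (u : rootsOfUnity 18 E) : star ((u : Eˣ) : E) * ((u : Eˣ) : E) = 1 := by
  obtain ⟨i, -, hi⟩ := isPrimitiveRoot_neg_ξ.eq_pow_of_pow_eq_one
    ((mem_rootsOfUnity' 18 (u : Eˣ)).1 u.2)
  rw [← hi, star_pow, ← mul_pow, star_neg, neg_mul_neg, star_ξ,
    inv_mul_cancel₀ (ξ_spec.ne_zero (by norm_num)), one_pow]

/-- The monomial matrices with roots of unity as entries. -/
def monomial (σ : Equiv.Perm (Fin 3)) (u : Fin 3 → rootsOfUnity 18 E) : U₃R :=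
  mkU₃R (Matrix.of fun i j => if i = σ j then ((u j : Eˣ) : E) else 0)
    (by
      ext j k
      rw [Matrix.mul_apply, Finset.sum_eq_single (σ j)]
      · by_cases hjk : j = k
        · subst hjk
          simpa [Matrix.star_apply] using star_mul_coe (u j)
        · simp [hjk]
      · intro i _ hi
        simp [Matrix.star_apply, hi]
      · simp)
    (fun i j => by
      rw [Matrix.of_apply]
      split_ifs
      · exact coe_mem_R _
      · exact zero_mem R)

theorem monomial_apply (σ : Equiv.Perm (Fin 3)) (u : Fin 3 → rootsOfUnity 18 E) (i j : Fin 3) :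
    ((monomial σ u).1 : Matrix (Fin 3) (Fin 3) E) i j = if i = σ j then ((u j : Eˣ) : E) else 0 :=
  rfl

theorem monomial_injective :
    Function.Injective fun p : Equiv.Perm (Fin 3) × (Fin 3 → rootsOfUnity 18 E) =>
      monomial p.1 p.2 := by
  rintro ⟨σ, u⟩ ⟨τ, w⟩ h
  have h1 : ∀ i j, (if i = σ j then ((u j : Eˣ) : E) else 0) =
      if i = τ j then ((w j : Eˣ) : E) else 0 := fun i j =>
    congrArg (fun g : U₃R => (g.1 : Matrix (Fin 3) (Fin 3) E) i j) h
  have h2 : ∀ j, σ j = τ j := by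
    intro j
    by_contra hne
    have := h1 (σ j) j
    rw [if_pos rfl, if_neg hne] at this
    exact Units.ne_zero _ this
  obtain rfl : σ = τ := Equiv.ext h2
  have h3 : u = w := by
    funext j
    have := h1 (σ j) j
    rw [if_pos rfl, if_pos rfl] at this
    exact Subtype.ext (Units.ext this)
  rw [h3]

theorem exists_monomial (g : U₃R)
    (h : ∀ i j, algebraMap E Eπ ((g.1 : Matrix (Fin 3) (Fin 3) E) i j) ∈ Oπ) :
    ∃ p : Equiv.Perm (Fin 3) × (Fin 3 → rootsOfUnity 18 E), monomial p.1 p.2 = g := by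
  have hcol : ∀ j, ∃ i,
      star ((g.1 : Matrix (Fin 3) (Fin 3) E) i j) * (g.1 : Matrix (Fin 3) (Fin 3) E) i j = 1 ∧
        ∀ k, k ≠ i → (g.1 : Matrix (Fin 3) (Fin 3) E) k j = 0 := fun j =>
    exists_column_support g (w := 1) one_ne_zero (by norm_num) fun i => by
      obtain ⟨y, hy⟩ := exists_coe_eq (g.2 i j) (algebraMap_mem_Oπ_iff.1 (h i j))
      exact ⟨y, by simp [hy]⟩
  choose s hs hs0 using hcol
  choose u hu using fun j => exists_rootsOfUnity (hs j) (g.2 _ _)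
  have hinj : Function.Injective s := by
    intro j k hjk
    by_contra hne
    have h1 := column_orthogonal g hne
    rw [Finset.sum_eq_single (s j)] at h1
    · refine mul_ne_zero (star_ne_zero.2 ?_) ?_ h1
      · rw [← hu j]
        exact Units.ne_zero _
      · rw [hjk, ← hu k]
        exact Units.ne_zero _
    · intro i _ hi
      rw [hs0 j i hi, star_zero, zero_mul]
    · simp
  refine ⟨⟨Equiv.ofBijective s (Finite.injective_iff_bijective.1 hinj), u⟩, ?_⟩
  refine Subtype.ext (Subtype.ext ?_)
  ext i j
  rw [monomial_apply, Equiv.ofBijective_apply]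
  split_ifs with hi
  · rw [hi, hu j]
  · exact (hs0 j i hi).symm

theorem card_integral : Nat.card {g : U₃R |
    ∀ i j, algebraMap E Eπ ((g.1 : Matrix (Fin 3) (Fin 3) E) i j) ∈ Oπ} = 6 * 18 ^ 3 := by
  have h : {g : U₃R | ∀ i j, algebraMap E Eπ ((g.1 : Matrix (Fin 3) (Fin 3) E) i j) ∈ Oπ} =
      Set.range fun p : Equiv.Perm (Fin 3) × (Fin 3 → rootsOfUnity 18 E) => monomial p.1 p.2 := by
    refine Set.Subset.antisymm (fun g hg => exists_monomial g hg) ?_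
    rintro _ ⟨p, rfl⟩ i j
    rw [monomial_apply]
    split_ifs
    · exact algebraMap_mem_of_norm_one (star_mul_coe _)
    · rw [map_zero]
      exact zero_mem Oπ
  rw [h, ← Nat.card_congr (Equiv.ofInjective _ monomial_injective), Nat.card_prod, Nat.card_fun,
    Nat.card_perm, card_rootsOfUnity]
  simp [Nat.factorial]

theorem card_center : Nat.card (Subgroup.center U₃R) = 18 := by
  let f : rootsOfUnity 18 E → Subgroup.center U₃R := fun u => ⟨monomial 1 fun _ => u, by
    rw [Subgroup.mem_center_iff]
    intro g
    have hs : ((monomial 1 fun _ => u).1 : Matrix (Fin 3) (Fin 3) E) =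
        Matrix.scalar (Fin 3) ((u : Eˣ) : E) := by
      ext i j
      by_cases hij : i = j <;> simp [monomial_apply, hij]
    refine Subtype.ext (Subtype.ext ?_)
    change (g.1 : Matrix (Fin 3) (Fin 3) E) * ((monomial 1 fun _ => u).1 : Matrix _ _ E) =
      ((monomial 1 fun _ => u).1 : Matrix _ _ E) * (g.1 : Matrix (Fin 3) (Fin 3) E)
    rw [hs]
    exact (Matrix.scalar_commute _ (Commute.all _) _).eq.symm⟩
  rw [← card_rootsOfUnity]
  refine (Nat.card_congr (Equiv.ofBijective f ⟨?_, ?_⟩)).symm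
  · intro u w h
    have := monomial_injective (a₁ := (1, fun _ => u)) (a₂ := (1, fun _ => w))
      (congrArg Subtype.val h)
    exact congrFun (congrArg Prod.snd this) 0
  · rintro ⟨z, hz⟩
    have hs := center_isScalar hz
    set c := (z.1 : Matrix (Fin 3) (Fin 3) E) 0 0 with hc
    have h1 := column_norm z 0
    rw [hs, Finset.sum_eq_single 0] at h1
    · have hc1 : star c * c = 1 := by simpa using h1
      obtain ⟨u, hu⟩ := exists_rootsOfUnity hc1 (z.2 0 0)
      refine ⟨u, Subtype.ext (Subtype.ext (Subtype.ext ?_))⟩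
      change ((monomial 1 fun _ => u).1 : Matrix (Fin 3) (Fin 3) E) = z.1
      rw [hs]
      ext i j
      by_cases hij : i = j <;> simp [monomial_apply, hij, hu]
    · intro k _ hk
      simp [hk]
    · simp

/-! ### The stabilizer of the base vertex -/

theorem top_mk_smul (g : U₃R) (s : TVertex) : top isUniformizer_π ((QuotientGroup.mk g : Γ) • s) =
    act (toLocal g : GL (Fin 3) Eπ) (top isUniformizer_π s) :=
  top_smul isUniformizer_π (toLocal g) s

theorem top_mk_smul_base (g : U₃R) : top isUniformizer_π ((QuotientGroup.mk g : Γ) • v₀) =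
    lattice Oπ (toLocal g : GL (Fin 3) Eπ) := by
  rw [top_mk_smul, top_baseVertex, act_lattice, mul_one]

theorem dual_lattice_toLocal (g : U₃R) : dual (lattice Oπ (toLocal g : GL (Fin 3) Eπ)) =
    lattice Oπ (toLocal g : GL (Fin 3) Eπ) := by
  have h : sharp (toLocal g : GL (Fin 3) Eπ) = (toLocal g : GL (Fin 3) Eπ) := (toLocal g).2
  rw [← lattice_sharp, h]

theorem lattice_toLocal_le_iff (g : U₃R) :
    lattice Oπ (toLocal g : GL (Fin 3) Eπ) ≤ lattice Oπ 1 ↔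
      ∀ i j, algebraMap E Eπ ((g.1 : Matrix (Fin 3) (Fin 3) E) i j) ∈ Oπ := by
  rw [lattice_le_iff]
  simp only [inv_one, one_mul]
  rfl

theorem smul_base_eq_iff (g : U₃R) : (QuotientGroup.mk g : Γ) • v₀ = v₀ ↔
    ∀ i j, algebraMap E Eπ ((g.1 : Matrix (Fin 3) (Fin 3) E) i j) ∈ Oπ := by
  rw [← lattice_toLocal_le_iff, ← (top_injective isUniformizer_π).eq_iff, top_mk_smul_base,
    top_baseVertex]
  refine ⟨fun h => h.le, fun h => lattice_eq_of_le_of_vol_le isUniformizer_π h ?_⟩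
  rw [vol_one, vol_of_selfDual isUniformizer_π (dual_lattice_toLocal g)]

/-- The preimage of the stabilizer in `U₃R` is the set of integral matrices counted in
`card_integral`, a union of cosets of the center. -/
theorem card_stabilizer_base : Nat.card (MulAction.stabilizer Γ v₀) = 1944 := by
  have h : Nat.card ((QuotientGroup.mk : U₃R → Γ) ⁻¹' (MulAction.stabilizer Γ v₀ : Set Γ)) =
      6 * 18 ^ 3 := by
    rw [← card_integral]
    refine congrArg (fun S : Set U₃R => Nat.card S) ?_
    ext g
    exact smul_base_eq_iff g
  rw [Nat.card_congr (QuotientGroup.preimageMkEquivSubgroupProdSet _ _), Nat.card_prod,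
    card_center] at h
  change 18 * Nat.card (MulAction.stabilizer Γ v₀) = 6 * 18 ^ 3 at h
  omega

/-- No vertex of the orbit of the base vertex lies at a distance between `1` and `3` from it. -/
theorem smul_base_eq_of_radius_le {g : Γ} (h : radius isUniformizer_π (g • v₀) ≤ 3) :
    g • v₀ = v₀ := by
  obtain ⟨g, rfl⟩ := QuotientGroup.mk_surjective g
  rw [radius, top_mk_smul_base, dual_lattice_toLocal] at h
  -- For a self-dual lattice the radius is twice the exponent, so radius at most 3 means exponent at
  -- most 1.
  have h1 : expo π (lattice Oπ (toLocal g : GL (Fin 3) Eπ)) ≤ 1 := by omega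
  rw [expo_le_iff isUniformizer_π, pow_one] at h1
  rw [smul_base_eq_iff]
  refine entry_mem_of_mul_mem g fun i j => ?_
  have h2 := h1 (Submodule.smul_mem_pointwise_smul _ π _ (col_mem_lattice _ j))
  exact mem_lattice_one.1 h2 i

end Qutrit

/-! ### Adjacency and images of vertices from inclusions and volumes -/

namespace BruhatTits

open Matrix

section Neighbours

variable {K : Type*} [Field K] [StarRing K] {O : ValuationSubring K} {ϖ : K} [StarStable O]

/-- The lattices `M`, `L`, `M^#` and `ϖM` have volumes -1, 0, 1 and 2, so all the inclusions are
strict. -/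
theorem incident_of_le (hϖ : IsUniformizer O ϖ) {l m : GL (Fin 3) K}
    (hl : dual (lattice O l) = lattice O l) (hlm : lattice O l ≤ lattice O m)
    (hm : ϖ • lattice O m ≤ dual (lattice O m)) (hv : vol hϖ m = -1) :
    Incident ϖ (lattice O l) (lattice O m) := by
  have hl0 := vol_of_selfDual hϖ hl
  have hd : dual (lattice O m) ≤ lattice O l := hl ▸ dual_anti hlm
  have hs : (ϖ : K) • lattice O m =
      lattice O (GeneralLinearGroup.scalar (Fin 3) (Units.mk0 ϖ hϖ.ne_zero) * m) := by
    rw [lattice_scalar_mul, Units.val_mk0]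
  have hvs : vol hϖ (GeneralLinearGroup.scalar (Fin 3) (Units.mk0 ϖ hϖ.ne_zero) * m) = 2 := by
    have h5 := ord_zpow hϖ 1
    rw [zpow_one] at h5
    rw [vol_mul, vol_scalar, hv, Units.val_mk0, h5]
    norm_num
  refine ⟨hl, hm.lt_of_ne fun h => ?_, hd.lt_of_ne fun h => ?_, hlm.lt_of_ne fun h => ?_⟩
  · rw [hs, ← lattice_sharp] at h
    have := vol_eq_of_lattice_eq hϖ h
    rw [hvs, vol_sharp, hv] at this
    omega
  · rw [← lattice_sharp] at h
    have := vol_eq_of_lattice_eq hϖ h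
    rw [vol_sharp, hl0, hv] at this
    omega
  · have := vol_eq_of_lattice_eq hϖ h
    omega

/-- The top lattice of the vertex `s` has volume `k`. -/
def HasVol (hϖ : IsUniformizer O ϖ) (s : TreeVertex O ϖ) (k : ℤ) : Prop :=
  ∃ l, top hϖ s = lattice O l ∧ vol hϖ l = k

theorem hasVol_of_selfDual (hϖ : IsUniformizer O ϖ) {s : TreeVertex O ϖ}
    (h : dual (top hϖ s) = top hϖ s) : HasVol hϖ s 0 := by
  obtain ⟨⟨l, hl⟩, -⟩ := top_admissible hϖ s
  rw [hl] at h
  exact ⟨l, hl, vol_of_selfDual hϖ h⟩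

theorem hasVol_of_incident (hϖ : IsUniformizer O ϖ) {L : Submodule O (Fin 3 → K)}
    {s : TreeVertex O ϖ} (h : Incident ϖ L (top hϖ s)) : HasVol hϖ s (-1) := by
  obtain ⟨⟨l, hl⟩, -⟩ := top_admissible hϖ s
  rw [hl] at h
  exact ⟨l, hl, vol_of_strict hϖ h.2.1 (h.2.2.1.trans h.2.2.2)⟩

theorem incident_of_adj (hϖ : IsUniformizer O ϖ) {s t : TreeVertex O ϖ}
    (hs : dual (top hϖ s) = top hϖ s) (h : (tree O ϖ).Adj s t) :
    Incident ϖ (top hϖ s) (top hϖ t) := by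
  refine ((adj_iff hϖ).1 h).resolve_right fun h' => ?_
  exact (h'.2.2.1.trans h'.2.2.2).ne hs

theorem incident_of_adj' (hϖ : IsUniformizer O ϖ) {s t : TreeVertex O ϖ}
    (hs : dual (top hϖ s) ≠ top hϖ s) (h : (tree O ϖ).Adj s t) :
    Incident ϖ (top hϖ t) (top hϖ s) :=
  ((adj_iff hϖ).1 h).resolve_left fun h' => hs h'.1

omit [StarRing K] [StarStable O] in
theorem act_le_iff {g : GL (Fin 3) K} {L M : Submodule O (Fin 3 → K)} :
    act g L ≤ M ↔ ∀ x ∈ L, (g : Matrix (Fin 3) (Fin 3) K) *ᵥ x ∈ M :=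
  Submodule.map_le_iff_le_comap

omit [StarRing K] [StarStable O] in
theorem mulVec_mem_act (g : GL (Fin 3) K) {L : Submodule O (Fin 3 → K)} {x : Fin 3 → K}
    (hx : x ∈ L) : (g : Matrix (Fin 3) (Fin 3) K) *ᵥ x ∈ act g L :=
  act_le_iff.1 le_rfl x hx

/-- A unitary matrix has volume 0, so an inclusion between lattices of equal volume is enough. -/
theorem smul_eq_of_act_le (hϖ : IsUniformizer O ϖ) (g : fixedGroup K) {s t : TreeVertex O ϖ} {k : ℤ}
    (hs : HasVol hϖ s k) (ht : HasVol hϖ t k) (h : act (g : GL (Fin 3) K) (top hϖ s) ≤ top hϖ t) :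
    g • s = t := by
  obtain ⟨l, hl, hlk⟩ := hs
  obtain ⟨m, hm, hmk⟩ := ht
  have hg : vol hϖ (g : GL (Fin 3) K) = 0 := by
    have h1 : sharp (g : GL (Fin 3) K) = g := g.2
    have h2 := vol_sharp hϖ (g : GL (Fin 3) K)
    rw [h1] at h2
    omega
  refine top_injective hϖ ?_
  rw [top_smul]
  rw [hl, hm, act_lattice] at h
  rw [hl, hm, act_lattice]
  refine lattice_eq_of_le_of_vol_le hϖ h ?_
  rw [vol_mul]
  omega

theorem smul_mem_fixedVertices (g : fixedGroup K) {s : Set (Vertex O)} (hs : s ∈ fixedVertices O) :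
    (g : GL (Fin 3) K) • s ∈ fixedVertices O := by
  obtain ⟨x, hx, rfl⟩ := hs
  exact ⟨(g : GL (Fin 3) K) • x, by rw [vertexSharp_smul, hx], Set.smul_set_singleton⟩

theorem smul_mem_reflectedEdges (g : fixedGroup K) {s : Set (Vertex O)}
    (hs : s ∈ reflectedEdges O ϖ) : (g : GL (Fin 3) K) • s ∈ reflectedEdges O ϖ := by
  obtain ⟨x, y, hxy, hx, hy, rfl⟩ := hs
  refine ⟨(g : GL (Fin 3) K) • x, (g : GL (Fin 3) K) • y, hxy.smul _, ?_, ?_, ?_⟩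
  · rw [vertexSharp_smul, hx]
  · rw [vertexSharp_smul, hy]
  · simp only [← Set.image_smul, Set.image_insert_eq, Set.image_singleton]

theorem smul_adj (g : fixedGroup K) {s t : TreeVertex O ϖ} (h : (tree O ϖ).Adj s t) :
    (tree O ϖ).Adj (g • s) (g • t) := by
  refine ⟨h.1.imp (fun h => ⟨?_, ?_⟩) (fun h => ⟨?_, ?_⟩), ?_⟩
  · exact smul_mem_fixedVertices g h.1
  · exact smul_mem_reflectedEdges g h.2
  · exact smul_mem_reflectedEdges g h.1
  · exact smul_mem_fixedVertices g h.2
  · rw [coe_smul_treeVertex, coe_smul_treeVertex, ← Set.smul_set_union]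
    exact h.2.smul _

end Neighbours

end BruhatTits

namespace Qutrit

open Matrix NumberField IsDedekindDomain BruhatTits

/-! ### Arithmetic modulo `π` -/

/-- `ξ` as a `π`-adic integer. -/
def ξO : Oπ := ⟨algebraMap E Eπ ξ, coe_mem_Oπ ξInt⟩

/-- `π` as a `π`-adic integer. -/
def πO : Oπ := 1 - ξO

theorem coe_ξO : (ξO : Eπ) = algebraMap E Eπ ξ := rfl

theorem coe_πO : (πO : Eπ) = π := by
  rw [πO, π, map_sub, map_one]
  rfl

theorem π_ne_zero : π ≠ 0 := isUniformizer_π.ne_zero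

theorem ξO_relation : ξO ^ 6 + ξO ^ 3 + 1 = 0 := by
  refine Subtype.ext ?_
  have := congrArg (algebraMap E Eπ) ξ_relation
  simpa [← coe_ξO] using this

theorem ξO_pow_nine : ξO ^ 9 = 1 := by
  linear_combination (ξO ^ 3 - 1) * ξO_relation

theorem π_eq : π = 1 - (ξO : Eπ) := by
  rw [← coe_πO, πO]
  rfl

theorem star_ξO : star (ξO : Eπ) = (ξO : Eπ) ^ 8 := by
  have h9 : (ξO : Eπ) ^ 9 = 1 := by exact_mod_cast congrArg (Subtype.val) ξO_pow_nine
  rw [coe_ξO, ← algebraMap_star, star_ξ, map_inv₀, ← coe_ξO]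
  refine inv_eq_of_mul_eq_one_left ?_
  rw [← pow_succ, h9]

theorem star_π : star π = -(ξO : Eπ) ^ 8 * π := by
  have h9 : (ξO : Eπ) ^ 9 = 1 := by exact_mod_cast congrArg (Subtype.val) ξO_pow_nine
  rw [π_eq, star_sub, star_one, star_ξO]
  linear_combination -h9

theorem inv_star_π : (star π)⁻¹ = -(ξO : Eπ) * π⁻¹ := by
  have h9 : (ξO : Eπ) ^ 9 = 1 := by exact_mod_cast congrArg (Subtype.val) ξO_pow_nine
  have := π_ne_zero
  refine inv_eq_of_mul_eq_one_left ?_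
  rw [star_π]
  field_simp
  linear_combination h9

/-- `3` is an associate of `π⁶`; this is the cofactor. -/
def cofactorThree : Oπ := 10 + 11 * ξO + 7 * ξO ^ 2 + 10 * ξO ^ 3 + 4 * ξO ^ 4 - 4 * ξO ^ 5

theorem three_eq : (3 : Oπ) = πO ^ 6 * cofactorThree := by
  rw [πO, cofactorThree]
  have h := ξO_relation
  grind

theorem not_πO_dvd_one : ¬ πO ∣ 1 := by
  rintro ⟨y, hy⟩
  have h1 := congrArg (Subtype.val) hy
  refine isUniformizer_π.inv_notMem ?_
  have : π⁻¹ = (y : Eπ) := by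
    refine inv_eq_of_mul_eq_one_right ?_
    rw [← coe_πO]
    exact h1.symm
  rw [this]
  exact y.2

theorem πO_dvd_three : πO ∣ 3 := ⟨πO ^ 5 * cofactorThree, by rw [three_eq]; ring⟩

theorem not_πO_dvd_two : ¬ πO ∣ 2 := fun h => not_πO_dvd_one <| by
  have := dvd_sub πO_dvd_three h
  norm_num at this
  exact this

theorem exists_residue (x : Oπ) : πO ∣ x ∨ πO ∣ x - 1 ∨ πO ∣ x + 1 := by
  obtain ⟨c, hc, y, hy, h⟩ := local_residue_cases x.2
  have key : x = c + πO * ⟨y, hy⟩ := by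
    refine Subtype.ext (h.trans ?_)
    rw [← coe_πO]
    simp
  rcases hc with rfl | rfl | rfl
  · exact Or.inl ⟨⟨y, hy⟩, by rw [key]; simp⟩
  · exact Or.inr (Or.inl ⟨⟨y, hy⟩, by rw [key]; simp⟩)
  · exact Or.inr (Or.inr ⟨⟨y, hy⟩, by rw [key]; simp⟩)

/-- Complex conjugation is trivial modulo `π`. -/
theorem exists_star_eq (x : Oπ) : ∃ y : Oπ, star (x : Eπ) = x + π * y := by
  have key : ∀ c : ℤ, πO ∣ x - c → ∃ y : Oπ, star (x : Eπ) = x + π * y := by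
    rintro c ⟨y, hy⟩
    have h : (x : Eπ) = c + π * y := by
      rw [← coe_πO]
      have := congrArg (Subtype.val) (sub_eq_iff_eq_add'.1 hy)
      simpa using this
    -- Conjugation fixes the integer `c` and multiplies `π` by the unit `-ξ⁸`.
    refine ⟨-ξO ^ 8 * ⟨star (y : Eπ), StarStable.star_mem y.2⟩ - y, ?_⟩
    push_cast
    rw [h, star_add, star_mul', star_π, star_intCast]
    ring
  rcases exists_residue x with h | h | h
  · exact key 0 (by simpa using h)
  · exact key 1 (by simpa using h)
  · exact key (-1) (by simpa using h)

end Qutrit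

namespace Qutrit

open Matrix NumberField IsDedekindDomain BruhatTits

/-! ### An apartment of the tree -/

/-- The vector with coordinates `α, β, γ` in the basis `(1,1,1), (1,-1,0), (1,0,0)`. -/
def vec (α β γ : Eπ) : Fin 3 → Eπ := ![α + β + γ, α - β, α]

/-- The lattices in the apartment of the basis `(1,1,1), (1,-1,0), (1,0,0)` are spanned by
`π⁻ᵃ (1,1,1), (1,-1,0), πᵇ (1,0,0)`. -/
def segGL (a b : ℕ) : GL (Fin 3) Eπ where
  val := !![(π ^ a)⁻¹, 1, π ^ b; (π ^ a)⁻¹, -1, 0; (π ^ a)⁻¹, 0, 0]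
  inv := !![0, 0, π ^ a; 0, -1, 1; (π ^ b)⁻¹, (π ^ b)⁻¹, -2 * (π ^ b)⁻¹]
  val_inv := by
    have ha := pow_ne_zero a π_ne_zero
    have hb := pow_ne_zero b π_ne_zero
    generalize π ^ a = x at ha
    generalize π ^ b = y at hb
    ext i j
    fin_cases i <;> fin_cases j <;> simp [Matrix.mul_apply, Fin.sum_univ_three] <;> field_simp <;>
      ring
  inv_val := by
    have ha := pow_ne_zero a π_ne_zero
    have hb := pow_ne_zero b π_ne_zero
    generalize π ^ a = x at ha
    generalize π ^ b = y at hb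
    ext i j
    fin_cases i <;> fin_cases j <;> simp [Matrix.mul_apply, Fin.sum_univ_three] <;> field_simp <;>
      ring

/-- The lattice spanned by `π⁻ᵃ (1,1,1), (1,-1,0), πᵇ (1,0,0)`. -/
abbrev seg (a b : ℕ) : Submodule Oπ (Fin 3 → Eπ) := lattice Oπ (segGL a b)

theorem mem_seg {a b : ℕ} {x : Fin 3 → Eπ} : x ∈ seg a b ↔
    ∃ p q r : Oπ, x = vec (p / π ^ a) q (π ^ b * r) := by
  have h0 := π_ne_zero
  have hinv : (((segGL a b)⁻¹ : GL (Fin 3) Eπ) : Matrix (Fin 3) (Fin 3) Eπ) =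
    !![0, 0, π ^ a; 0, -1, 1; (π ^ b)⁻¹, (π ^ b)⁻¹, -2 * (π ^ b)⁻¹] := rfl
  rw [mem_lattice, hinv]
  simp only [Fin.forall_fin_succ, IsEmpty.forall_iff, and_true]
  simp [Matrix.mulVec, dotProduct, Fin.sum_univ_three]
  constructor
  · rintro ⟨h1, h2, h3⟩
    refine ⟨_, h1, _, h2, _, h3, ?_⟩
    ext i
    fin_cases i <;> simp [vec] <;> field_simp <;> ring
  · rintro ⟨p, hp, q, hq, r, hr, rfl⟩
    simp only [vec]
    refine ⟨?_, ?_, ?_⟩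
    · convert hp using 1
      simp
      field_simp
    · convert hq using 1
      simp
    · convert hr using 1
      simp
      field_simp
      ring

theorem vol_segGL (a b : ℕ) : vol isUniformizer_π (segGL a b) = b - a := by
  have h0 := π_ne_zero
  have hdet : ((segGL a b : GL (Fin 3) Eπ) : Matrix (Fin 3) (Fin 3) Eπ).det = π ^ ((b : ℤ) - a) := by
    have : ((segGL a b : GL (Fin 3) Eπ) : Matrix (Fin 3) (Fin 3) Eπ) =
      !![(π ^ a)⁻¹, 1, π ^ b; (π ^ a)⁻¹, -1, 0; (π ^ a)⁻¹, 0, 0] := rfl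
    rw [this, Matrix.det_fin_three, zpow_sub₀ h0]
    simp
    field_simp
  rw [vol, hdet, ord_zpow]

theorem seg_zero : seg 0 0 = lattice Oπ 1 := by
  refine lattice_eq_of_le_of_vol_le isUniformizer_π ?_ (by rw [vol_one, vol_segGL]; simp)
  intro x hx
  obtain ⟨p, q, r, rfl⟩ := mem_seg.1 hx
  rw [mem_lattice_one]
  simp only [Fin.forall_fin_succ, IsEmpty.forall_iff, and_true, vec]
  refine ⟨?_, ?_, ?_⟩
  · simpa using (p + q + r).2
  · simpa using (p - q).2
  · simp

theorem seg_mono {a b a' b' : ℕ} (ha : a ≤ a') (hb : b' ≤ b) : seg a b ≤ seg a' b' := by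
  have h0 := π_ne_zero
  intro x hx
  obtain ⟨p, q, r, rfl⟩ := mem_seg.1 hx
  obtain ⟨k, rfl⟩ := Nat.exists_eq_add_of_le ha
  obtain ⟨l, rfl⟩ := Nat.exists_eq_add_of_le hb
  refine mem_seg.2 ⟨p * πO ^ k, q, πO ^ l * r, ?_⟩
  push_cast
  rw [coe_πO]
  congr 1
  · field_simp
    ring
  · ring

theorem smul_seg_le (a b : ℕ) : π • seg (a + 1) b ≤ seg a (b + 1) := by
  have h0 := π_ne_zero
  intro x hx
  obtain ⟨p, q, r, hx⟩ := mem_seg.1 ((mem_smul_iff h0).1 hx)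
  rw [inv_smul_eq_iff₀ h0] at hx
  refine mem_seg.2 ⟨p, πO * q, r, ?_⟩
  push_cast
  rw [coe_πO, hx]
  ext i
  fin_cases i <;> simp [vec] <;> field_simp <;> ring

theorem star_vec_dotProduct (α β γ α' β' γ' : Eπ) : star (vec α β γ) ⬝ᵥ vec α' β' γ' =
    3 * star α * α' + 2 * star β * β' + star γ * γ' + star α * γ' + star γ * α' + star β * γ' +
      star γ * β' := by
  simp [vec, dotProduct, Fin.sum_univ_three]
  ring

/-- Of the products of the spanning vectors, only `3 / π^(a+b)`, which comes from `(1,1,1)` with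
itself, could fail to be integral; `3` is divisible by `π⁶`, whence the bound. Equality then follows
from the volumes. -/
theorem dual_seg {a b : ℕ} (hab : a + b ≤ 6) : dual (seg a b) = seg b a := by
  have h0 := π_ne_zero
  have hle : seg b a ≤ dual (seg a b) := by
    intro x hx y hy
    obtain ⟨p', q', r', rfl⟩ := mem_seg.1 hx
    obtain ⟨p, q, r, rfl⟩ := mem_seg.1 hy
    obtain ⟨ps, hp⟩ : ∃ s : Oπ, star (p : Eπ) = s := ⟨⟨_, StarStable.star_mem p.2⟩, rfl⟩
    obtain ⟨qs, hq⟩ : ∃ s : Oπ, star (q : Eπ) = s := ⟨⟨_, StarStable.star_mem q.2⟩, rfl⟩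
    obtain ⟨rs, hr⟩ : ∃ s : Oπ, star (r : Eπ) = s := ⟨⟨_, StarStable.star_mem r.2⟩, rfl⟩
    obtain ⟨c, hc⟩ : ∃ c : Oπ, (3 : Eπ) = π ^ a * π ^ b * c := by
      obtain ⟨k, hk⟩ := Nat.exists_eq_add_of_le hab
      refine ⟨πO ^ k * cofactorThree, ?_⟩
      have := congrArg (Subtype.val) three_eq
      push_cast at this
      rw [coe_πO, hk] at this
      push_cast
      rw [coe_πO]
      refine this.trans ?_
      ring
    have e1 : star ((p : Eπ) / π ^ a) = ps * (-(ξO : Eπ)) ^ a / π ^ a := by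
      rw [div_eq_mul_inv, star_mul', hp, star_inv₀, star_pow, ← inv_pow, inv_star_π, mul_pow, inv_pow]
      ring
    have e2 : star (π ^ b * (r : Eπ)) = (-(ξO : Eπ) ^ 8) ^ b * π ^ b * rs := by
      rw [star_mul', hr, star_pow, star_π, mul_pow]
    rw [star_vec_dotProduct, e1, e2, hq, hc]
    convert (c * ps * (-ξO) ^ a * p' + (qs * q' + qs * q') + πO ^ a * r' * (rs * (-ξO ^ 8) ^ b * πO ^ b) +
      ps * (-ξO) ^ a * r' + rs * (-ξO ^ 8) ^ b * p' + qs * πO ^ a * r' +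
      (-ξO ^ 8) ^ b * πO ^ b * rs * q').2 using 1
    push_cast
    rw [coe_πO]
    field_simp
    ring
  rw [← lattice_sharp] at hle ⊢
  refine (lattice_eq_of_le_of_vol_le isUniformizer_π hle ?_).symm
  rw [vol_sharp, vol_segGL, vol_segGL]
  omega

theorem incident_seg_left {a : ℕ} (ha : a ≤ 2) : Incident π (seg a a) (seg (a + 1) a) := by
  refine incident_of_le isUniformizer_π (dual_seg (by omega)) (seg_mono (by omega) le_rfl) ?_ ?_
  · rw [dual_seg (by omega)]
    exact smul_seg_le a a
  · rw [vol_segGL]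
    push_cast
    ring

theorem incident_seg_right {a : ℕ} (ha : a ≤ 2) :
    Incident π (seg (a + 1) (a + 1)) (seg (a + 1) a) := by
  refine incident_of_le isUniformizer_π (dual_seg (by omega)) (seg_mono le_rfl (by omega)) ?_ ?_
  · rw [dual_seg (by omega)]
    exact smul_seg_le a a
  · rw [vol_segGL]
    push_cast
    ring

theorem exists_top_eq_seg_self (a : ℕ) (ha : a ≤ 2) :
    ∃ s : TVertex, top isUniformizer_π s = seg a a :=
  exists_top_eq_of_selfDual isUniformizer_π (dual_seg (by omega))

theorem exists_top_eq_seg_succ (a : ℕ) (ha : a ≤ 2) :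
    ∃ s : TVertex, top isUniformizer_π s = seg (a + 1) a :=
  exists_top_eq_of_incident isUniformizer_π (incident_seg_left ha)

/-- The neighbour of the base vertex on the path to its image under `H`. -/
def v₁ : TVertex := (exists_top_eq_seg_succ 0 (by norm_num)).choose

/-- The second vertex on the path from the base vertex to its image under `H`. -/
def v₂ : TVertex := (exists_top_eq_seg_self 1 (by norm_num)).choose

/-- The midpoint of the path from the base vertex to its image under `H`. -/
def v₃ : TVertex := (exists_top_eq_seg_succ 1 (by norm_num)).choose

theorem top_v₀ : top isUniformizer_π v₀ = seg 0 0 :=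
  (top_baseVertex isUniformizer_π).trans seg_zero.symm

theorem top_v₁ : top isUniformizer_π v₁ = seg 1 0 :=
  (exists_top_eq_seg_succ 0 (by norm_num)).choose_spec

theorem top_v₂ : top isUniformizer_π v₂ = seg 1 1 :=
  (exists_top_eq_seg_self 1 (by norm_num)).choose_spec

theorem top_v₃ : top isUniformizer_π v₃ = seg 2 1 :=
  (exists_top_eq_seg_succ 1 (by norm_num)).choose_spec

theorem adj₀₁ : T.Adj v₀ v₁ := by
  rw [adj_iff isUniformizer_π, top_v₀, top_v₁]
  exact Or.inl (incident_seg_left (by norm_num))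

theorem adj₁₂ : T.Adj v₁ v₂ := by
  rw [adj_iff isUniformizer_π, top_v₁, top_v₂]
  exact Or.inr (incident_seg_right (by norm_num))

theorem adj₂₃ : T.Adj v₂ v₃ := by
  rw [adj_iff isUniformizer_π, top_v₂, top_v₃]
  exact Or.inl (incident_seg_left (by norm_num))

theorem hasVol₀ : HasVol isUniformizer_π v₀ 0 := ⟨_, top_v₀, by rw [vol_segGL]; norm_num⟩

theorem hasVol₁ : HasVol isUniformizer_π v₁ (-1) := ⟨_, top_v₁, by rw [vol_segGL]; norm_num⟩

theorem hasVol₂ : HasVol isUniformizer_π v₂ 0 := ⟨_, top_v₂, by rw [vol_segGL]; norm_num⟩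

theorem hasVol₃ : HasVol isUniformizer_π v₃ (-1) := ⟨_, top_v₃, by rw [vol_segGL]; norm_num⟩

end Qutrit

namespace BruhatTits

section Neighbours

variable {K : Type*} [Field K] [StarRing K] {O : ValuationSubring K} {ϖ : K} [StarStable O]

theorem eq_of_top_le (hϖ : IsUniformizer O ϖ) {s t : TreeVertex O ϖ} {k : ℤ}
    (hs : HasVol hϖ s k) (ht : HasVol hϖ t k) (h : top hϖ s ≤ top hϖ t) : s = t := by
  obtain ⟨l, hl, hlk⟩ := hs
  obtain ⟨m, hm, hmk⟩ := ht
  refine top_injective hϖ ?_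
  rw [hl, hm] at h ⊢
  exact lattice_eq_of_le_of_vol_le hϖ h (by omega)

end Neighbours

end BruhatTits

namespace Qutrit

open Matrix NumberField IsDedekindDomain BruhatTits

/-! ### Elements of the arithmetic group -/

/-- The class of a diagonal matrix of roots of unity. -/
def diag : (Fin 3 → rootsOfUnity 18 E) →* Γ where
  toFun u := QuotientGroup.mk (monomial 1 u)
  map_one' := by
    rw [QuotientGroup.eq_one_iff]
    convert one_mem (Subgroup.center U₃R)
    refine Subtype.ext (Subtype.ext ?_)
    ext i j
    rw [monomial_apply]
    by_cases h : i = j <;> simp [h]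
  map_mul' u w := by
    rw [← QuotientGroup.mk_mul]
    congr 1
    refine Subtype.ext (Subtype.ext ?_)
    ext i j
    change _ = ((monomial 1 u).1.1 * (monomial 1 w).1.1) i j
    rw [Matrix.mul_apply, Finset.sum_eq_single j]
    · simp only [monomial_apply]
      by_cases h : i = j <;> simp [h]
    · intro k _ hk
      simp [monomial_apply, hk]
    · simp

/-- A root of unity as a `π`-adic integer. -/
def loc (u : rootsOfUnity 18 E) : Oπ :=
  ⟨algebraMap E Eπ ((u : Eˣ) : E), algebraMap_mem_of_norm_one (star_mul_coe u)⟩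

theorem loc_pow (u : rootsOfUnity 18 E) (k : ℕ) : loc (u ^ k) = loc u ^ k := by
  refine Subtype.ext ?_
  simp [loc]

theorem loc_one : loc 1 = 1 := by
  refine Subtype.ext ?_
  simp [loc]

theorem toLocal_monomial_mulVec (u : Fin 3 → rootsOfUnity 18 E) (x : Fin 3 → Eπ) :
    ((toLocal (monomial 1 u) : GL (Fin 3) Eπ) : Matrix (Fin 3) (Fin 3) Eπ) *ᵥ x =
      fun i => loc (u i) * x i := by
  ext i
  rw [Matrix.mulVec, dotProduct, Finset.sum_eq_single i]
  · rw [coe_toLocal_apply, monomial_apply]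
    simp [loc]
  · intro k _ hk
    rw [coe_toLocal_apply, monomial_apply, if_neg (by simpa using hk.symm), map_zero, zero_mul]
  · simp

theorem mulVec_mem_top (g : U₃R) {s : TVertex} {x : Fin 3 → Eπ}
    (hx : x ∈ top isUniformizer_π s) :
    ((toLocal g : GL (Fin 3) Eπ) : Matrix (Fin 3) (Fin 3) Eπ) *ᵥ x ∈
      top isUniformizer_π ((QuotientGroup.mk g : Γ) • s) := by
  rw [top_mk_smul]
  exact mulVec_mem_act _ hx

theorem mk_smul_eq (g : U₃R) {s t : TVertex} {k : ℤ} (hs : HasVol isUniformizer_π s k)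
    (ht : HasVol isUniformizer_π t k) (h : ∀ x ∈ top isUniformizer_π s,
      ((toLocal g : GL (Fin 3) Eπ) : Matrix (Fin 3) (Fin 3) Eπ) *ᵥ x ∈ top isUniformizer_π t) :
    (QuotientGroup.mk g : Γ) • s = t :=
  smul_eq_of_act_le isUniformizer_π (toLocal g) hs ht (act_le_iff.2 h)

theorem diag_smul_mem_top (u : Fin 3 → rootsOfUnity 18 E) {s : TVertex} {x : Fin 3 → Eπ}
    (hx : x ∈ top isUniformizer_π s) :
    (fun i => loc (u i) * x i) ∈ top isUniformizer_π (diag u • s) := by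
  rw [← toLocal_monomial_mulVec]
  exact mulVec_mem_top _ hx

theorem diag_smul_eq (u : Fin 3 → rootsOfUnity 18 E) {s t : TVertex} {k : ℤ}
    (hs : HasVol isUniformizer_π s k) (ht : HasVol isUniformizer_π t k)
    (h : ∀ x ∈ top isUniformizer_π s, (fun i => loc (u i) * x i) ∈ top isUniformizer_π t) :
    diag u • s = t := by
  refine mk_smul_eq _ hs ht fun x hx => ?_
  rw [toLocal_monomial_mulVec]
  exact h x hx

theorem diag_smul_v₀ (u : Fin 3 → rootsOfUnity 18 E) : diag u • v₀ = v₀ :=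
  (smul_base_eq_iff _).2 fun i j => by
    rw [monomial_apply]
    split_ifs
    · exact (loc _).2
    · rw [map_zero]
      exact zero_mem Oπ

/-- `ξ` as a root of unity. -/
def rootξ : rootsOfUnity 18 E := rootsOfUnity.mkOfPowEq ξ <| by
  rw [show 18 = 9 * 2 from rfl, pow_mul, ξ_spec.pow_eq_one, one_pow]

theorem loc_rootξ : loc rootξ = ξO := rfl

theorem rootξ_pow_nine : rootξ ^ 9 = 1 :=
  Subtype.ext (Units.ext (by simpa [rootξ] using ξ_spec.pow_eq_one))

/-- A sign as a root of unity. -/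
def sgn (ε : ℤˣ) : rootsOfUnity 18 E := rootsOfUnity.mkOfPowEq ((ε : ℤ) : E) <| by
  rcases Int.units_eq_one_or ε with rfl | rfl <;> norm_num

theorem loc_sgn (ε : ℤˣ) : loc (sgn ε) = ((ε : ℤ) : Oπ) := by
  refine Subtype.ext ?_
  simp [loc, sgn]

/-- A cofactor of `π³` in `1 - ζ₃`. -/
def cofactorζ : Oπ := 1 + πO ^ 4 * cofactorThree * (1 - πO)

/-- Expand `1 - (1 - π)³ = π³ + 3π(1 - π)` and replace 3 by its multiple of `π⁶`. The resulting
cofactor is 1 modulo `π`. -/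
theorem one_sub_ζ_eq : 1 - ξO ^ 3 = πO ^ 3 * cofactorζ := by
  have h := three_eq
  have h2 : ξO = 1 - πO := by rw [πO]; ring
  rw [cofactorζ, h2]
  linear_combination (πO - πO ^ 2) * h

/-- A cofactor of `π³` in `√-3`. -/
def cofactorSqrt : Oπ := -ξO - 2 * ξO ^ 2 - 2 * ξO ^ 3 - 2 * ξO ^ 4 - ξO ^ 5

/-- The inverse of the unit `√-3 / π³`. -/
def cofactorInv : Oπ := -1 + ξO - ξO ^ 2 - ξO ^ 3 + 2 * ξO ^ 4 - 2 * ξO ^ 5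

theorem sqrt_eq : 1 + 2 * ξO ^ 3 = πO ^ 3 * cofactorSqrt := by
  rw [πO, cofactorSqrt]
  have h := ξO_relation
  grind

theorem cofactorSqrt_mul : cofactorSqrt * cofactorInv = 1 := by
  rw [cofactorInv, cofactorSqrt]
  have h := ξO_relation
  grind

theorem coe_sqrt : algebraMap E Eπ sqrtNegThree = π ^ 3 * cofactorSqrt := by
  have h := congrArg (Subtype.val) sqrt_eq
  have h1 : algebraMap E Eπ sqrtNegThree = ((1 + 2 * ξO ^ 3 : Oπ) : Eπ) := by
    simp only [sqrtNegThree, map_add, map_one, map_mul, map_pow, map_ofNat]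
    rfl
  rw [h1, ← coe_πO]
  exact h

theorem inv_sqrt : algebraMap E Eπ sqrtNegThree⁻¹ = cofactorInv / π ^ 3 := by
  have h0 := π_ne_zero
  have h := congrArg (Subtype.val) cofactorSqrt_mul
  push_cast at h
  rw [map_inv₀, coe_sqrt]
  refine inv_eq_of_mul_eq_one_left ?_
  field_simp
  linear_combination h

/-- `H` sends `(1,1,1)` to `-√-3 (1,0,0)` and `(1,0,0)` to `(1,1,1)/√-3`, and fixes `(1,-1,0)` up to
multiples of the other two. As `√-3` is `π³` times a unit, exponents `(a, b)` of the apartment are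
reflected to `(3 - b, 3 - a)`; the pair `(2, 1)` of `v₃` is fixed. -/
theorem toLocal_H_vec (α β γ : Eπ) :
    ((toLocal (mkU₃R matH star_mul_matH matH_mem) : GL (Fin 3) Eπ) :
      Matrix (Fin 3) (Fin 3) Eπ) *ᵥ vec α β γ =
      vec (-(ξO : Eπ) ^ 3 * β + cofactorInv / π ^ 3 * γ) β
        (-(π ^ 3 * cofactorSqrt) * α - (1 - (ξO : Eπ) ^ 3) * β) := by
  have h0 := π_ne_zero
  have hz : (ξO : Eπ) ^ 6 = - (ξO : Eπ) ^ 3 - 1 := by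
    have h := congrArg (Subtype.val) ξO_relation
    push_cast at h
    linear_combination h
  have hq : ((ξO : Eπ) ^ 3) ^ 2 + (ξO : Eπ) ^ 3 + 1 = 0 := by linear_combination hz
  have hs := inv_sqrt
  have hr : (cofactorInv : Eπ) / π ^ 3 * (1 + 2 * (ξO : Eπ) ^ 3) = 1 := by
    have h := congrArg (Subtype.val) cofactorSqrt_mul
    push_cast at h
    have h2 : 1 + 2 * (ξO : Eπ) ^ 3 = π ^ 3 * cofactorSqrt := by
      rw [← coe_πO]
      exact congrArg (Subtype.val) sqrt_eq
    rw [h2]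
    field_simp
    linear_combination h
  have h2 : π ^ 3 * (cofactorSqrt : Eπ) = 1 + 2 * (ξO : Eπ) ^ 3 := by
    rw [← coe_πO]
    exact congrArg (Subtype.val) sqrt_eq.symm
  have hM : ∀ i j, ((toLocal (mkU₃R matH star_mul_matH matH_mem) : GL (Fin 3) Eπ) :
      Matrix (Fin 3) (Fin 3) Eπ) i j = cofactorInv / π ^ 3 *
        (!![1, 1, 1; 1, (ξO : Eπ) ^ 3, (ξO : Eπ) ^ 6; 1, (ξO : Eπ) ^ 6, (ξO : Eπ) ^ 3] :
          Matrix (Fin 3) (Fin 3) Eπ) i j := by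
    intro i j
    rw [coe_toLocal_apply]
    change algebraMap E Eπ (matH i j) = _
    rw [matH, Matrix.smul_apply, smul_eq_mul, map_mul, hs]
    congr 1
    fin_cases i <;> fin_cases j <;> simp [coe_ξO]
  rw [h2]
  generalize (cofactorInv : Eπ) / π ^ 3 = w at *
  generalize (ξO : Eπ) ^ 3 = z at *
  generalize (ξO : Eπ) ^ 6 = z' at *
  subst hz
  ext i
  fin_cases i <;> simp [Matrix.mulVec, dotProduct, Fin.sum_univ_three, hM, vec]
  · linear_combination (-α * (1 + 2 * z)) * hr + 4 * w * α * hq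
  · linear_combination β * z ^ 2 * hr + (β * w * (1 - 2 * z) + β) * hq
  · linear_combination (-β * z) * hr + 2 * w * β * hq

end Qutrit

namespace Qutrit

open Matrix NumberField IsDedekindDomain BruhatTits

/-! ### The neighbours of the vertices of the segment -/

theorem mem_top_v₀ {x : Fin 3 → Eπ} : x ∈ top isUniformizer_π v₀ ↔
    ∃ p q r : Oπ, x = vec p q r := by
  rw [top_v₀, mem_seg]
  simp only [pow_zero, div_one, one_mul]

theorem mem_top_v₁ {x : Fin 3 → Eπ} : x ∈ top isUniformizer_π v₁ ↔
    ∃ p q r : Oπ, x = vec (p / π) q r := by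
  rw [top_v₁, mem_seg]
  simp only [pow_zero, pow_one, one_mul]

theorem mem_top_v₂ {x : Fin 3 → Eπ} : x ∈ top isUniformizer_π v₂ ↔
    ∃ p q r : Oπ, x = vec (p / π) q (π * r) := by
  rw [top_v₂, mem_seg]
  simp only [pow_one]

theorem mem_top_v₃ {x : Fin 3 → Eπ} : x ∈ top isUniformizer_π v₃ ↔
    ∃ p q r : Oπ, x = vec (p / π ^ 2) q (π * r) := by
  rw [top_v₃, mem_seg]
  simp only [pow_one]

theorem vec_add (α β γ α' β' γ' : Eπ) :
    vec α β γ + vec α' β' γ' = vec (α + α') (β + β') (γ + γ') := by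
  ext i
  fin_cases i <;> simp [vec] <;> ring

theorem smul_vec (c : Oπ) (α β γ : Eπ) : c • vec α β γ = vec (c * α) (c * β) (c * γ) := by
  have hs : ∀ a : Eπ, c • a = c * a := fun _ => rfl
  ext i
  fin_cases i <;> simp [vec, hs, mul_add, mul_sub]

theorem vec_injective {α β γ α' β' γ' : Eπ} (h : vec α β γ = vec α' β' γ') :
    α = α' ∧ β = β' ∧ γ = γ' := by
  have h0 := congrFun h 0
  have h1 := congrFun h 1
  have h2 := congrFun h 2
  simp only [vec, Matrix.cons_val] at h0 h1 h2
  subst h2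
  obtain rfl : β = β' := by linear_combination -h1
  exact ⟨rfl, rfl, by linear_combination h0⟩

theorem diag_vec (u w z : rootsOfUnity 18 E) (α β γ : Eπ) :
    (fun i => (loc (![u, w, z] i) : Eπ) * vec α β γ i) =
      vec (loc z * α) (loc z * α - loc w * (α - β))
        (loc u * (α + β + γ) + loc w * (α - β) - 2 * (loc z * α)) := by
  ext i
  fin_cases i <;> simp [vec]
  ring

/-- A neighbour's lattice is pinned down by a known sublattice `seg a b` and one more vector.
Membership is certified by a multiple of that vector plus an element of `seg a b`. -/
theorem mem_of_vec {X : Submodule Oπ (Fin 3 → Eπ)} {a b : ℕ} (h : seg a b ≤ X) {α β γ α' β' γ' : Eπ}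
    (hu : vec α β γ ∈ X) (c p q r : Oπ) (h₁ : α' = c * α + p / π ^ a) (h₂ : β' = c * β + q)
    (h₃ : γ' = c * γ + π ^ b * r) : vec α' β' γ' ∈ X := by
  have := X.add_mem (X.smul_mem c hu) (h (mem_seg.2 ⟨p, q, r, rfl⟩))
  rwa [smul_vec, vec_add, ← h₁, ← h₂, ← h₃] at this

theorem coe_eq {x y : Oπ} (h : x = y) : (x : Eπ) = y := congrArg _ h

/-- The matrix sends `π⁻¹(1,1,1)` to `π⁻¹(1,1,1) - A(1,0,0)`. Modulo `seg 0 1` only the residue of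
the last coefficient counts, so the two lattices agree when `r ≡ -A`. -/
theorem diag_smul_v₂_eq {u : rootsOfUnity 18 E} {A : Oπ} (hA : loc u = 1 - πO * A) {y : TVertex}
    (hy : HasVol isUniformizer_π y 0) (h : seg 0 1 ≤ top isUniformizer_π y) {e b r : Oπ}
    (hu : vec ((1 + πO * e : Oπ) / π) b r ∈ top isUniformizer_π y) (hr : πO ∣ r + A) :
    diag ![u, 1, 1] • v₂ = y := by
  have h0 := π_ne_zero
  obtain ⟨f, hf⟩ := hr
  have hf' := coe_eq hf
  push_cast at hf' hu
  rw [coe_πO] at hf' hu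
  refine diag_smul_eq _ hasVol₂ hy fun x hx => ?_
  obtain ⟨p, q, s, rfl⟩ := mem_top_v₂.1 hx
  rw [diag_vec, loc_one, hA]
  refine mem_of_vec h hu p (-(p * e)) (q - p * b) (s - A * q - πO * A * s - p * f) ?_ ?_ ?_
  · push_cast
    field_simp
    ring
  · push_cast
    ring
  · push_cast
    rw [coe_πO]
    field_simp
    linear_combination (-(p * π : Eπ)) * hf'

/-- The image of `π⁻²(1,1,1)` has coordinates `(π⁻², π⁻¹B, -C)`, to be compared with those of the
given vector modulo `seg 1 1`. -/
theorem diag_smul_v₃_eq {u w : rootsOfUnity 18 E} {A B C : Oπ} (hA : loc u = 1 - πO * A)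
    (hB : loc w = 1 - πO * B) (hC : A + B = πO * C) {y : TVertex}
    (hy : HasVol isUniformizer_π y (-1)) (h : seg 1 1 ≤ top isUniformizer_π y) {e b d : Oπ}
    (hu : vec ((1 + πO * e : Oπ) / π ^ 2) (b / π) d ∈ top isUniformizer_π y) (hb : πO ∣ B - b)
    (hd : πO ∣ C + d) : diag ![u, w, 1] • v₃ = y := by
  have h0 := π_ne_zero
  obtain ⟨f, hf⟩ := hb
  obtain ⟨g, hg⟩ := hd
  have hf' := coe_eq hf
  have hg' := coe_eq hg
  have hC' := coe_eq hC
  push_cast at hf' hg' hC' hu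
  rw [coe_πO] at hf' hg' hC' hu
  refine diag_smul_eq _ hasVol₃ hy fun x hx => ?_
  obtain ⟨p, q, s, rfl⟩ := mem_top_v₃.1 hx
  rw [diag_vec, loc_one, hA, hB]
  refine mem_of_vec h hu p (-(p * e)) (q + p * f - πO * B * q)
    (s - p * g - A * q - πO * A * s + B * q) ?_ ?_ ?_
  · push_cast
    field_simp
    ring
  · push_cast
    rw [coe_πO]
    field_simp
    linear_combination (p * π : Eπ) * hf'
  · push_cast
    rw [coe_πO]
    field_simp
    linear_combination (-(p * π : Eπ)) * hC' - p * π ^ 2 * hg'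

/-- The lattice of `H • v₂` contains `π⁻²(1,1,1)`. Its image under the diagonal matrix has last
coordinate `2πρ`, and modulo `seg 1 2` nothing else changes. -/
theorem diag_smul_H_smul_v₂_eq {u : rootsOfUnity 18 E} {ρ : Oπ} (hρ : loc u = 1 - πO ^ 3 * ρ)
    {y : TVertex} (hy : HasVol isUniformizer_π y 0) (h : seg 1 2 ≤ top isUniformizer_π y)
    {e b d : Oπ} (hu : vec ((1 + πO * e : Oπ) / π ^ 2) b (π * d) ∈ top isUniformizer_π y)
    (hd : πO ∣ 2 * ρ - d) : diag ![1, 1, u] • H • v₂ = y := by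
  have h0 := π_ne_zero
  obtain ⟨f, hf⟩ := hd
  have hf' := coe_eq hf
  have hz := coe_eq one_sub_ζ_eq
  have h2 : ((2 : Oπ) : Eπ) = 2 := rfl
  push_cast at hf' hz hu
  rw [coe_πO] at hf' hz hu
  rw [h2] at hf'
  have hact : diag ![1, 1, u] • H • v₂ =
      (QuotientGroup.mk (monomial 1 ![1, 1, u] * mkU₃R matH star_mul_matH matH_mem) : Γ) • v₂ := by
    rw [smul_smul]
    rfl
  rw [hact]
  refine mk_smul_eq _ hasVol₂ hy fun x hx => ?_
  obtain ⟨p, q, s, rfl⟩ := mem_top_v₂.1 hx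
  rw [map_mul, Subgroup.coe_mul, Units.val_mul, ← Matrix.mulVec_mulVec, toLocal_H_vec,
    toLocal_monomial_mulVec, diag_vec, loc_one, hρ, hz]
  refine mem_of_vec h hu (s * cofactorInv)
    (-(πO * ξO ^ 3 * q) + πO ^ 4 * ρ * ξO ^ 3 * q - πO ^ 2 * ρ * s * cofactorInv -
      s * cofactorInv * e)
    (q + πO ^ 3 * ρ * ξO ^ 3 * q - πO * ρ * s * cofactorInv - s * cofactorInv * b)
    (-(cofactorSqrt * p) - πO * cofactorζ * q - πO * (ρ + ρ) * ξO ^ 3 * q + s * cofactorInv * f)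
    ?_ ?_ ?_
  · push_cast
    rw [coe_πO]
    field_simp
    ring
  · push_cast
    rw [coe_πO]
    field_simp
    ring
  · push_cast
    rw [coe_πO]
    field_simp
    linear_combination (s * cofactorInv * π ^ 3 : Eπ) * hf'

theorem H_smul_v₃ : H • v₃ = v₃ := by
  have h0 := π_ne_zero
  have hz := coe_eq one_sub_ζ_eq
  push_cast at hz
  rw [coe_πO] at hz
  refine mk_smul_eq _ hasVol₃ hasVol₃ fun x hx => ?_
  obtain ⟨p, q, s, rfl⟩ := mem_top_v₃.1 hx
  rw [toLocal_H_vec, mem_top_v₃, hz]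
  refine ⟨-(πO ^ 2 * ξO ^ 3 * q) + cofactorInv * s, q,
    -(cofactorSqrt * p) - πO ^ 2 * cofactorζ * q, ?_⟩
  congr 1
  · push_cast
    rw [coe_πO]
    field_simp
  · push_cast
    rw [coe_πO]
    field_simp

theorem diag_smul_v₁ {u w : rootsOfUnity 18 E} {A B : Oπ} (hA : loc u = 1 - πO * A)
    (hB : loc w = 1 - πO * B) : diag ![u, w, 1] • v₁ = v₁ := by
  have h0 := π_ne_zero
  refine diag_smul_eq _ hasVol₁ hasVol₁ fun x hx => ?_
  obtain ⟨p, q, s, rfl⟩ := mem_top_v₁.1 hx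
  rw [diag_vec, loc_one, hA, hB, mem_top_v₁]
  refine ⟨p, B * p + q - πO * B * q, s - A * p - πO * A * (q + s) - B * p + πO * B * q, ?_⟩
  congr 1
  · simp
  · push_cast
    rw [coe_πO]
    field_simp
    ring
  · push_cast
    rw [coe_πO]
    field_simp
    ring

theorem diag_smul_v₂ {u w : rootsOfUnity 18 E} {A B C : Oπ} (hA : loc u = 1 - πO * A)
    (hB : loc w = 1 - πO * B) (hC : A + B = πO * C) : diag ![u, w, 1] • v₂ = v₂ := by
  have h0 := π_ne_zero
  have hC' := coe_eq hC
  push_cast at hC'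
  rw [coe_πO] at hC'
  refine diag_smul_eq _ hasVol₂ hasVol₂ fun x hx => ?_
  obtain ⟨p, q, s, rfl⟩ := mem_top_v₂.1 hx
  rw [diag_vec, loc_one, hA, hB, mem_top_v₂]
  refine ⟨p, B * p + q - πO * B * q, s - A * q - πO * A * s - C * p + B * q, ?_⟩
  congr 1
  · simp
  · push_cast
    rw [coe_πO]
    field_simp
    ring
  · push_cast
    rw [coe_πO]
    field_simp
    linear_combination (-(p * π : Eπ)) * hC'

theorem diag_smul_v₂' {u : rootsOfUnity 18 E} {ρ : Oπ} (hρ : loc u = 1 - πO ^ 3 * ρ) :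
    diag ![1, 1, u] • v₂ = v₂ := by
  have h0 := π_ne_zero
  refine diag_smul_eq _ hasVol₂ hasVol₂ fun x hx => ?_
  obtain ⟨p, q, s, rfl⟩ := mem_top_v₂.1 hx
  rw [diag_vec, loc_one, hρ, mem_top_v₂]
  refine ⟨p - πO ^ 3 * ρ * p, q - πO ^ 2 * ρ * p, s + πO * (ρ + ρ) * p, ?_⟩
  congr 1 <;> push_cast <;> rw [coe_πO] <;> field_simp <;> ring

theorem diag_smul_v₃' {u : rootsOfUnity 18 E} {ρ : Oπ} (hρ : loc u = 1 - πO ^ 3 * ρ) :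
    diag ![1, 1, u] • v₃ = v₃ := by
  have h0 := π_ne_zero
  refine diag_smul_eq _ hasVol₃ hasVol₃ fun x hx => ?_
  obtain ⟨p, q, s, rfl⟩ := mem_top_v₃.1 hx
  rw [diag_vec, loc_one, hρ, mem_top_v₃]
  refine ⟨p - πO ^ 3 * ρ * p, q - πO * ρ * p, s + (ρ + ρ) * p, ?_⟩
  congr 1 <;> push_cast <;> rw [coe_πO] <;> field_simp <;> ring

end Qutrit

/-! ### The neighbours of `v₀` -/

namespace Qutrit

open Matrix NumberField IsDedekindDomain BruhatTits

theorem dual_top_v₀ : dual (top isUniformizer_π v₀) = top isUniformizer_π v₀ := by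
  rw [top_v₀, dual_seg (by norm_num)]

theorem dual_top_v₁ : dual (top isUniformizer_π v₁) = seg 0 1 := by
  rw [top_v₁, dual_seg (by norm_num)]

theorem dual_top_v₂ : dual (top isUniformizer_π v₂) = top isUniformizer_π v₂ := by
  rw [top_v₂, dual_seg (by norm_num)]

theorem dual_top_v₃ : dual (top isUniformizer_π v₃) = seg 1 2 := by
  rw [top_v₃, dual_seg (by norm_num)]

theorem incident_v₁ {y : TVertex} (h : T.Adj v₁ y) :
    Incident π (top isUniformizer_π y) (top isUniformizer_π v₁) := by
  refine incident_of_adj' isUniformizer_π ?_ h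
  have := incident_seg_left (a := 0) (by norm_num)
  rw [top_v₁]
  exact (this.2.2.1.trans this.2.2.2).ne

theorem incident_v₃ {y : TVertex} (h : T.Adj v₃ y) :
    Incident π (top isUniformizer_π y) (top isUniformizer_π v₃) := by
  refine incident_of_adj' isUniformizer_π ?_ h
  have := incident_seg_left (a := 1) (by norm_num)
  rw [top_v₃]
  exact (this.2.2.1.trans this.2.2.2).ne

theorem exists_sign (x : Oπ) : πO ∣ x ∨ ∃ c : ℤˣ, πO ∣ x - ((c : ℤ) : Oπ) := by
  rcases exists_residue x with h | h | h
  · exact Or.inl h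
  · exact Or.inr ⟨1, by simpa using h⟩
  · exact Or.inr ⟨-1, by simpa using h⟩

theorem sign_mul_self (c : ℤˣ) : ((c : ℤ) : Oπ) * ((c : ℤ) : Oπ) = 1 := by
  rcases Int.units_eq_one_or c with rfl | rfl <;> simp

theorem dvd_sq_sub_one {x : Oπ} {c : ℤˣ} (h : πO ∣ x - ((c : ℤ) : Oπ)) : πO ∣ x ^ 2 - 1 := by
  rw [← sign_mul_self c, show x ^ 2 - ((c : ℤ) : Oπ) * ((c : ℤ) : Oπ) =
    (x - ((c : ℤ) : Oπ)) * (x + ((c : ℤ) : Oπ)) by ring]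
  exact h.mul_right _

/-- Over `F₃` a nonzero square is 1, so a sum of three squares that are not all zero vanishes only
if none of them is zero. -/
theorem exists_signs {w : Fin 3 → Oπ} (hw : ∃ i, ¬ πO ∣ w i)
    (h : πO ∣ w 0 ^ 2 + w 1 ^ 2 + w 2 ^ 2) :
    ∃ c : Fin 3 → ℤˣ, ∀ i, πO ∣ w i - ((c i : ℤ) : Oπ) := by
  have sq : ∀ {x : Oπ}, πO ∣ x → πO ∣ x ^ 2 := fun h => h.pow two_ne_zero
  have bad₁ : ∀ {x y z : Oπ}, πO ∣ x ^ 2 + y ^ 2 + z ^ 2 → πO ∣ x → πO ∣ y →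
      ∀ {c : ℤˣ}, πO ∣ z - ((c : ℤ) : Oπ) → False := by
    intro x y z h hx hy c hz
    refine not_πO_dvd_one ?_
    convert (((h.sub (sq hx)).sub (sq hy)).sub (dvd_sq_sub_one hz)) using 1
    ring
  have bad₂ : ∀ {x y z : Oπ}, πO ∣ x ^ 2 + y ^ 2 + z ^ 2 → πO ∣ x →
      ∀ {c d : ℤˣ}, πO ∣ y - ((c : ℤ) : Oπ) → πO ∣ z - ((d : ℤ) : Oπ) → False := by
    intro x y z h hx c d hy hz
    refine not_πO_dvd_two ?_
    convert (((h.sub (sq hx)).sub (dvd_sq_sub_one hy)).sub (dvd_sq_sub_one hz)) using 1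
    ring
  have h1 : πO ∣ w 1 ^ 2 + w 2 ^ 2 + w 0 ^ 2 := by convert h using 1; ring
  have h2 : πO ∣ w 2 ^ 2 + w 0 ^ 2 + w 1 ^ 2 := by convert h using 1; ring
  rcases exists_sign (w 0) with h0 | ⟨c0, h0⟩ <;> rcases exists_sign (w 1) with h1' | ⟨c1, h1'⟩ <;>
    rcases exists_sign (w 2) with h2' | ⟨c2, h2'⟩
  · obtain ⟨i, hi⟩ := hw
    fin_cases i <;> contradiction
  · exact (bad₁ h h0 h1' h2').elim
  · exact (bad₁ h2 h2' h0 h1').elim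
  · exact (bad₂ h h0 h1' h2').elim
  · exact (bad₁ h1 h1' h2' h0).elim
  · exact (bad₂ h1 h1' h2' h0).elim
  · exact (bad₂ h2 h2' h0 h1').elim
  · refine ⟨![c0, c1, c2], fun i => ?_⟩
    fin_cases i <;> assumption

/-- A neighbour of `v₀` contains `w/π` for an integral `w` that is nonzero modulo `π`. The condition
`πM ≤ M^#` makes `w` isotropic, and conjugation is trivial modulo `π`, so `w₀² + w₁² + w₂² ≡ 0`. The
isotropic lines of `F₃³` are spanned by the vectors `(±1, ±1, 1)`, which diagonal signs permute. -/
theorem exists_smul_v₁_eq {y : TVertex} (h : T.Adj v₀ y) :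
    ∃ ε : ℤˣ × ℤˣ, diag ![sgn ε.1, sgn ε.2, 1] • v₁ = y := by
  have h0 := π_ne_zero
  have hi := incident_of_adj isUniformizer_π dual_top_v₀ h
  have hy := hasVol_of_incident isUniformizer_π hi
  obtain ⟨u, hu, hu0⟩ := SetLike.exists_of_lt hi.2.2.2
  have hd := hi.2.1.le (Submodule.smul_mem_pointwise_smul u π _ hu)
  obtain ⟨k, hk⟩ : ∃ k : Oπ, star u ⬝ᵥ (π • u) = k := ⟨⟨_, hd u hu⟩, rfl⟩
  have hw := hi.2.2.1.le hd
  have hle : lattice Oπ 1 ≤ top isUniformizer_π y := by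
    rw [← seg_zero, ← top_v₀]
    exact hi.2.2.2.le
  rw [top_v₀, seg_zero, mem_lattice_one] at hw hu0
  obtain ⟨w, hwu⟩ : ∃ w : Fin 3 → Oπ, ∀ i, u i = (w i : Eπ) / π :=
    ⟨fun i => ⟨_, hw i⟩, fun i => by simp [h0]⟩
  choose e he using fun i => exists_star_eq (w i)
  have hsum : πO ∣ w 0 ^ 2 + w 1 ^ 2 + w 2 ^ 2 := by
    refine ⟨-ξO ^ 8 * k - (e 0 * w 0 + e 1 * w 1 + e 2 * w 2), Subtype.ext ?_⟩
    have h9 := coe_eq ξO_pow_nine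
    have hs : ∀ i, star (u i) = -(ξO : Eπ) * π⁻¹ * (w i + π * e i) := by
      intro i
      rw [hwu, div_eq_mul_inv, star_mul', star_inv₀, inv_star_π, he]
      ring
    have hk' : -(ξO : Eπ) * ((w 0 + π * e 0) * w 0 + (w 1 + π * e 1) * w 1 +
        (w 2 + π * e 2) * w 2) = π * k := by
      rw [← hk]
      simp only [dotProduct, Fin.sum_univ_three, Pi.star_apply, Pi.smul_apply, smul_eq_mul, hs]
      simp only [hwu]
      field_simp
      ring
    push_cast at h9 ⊢
    rw [coe_πO]
    linear_combination (-(ξO : Eπ) ^ 8) * hk' - ((w 0 + π * e 0) * w 0 + (w 1 + π * e 1) * w 1 +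
        (w 2 + π * e 2) * w 2 : Eπ) * h9
  obtain ⟨c, hc⟩ := exists_signs (by
    by_contra! hcon
    refine hu0 fun i => ?_
    obtain ⟨z, hz⟩ := hcon i
    rw [hwu, hz]
    push_cast
    rw [coe_πO, mul_div_cancel_left₀ _ h0]
    exact z.2) hsum
  choose z hz using hc
  have hz' : ∀ i, (w i : Eπ) = ((c i : ℤ) : Eπ) + π * z i := by
    intro i
    rw [← coe_πO]
    simpa using coe_eq (sub_eq_iff_eq_add'.1 (hz i))
  have hc2 : (((c 2 : ℤˣ) : ℤ) : Eπ) * (((c 2 : ℤˣ) : ℤ) : Eπ) = 1 := by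
    simpa using coe_eq (sign_mul_self (c 2))
  -- Multiplication by `c 2` normalizes the last coordinate of the isotropic vector to 1.
  refine ⟨(c 0 * c 2, c 1 * c 2), diag_smul_eq _ hasVol₁ hy fun x hx => ?_⟩
  obtain ⟨p, q, s, rfl⟩ := mem_top_v₁.1 hx
  have hrem := (top isUniformizer_π y).sub_mem (hle (mem_lattice_one.2 ?_) :
    (fun i => (loc (![sgn (c 0 * c 2), sgn (c 1 * c 2), 1] i) : Eπ) * vec (p / π) q s i) -
      (p * (((c 2 : ℤˣ) : ℤ) : Oπ)) • u ∈ _)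
    ((top isUniformizer_π y).smul_mem (-(p * (((c 2 : ℤˣ) : ℤ) : Oπ))) hu)
  · convert hrem using 1
    rw [neg_smul, sub_neg_eq_add, sub_add_cancel]
  · have hsm : ∀ i, ((p * (((c 2 : ℤˣ) : ℤ) : Oπ)) • u) i = p * (((c 2 : ℤˣ) : ℤ) : Eπ) * u i := by
      intro i
      change ((p * (((c 2 : ℤˣ) : ℤ) : Oπ) : Oπ) : Eπ) * u i = _
      push_cast
      rfl
    intro i
    rw [Pi.sub_apply, hsm, hwu, hz']
    fin_cases i
    · convert ((((c 0 * c 2 : ℤˣ) : ℤ) : Oπ) * (q + s) - p * (((c 2 : ℤˣ) : ℤ) : Oπ) * z 0).2 using 1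
      simp [vec, loc_sgn]
      field_simp
      ring
    · convert (-(((c 1 * c 2 : ℤˣ) : ℤ) : Oπ) * q - p * (((c 2 : ℤˣ) : ℤ) : Oπ) * z 1).2 using 1
      simp [vec, loc_sgn]
      field_simp
      ring
    · convert (-p * (((c 2 : ℤˣ) : ℤ) : Oπ) * z 2).2 using 1
      simp [vec, loc_one]
      field_simp
      linear_combination (-p : Eπ) * hc2

/-- If two sign choices gave the same lattice, the vectors `(a, b, 1)` and `(a', b', 1)` would be
orthogonal modulo `π`. Now `aa' + bb' + 1 ≡ 0` modulo 3 forces `aa' = bb' = 1`. -/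
theorem smul_v₁_injective :
    Function.Injective fun ε : ℤˣ × ℤˣ => diag ![sgn ε.1, sgn ε.2, 1] • v₁ := by
  have h0 := π_ne_zero
  rintro ⟨a, b⟩ ⟨a', b'⟩ h
  dsimp only at h
  have hx : vec (1 / π) 0 0 ∈ top isUniformizer_π v₁ := mem_top_v₁.2 ⟨1, 0, 0, by simp⟩
  have h1 := diag_smul_mem_top ![sgn a, sgn b, 1] hx
  have h2 := diag_smul_mem_top ![sgn a', sgn b', 1] hx
  rw [h] at h1
  have hadj : T.Adj v₀ (diag ![sgn a', sgn b', 1] • v₁) := by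
    have := smul_adj (toLocal (monomial 1 ![sgn a', sgn b', 1])) adj₀₁
    change T.Adj (diag ![sgn a', sgn b', 1] • v₀) (diag ![sgn a', sgn b', 1] • v₁) at this
    rwa [diag_smul_v₀] at this
  have hi := incident_of_adj isUniformizer_π dual_top_v₀ hadj
  have hd := hi.2.1.le (Submodule.smul_mem_pointwise_smul _ π _ h2)
  obtain ⟨k, hk⟩ : ∃ k : Oπ,
      star (fun i => (loc (![sgn a, sgn b, 1] i) : Eπ) * vec (1 / π) 0 0 i) ⬝ᵥ
        (π • fun i => (loc (![sgn a', sgn b', 1] i) : Eπ) * vec (1 / π) 0 0 i) = k :=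
    ⟨⟨_, hd _ h1⟩, rfl⟩
  have hdvd : πO ∣ ((a : ℤ) : Oπ) * ((a' : ℤ) : Oπ) + ((b : ℤ) : Oπ) * ((b' : ℤ) : Oπ) + 1 := by
    refine ⟨-ξO ^ 8 * k, Subtype.ext ?_⟩
    have h9 := coe_eq ξO_pow_nine
    have hk' : -(ξO : Eπ) * (((a : ℤ) : Eπ) * ((a' : ℤ) : Eπ) + ((b : ℤ) : Eπ) * ((b' : ℤ) : Eπ) + 1) =
        π * k := by
      rw [← hk]
      simp [dotProduct, Fin.sum_univ_three, loc_sgn, loc_one, vec, inv_star_π]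
      field_simp
      ring
    push_cast at h9 ⊢
    rw [coe_πO]
    linear_combination (-(ξO : Eπ) ^ 8) * hk' -
      (((a : ℤ) : Eπ) * ((a' : ℤ) : Eπ) + ((b : ℤ) : Eπ) * ((b' : ℤ) : Eπ) + 1) * h9
  rcases Int.units_eq_one_or a with rfl | rfl <;> rcases Int.units_eq_one_or a' with rfl | rfl <;>
    rcases Int.units_eq_one_or b with rfl | rfl <;> rcases Int.units_eq_one_or b' with rfl | rfl <;>
    first
    | rfl
    | (exfalso; norm_num at hdvd; exact not_πO_dvd_one hdvd)

end Qutrit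

/-! ### The neighbours of `v₁`, `v₂` and `v₃` -/

namespace Qutrit

open Matrix NumberField IsDedekindDomain BruhatTits

theorem ξO_eq : ξO = 1 - πO := by
  rw [πO]
  ring

theorem loc_rootξ_pow (k : ℕ) : loc (rootξ ^ k) = ξO ^ k := by
  rw [loc_pow, loc_rootξ]

theorem neg_vec (α β γ : Eπ) : -vec α β γ = vec (-α) (-β) (-γ) := by
  ext i
  fin_cases i <;> simp [vec] <;> ring

/-- The diagonal matrix `diag(ξ, 1, 1)` moves the neighbours of `v₁` other than `v₀`. -/
def t₁ : Γ := diag ![rootξ, 1, 1]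

/-- The diagonal matrix `diag(ξ, ξ⁻¹, 1)` moves the neighbours of `v₂` other than `v₁`. -/
def t₂ : Γ := diag ![rootξ, rootξ ^ 8, 1]

/-- The diagonal matrix `diag(1, 1, ζ₃)` moves the neighbours of `v₃` other than `v₂`. -/
def t₃ : Γ := diag ![1, 1, rootξ ^ 3]

theorem t₁_pow (k : ℕ) : t₁ ^ k = diag ![rootξ ^ k, 1, 1] := by
  rw [t₁, ← map_pow]
  congr 1
  ext i
  fin_cases i <;> simp

theorem t₂_pow (k : ℕ) : t₂ ^ k = diag ![rootξ ^ k, (rootξ ^ 8) ^ k, 1] := by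
  rw [t₂, ← map_pow]
  congr 1
  ext i
  fin_cases i <;> simp

theorem t₃_pow (k : ℕ) : t₃ ^ k = diag ![1, 1, (rootξ ^ 3) ^ k] := by
  rw [t₃, ← map_pow]
  congr 1
  ext i
  fin_cases i <;> simp

theorem diag_ones : diag ![1, 1, 1] = 1 := by
  rw [← map_one diag]
  congr 1
  ext i
  fin_cases i <;> simp

theorem t₁_pow_nine : t₁ ^ 9 = 1 := by
  rw [t₁_pow, rootξ_pow_nine, diag_ones]

theorem t₂_pow_nine : t₂ ^ 9 = 1 := by
  rw [t₂_pow, rootξ_pow_nine, ← pow_mul, mul_comm, pow_mul, rootξ_pow_nine, one_pow, diag_ones]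

theorem t₃_pow_nine : t₃ ^ 9 = 1 := by
  rw [t₃_pow, ← pow_mul, mul_comm, pow_mul, rootξ_pow_nine, one_pow, diag_ones]

theorem one_sub_ξO_pow_eight : ξO ^ 8 = 1 - πO * (-ξO ^ 8) := by
  rw [πO]
  linear_combination ξO_pow_nine

theorem dvd_ξO_pow_sub_one (k : ℕ) : πO ∣ ξO ^ k - 1 := by
  have := (sub_one_dvd_pow_sub_one ξO k)
  rwa [← neg_sub, neg_dvd] at this

/-- Since `ξ^k = 1 - πA` with `A ≡ k`, the exponent is determined by `k ≡ -r`. -/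
theorem exists_pow_smul_v₂_eq_of_mem {y : TVertex} (hy : HasVol isUniformizer_π y 0)
    (h : seg 0 1 ≤ top isUniformizer_π y) {e b r : Oπ}
    (hu : vec ((1 + πO * e : Oπ) / π) b r ∈ top isUniformizer_π y) :
    ∃ k < 3, t₁ ^ k • v₂ = y := by
  rcases exists_residue r with hr | hr | hr
  · refine ⟨0, by norm_num, ?_⟩
    rw [t₁_pow]
    refine diag_smul_v₂_eq (A := 0) ?_ hy h hu (by simpa using hr)
    rw [loc_rootξ_pow]
    ring
  · refine ⟨2, by norm_num, ?_⟩
    rw [t₁_pow]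
    refine diag_smul_v₂_eq (A := 1 + ξO) ?_ hy h hu ?_
    · rw [loc_rootξ_pow, πO]
      ring
    · convert (hr.add πO_dvd_three).sub (dvd_refl πO) using 1
      rw [ξO_eq]
      ring
  · refine ⟨1, by norm_num, ?_⟩
    rw [t₁_pow]
    refine diag_smul_v₂_eq (A := 1) ?_ hy h hu hr
    rw [loc_rootξ_pow, πO]
    ring

/-- A neighbour other than `v₀` contains a vector of `top v₁` outside `O³`, that is, one whose
coefficient at `π⁻¹(1,1,1)` is a unit; up to sign this coefficient is 1 modulo `π`. -/
theorem exists_pow_smul_v₂_eq {y : TVertex} (h : T.Adj v₁ y) (hne : y ≠ v₀) :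
    ∃ k < 3, t₁ ^ k • v₂ = y := by
  have h0 := π_ne_zero
  have hi := incident_v₁ h
  have hy := hasVol_of_selfDual isUniformizer_π hi.1
  have hle := dual_top_v₁ ▸ hi.2.2.1.le
  obtain ⟨u, hu, hu0⟩ := SetLike.not_le_iff_exists.1 fun hle =>
    hne (eq_of_top_le isUniformizer_π hy hasVol₀ hle)
  obtain ⟨p, q, r, rfl⟩ := mem_top_v₁.1 (hi.2.2.2.le hu)
  rcases exists_residue p with ⟨e, he⟩ | ⟨e, he⟩ | ⟨e, he⟩
  · refine (hu0 (mem_top_v₀.2 ⟨e, q, r, ?_⟩)).elim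
    rw [he]
    push_cast
    rw [coe_πO, mul_div_cancel_left₀ _ h0]
  · refine exists_pow_smul_v₂_eq_of_mem hy hle (e := e) (b := q) (r := r) ?_
    rwa [← he, add_sub_cancel]
  · refine exists_pow_smul_v₂_eq_of_mem hy hle (e := -e) (b := -q) (r := -r) ?_
    have := (top isUniformizer_π y).neg_mem hu
    rw [neg_vec] at this
    convert this using 2
    · rw [mul_neg, ← he]
      push_cast
      ring
    · simp
    · simp

/-- In these coordinates the form modulo `π` is `2(ad - b²)`: the product of `(1,1,1)` with itself
disappears because `π⁶` divides 3, and the minus sign comes from `star π⁻¹ = -ξ π⁻¹`. Neighbours of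
`v₂` thus correspond to points of the conic `ad = b²` over `F₃`. -/
theorem dvd_of_isotropic {y : TVertex} (hi : Incident π (top isUniformizer_π v₂)
    (top isUniformizer_π y)) {a b d : Oπ}
    (hu : vec (a / π ^ 2) (b / π) d ∈ top isUniformizer_π y) : πO ∣ a * d - b ^ 2 := by
  have h0 := π_ne_zero
  have hd := hi.2.1.le (Submodule.smul_mem_pointwise_smul _ π _ hu) _ hu
  have hπ : π • vec (a / π ^ 2) (b / π) d = vec (a / π) b (π * d) := by
    ext i
    fin_cases i <;> simp [vec] <;> field_simp
  rw [hπ] at hd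
  obtain ⟨k, hk⟩ : ∃ k : Oπ, star (vec (a / π ^ 2) (b / π) d) ⬝ᵥ vec (a / π) b (π * d) = k :=
    ⟨⟨_, hd⟩, rfl⟩
  obtain ⟨e₁, he₁⟩ := exists_star_eq a
  obtain ⟨e₂, he₂⟩ := exists_star_eq b
  obtain ⟨e₃, he₃⟩ := exists_star_eq d
  have h3' : (3 : Eπ) = π ^ 6 * cofactorThree := by
    rw [← coe_πO]
    exact coe_eq three_eq
  have hs₁ : star ((a : Eπ) / π ^ 2) = (a + π * e₁) * (ξO : Eπ) ^ 2 / π ^ 2 := by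
    rw [div_eq_mul_inv, star_mul', star_inv₀, star_pow, ← inv_pow, inv_star_π, he₁]
    field_simp
  have hs₂ : star ((b : Eπ) / π) = -(b + π * e₂) * (ξO : Eπ) / π := by
    rw [div_eq_mul_inv, star_mul', star_inv₀, inv_star_π, he₂]
    field_simp
  have hk' : π ^ 4 * cofactorThree * (a + π * e₁) * (ξO : Eπ) ^ 2 * a -
      2 * ξO * (b + π * e₂) * b + π ^ 2 * (d + π * e₃) * d + (ξO : Eπ) ^ 2 * (a + π * e₁) * d +
      (d + π * e₃) * a - ξO * π * (b + π * e₂) * d + π * (d + π * e₃) * b = π * k := by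
    rw [← hk, star_vec_dotProduct, hs₁, hs₂, he₃, h3']
    field_simp
    ring
  have hξ : (ξO : Eπ) = 1 - π := by
    rw [π_eq]
    ring
  have h2 : πO ∣ 2 * (a * d - b ^ 2) := by
    refine ⟨k - πO ^ 3 * cofactorThree * (a + πO * e₁) * ξO ^ 2 * a - πO * (d + πO * e₃) * d +
      ξO * (b + πO * e₂) * d - (d + πO * e₃) * b + (1 + ξO) * a * d - (b ^ 2 + b ^ 2) -
      ξO ^ 2 * e₁ * d - e₃ * a + (ξO * e₂ * b + ξO * e₂ * b), Subtype.ext ?_⟩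
    rw [two_mul]
    push_cast
    rw [coe_πO]
    rw [hξ] at hk' ⊢
    linear_combination hk'
  convert (πO_dvd_three.mul_right (a * d - b ^ 2)).sub h2 using 1
  ring

theorem dvd_of_dvd_sq {b : Oπ} (h : πO ∣ b ^ 2) : πO ∣ b := by
  refine (exists_sign b).resolve_right fun ⟨c, hc⟩ => not_πO_dvd_one ?_
  convert h.sub (dvd_sq_sub_one hc) using 1
  ring

/-- With `a = 1` the point of the conic is `(1, b, b²)`. For the `k`-th power of `t₂` one has `A ≡
k`, `B ≡ -k`, `C ≡ -k²`, so it realizes the point with `b ≡ -k`. -/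
theorem exists_pow_smul_v₃_eq_of_mem {y : TVertex} (hi : Incident π (top isUniformizer_π v₂)
    (top isUniformizer_π y)) {e b d : Oπ}
    (hu : vec ((1 + πO * e : Oπ) / π ^ 2) (b / π) d ∈ top isUniformizer_π y) :
    ∃ k < 3, t₂ ^ k • v₃ = y := by
  have hy := hasVol_of_incident isUniformizer_π hi
  have hle := top_v₂ ▸ hi.2.2.2.le
  have hdvd : πO ∣ d - b ^ 2 := by
    convert (dvd_of_isotropic hi hu).sub (dvd_mul_right πO (e * d)) using 1
    ring
  have h8 := one_sub_ξO_pow_eight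
  have h9 := ξO_pow_nine
  rcases exists_residue b with hb | hb | hb
  · refine ⟨0, by norm_num, ?_⟩
    rw [t₂_pow]
    refine diag_smul_v₃_eq (A := 0) (B := 0) (C := 0) ?_ ?_ (by ring) hy hle hu (by simpa using hb) ?_
    · rw [loc_rootξ_pow]
      ring
    · rw [pow_zero, loc_one]
      ring
    · convert hdvd.add (hb.pow two_ne_zero) using 1
      ring
  · refine ⟨2, by norm_num, ?_⟩
    rw [t₂_pow]
    refine diag_smul_v₃_eq (A := 1 + ξO) (B := -ξO ^ 7 * (1 + ξO)) (C := -ξO ^ 7 * (1 + ξO) ^ 2)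
      ?_ ?_ ?_ hy hle hu ?_ ?_
    · rw [loc_rootξ_pow, πO]
      ring
    · rw [← pow_mul, loc_rootξ_pow, πO]
      linear_combination (ξO ^ 7 + 1) * h9
    · rw [πO]
      linear_combination (-1 - ξO) * h9
    · convert (((dvd_ξO_pow_sub_one 7).add (dvd_ξO_pow_sub_one 8)).add (hb.add πO_dvd_three)).neg_right
        using 1
      ring
    · convert ((hdvd.add (hb.mul_right (b + 1))).sub πO_dvd_three).sub
        (((dvd_ξO_pow_sub_one 7).add ((dvd_ξO_pow_sub_one 8).mul_left 2)).add
          (dvd_ξO_pow_sub_one 9)) using 1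
      ring
  · refine ⟨1, by norm_num, ?_⟩
    rw [t₂_pow]
    refine diag_smul_v₃_eq (A := 1) (B := -ξO ^ 8) (C := -ξO ^ 8) ?_ ?_ ?_ hy hle hu ?_ ?_
    · rw [loc_rootξ_pow, πO]
      ring
    · rw [pow_one, loc_rootξ_pow]
      exact h8
    · rw [πO]
      linear_combination -h9
    · convert ((dvd_ξO_pow_sub_one 8).add hb).neg_right using 1
      ring
    · convert (hdvd.add (hb.mul_right (b - 1))).sub (dvd_ξO_pow_sub_one 8) using 1
      ring

theorem exists_pow_smul_v₃_eq {y : TVertex} (h : T.Adj v₂ y) (hne : y ≠ v₁) :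
    ∃ k < 3, t₂ ^ k • v₃ = y := by
  have h0 := π_ne_zero
  have hi := incident_of_adj isUniformizer_π dual_top_v₂ h
  have hy := hasVol_of_incident isUniformizer_π hi
  obtain ⟨u, hu, hu0⟩ := SetLike.exists_of_lt hi.2.2.2
  obtain ⟨a, b, d, hw⟩ := mem_top_v₂.1
    (hi.2.2.1.le (hi.2.1.le (Submodule.smul_mem_pointwise_smul u π _ hu)))
  obtain rfl : u = vec (a / π ^ 2) (b / π) d := by
    rw [← inv_smul_smul₀ h0 u, hw]
    ext i
    fin_cases i <;> simp [vec] <;> field_simp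
  rcases exists_residue a with ⟨e, he⟩ | ⟨e, he⟩ | ⟨e, he⟩
  -- If `a ≡ 0` then `b ≡ 0`, and `d` must be a unit. This remaining point `(0, 0, 1)` of the conic
  -- gives back `v₁`.
  · refine (hne (eq_of_top_le isUniformizer_π hasVol₁ hy fun x hx => ?_).symm).elim
    obtain ⟨b', rfl⟩ : πO ∣ b := dvd_of_dvd_sq <| by
      have h1 := dvd_of_isotropic hi hu
      rw [he] at h1
      convert (dvd_mul_right πO (e * d)).sub h1 using 1
      ring
    have hu' : vec (e / π) b' d ∈ top isUniformizer_π y := by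
      convert hu using 2
      · rw [he]
        push_cast
        rw [coe_πO]
        field_simp
      · push_cast
        rw [coe_πO]
        field_simp
    rcases exists_sign d with ⟨d', rfl⟩ | ⟨c, z, hz⟩
    · refine (hu0 (mem_top_v₂.2 ⟨e, b', d', ?_⟩)).elim
      rw [he]
      push_cast
      rw [coe_πO]
      congr 1 <;> field_simp
    · obtain ⟨p, q, r, rfl⟩ := mem_top_v₁.1 hx
      have hz' : (d : Eπ) = ((c : ℤ) : Eπ) + π * z := by
        rw [← coe_πO]
        simpa using coe_eq (sub_eq_iff_eq_add'.1 hz)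
      have hc : ((c : ℤ) : Eπ) * ((c : ℤ) : Eπ) = 1 := by simpa using coe_eq (sign_mul_self c)
      refine mem_of_vec (top_v₂ ▸ hi.2.2.2.le) hu' (((c : ℤ) : Oπ) * r)
        (p - ((c : ℤ) : Oπ) * r * e) (q - ((c : ℤ) : Oπ) * r * b') (-((c : ℤ) : Oπ) * r * z) ?_ ?_ ?_
      · push_cast
        field_simp
        ring
      · push_cast
        ring
      · push_cast
        rw [hz']
        linear_combination (-r : Eπ) * hc
  · refine exists_pow_smul_v₃_eq_of_mem hi (e := e) (b := b) (d := d) ?_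
    rwa [← he, add_sub_cancel]
  · refine exists_pow_smul_v₃_eq_of_mem hi (e := -e) (b := -b) (d := -d) ?_
    have := (top isUniformizer_π y).neg_mem hu
    rw [neg_vec] at this
    convert this using 2
    · rw [mul_neg, ← he]
      push_cast
      ring
    · push_cast
      ring
    · simp

/-- Here `ζ₃^k = 1 - π³ρ` with `ρ ≡ k`, because `cofactorζ ≡ 1`; so `d ≡ 2k ≡ -k` determines `k`. -/
theorem exists_pow_smul_H_smul_v₂_eq_of_mem {y : TVertex} (hy : HasVol isUniformizer_π y 0)
    (h : seg 1 2 ≤ top isUniformizer_π y) {e b d : Oπ}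
    (hu : vec ((1 + πO * e : Oπ) / π ^ 2) b (π * d) ∈ top isUniformizer_π y) :
    ∃ k < 3, t₃ ^ k • H • v₂ = y := by
  have hζ := one_sub_ζ_eq
  have hτ : πO ∣ cofactorζ - 1 := ⟨πO ^ 3 * cofactorThree * (1 - πO), by rw [cofactorζ]; ring⟩
  rcases exists_residue d with hd | hd | hd
  · refine ⟨0, by norm_num, ?_⟩
    rw [t₃_pow]
    refine diag_smul_H_smul_v₂_eq (ρ := 0) ?_ hy h hu ?_
    · rw [pow_zero, loc_one]
      ring
    · simpa using hd
  · refine ⟨2, by norm_num, ?_⟩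
    rw [t₃_pow]
    refine diag_smul_H_smul_v₂_eq (ρ := cofactorζ * (1 + ξO ^ 3)) ?_ hy h hu ?_
    · rw [← pow_mul, loc_rootξ_pow]
      linear_combination -(1 + ξO ^ 3) * hζ
    · convert (((hτ.mul_left (2 * (1 + ξO ^ 3))).add ((dvd_ξO_pow_sub_one 3).mul_left 2)).sub hd).add
        πO_dvd_three using 1
      ring
  · refine ⟨1, by norm_num, ?_⟩
    rw [t₃_pow]
    refine diag_smul_H_smul_v₂_eq (ρ := cofactorζ) ?_ hy h hu ?_
    · rw [pow_one, loc_rootξ_pow]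
      linear_combination -hζ
    · convert ((hτ.mul_left 2).sub hd).add πO_dvd_three using 1
      ring

theorem exists_pow_smul_H_smul_v₂_eq {y : TVertex} (h : T.Adj v₃ y) (hne : y ≠ v₂) :
    ∃ k < 3, t₃ ^ k • H • v₂ = y := by
  have h0 := π_ne_zero
  have hi := incident_v₃ h
  have hy := hasVol_of_selfDual isUniformizer_π hi.1
  have hle := dual_top_v₃ ▸ hi.2.2.1.le
  obtain ⟨u, hu, hu0⟩ := SetLike.not_le_iff_exists.1 fun hle =>
    hne (eq_of_top_le isUniformizer_π hy hasVol₂ hle)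
  obtain ⟨p, q, r, rfl⟩ := mem_top_v₃.1 (hi.2.2.2.le hu)
  rcases exists_residue p with ⟨e, he⟩ | ⟨e, he⟩ | ⟨e, he⟩
  · refine (hu0 (mem_top_v₂.2 ⟨e, q, r, ?_⟩)).elim
    rw [he]
    push_cast
    rw [coe_πO]
    congr 1
    field_simp
  · refine exists_pow_smul_H_smul_v₂_eq_of_mem hy hle (e := e) (b := q) (d := r) ?_
    rwa [← he, add_sub_cancel]
  · refine exists_pow_smul_H_smul_v₂_eq_of_mem hy hle (e := -e) (b := -q) (d := -r) ?_
    have := (top isUniformizer_π y).neg_mem hu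
    rw [neg_vec] at this
    convert this using 2
    · rw [mul_neg, ← he]
      push_cast
      ring
    · simp
    · simp

end Qutrit

/-- The order of `t` is odd, so if `t²` fixed `x` then so would `t = (t²)⁵`. Hence `x`, `t • x`, `t²
• x` are distinct, and they differ from the fixed point `a`. -/
theorem ncard_eq_four_of_orbit {G V : Type*} [Group G] [MulAction G V] {S : Set V} {a x : V} {t : G}
    (ht : t ^ 9 = 1) (ha : t • a = a) (hxa : x ≠ a) (htx : t • x ≠ x)
    (hS : ∀ y, y ∈ S ↔ y = a ∨ ∃ k < 3, t ^ k • x = y) : S.ncard = 4 := by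
  have htxa : t • x ≠ a := fun h => hxa (smul_left_cancel t (h.trans ha.symm))
  have httxa : t • t • x ≠ a := fun h => htxa (smul_left_cancel t (h.trans ha.symm))
  have httx : t • t • x ≠ x := by
    intro h
    have h2 : ∀ n : ℕ, (t ^ 2) ^ n • x = x := by
      intro n
      induction n with
      | zero => rw [pow_zero, one_smul]
      | succ n ih => rw [pow_succ, mul_smul, pow_two, mul_smul, h, ← pow_two, ih]
    refine htx ?_
    have h5 := h2 5
    rwa [← pow_mul, show 2 * 5 = 9 + 1 from rfl, pow_succ, ht, one_mul] at h5
  have hset : S = {a, x, t • x, t • t • x} := by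
    ext y
    rw [hS]
    simp only [Set.mem_insert_iff, Set.mem_singleton_iff]
    constructor
    · rintro (rfl | ⟨k, hk, rfl⟩)
      · exact Or.inl rfl
      · interval_cases k
        · simp
        · simp
        · rw [pow_two, mul_smul]
          simp
    · rintro (rfl | rfl | rfl | rfl)
      · exact Or.inl rfl
      · exact Or.inr ⟨0, by norm_num, by simp⟩
      · exact Or.inr ⟨1, by norm_num, by simp⟩
      · exact Or.inr ⟨2, by norm_num, by rw [pow_two, mul_smul]⟩
  rw [hset, Set.ncard_insert_of_notMem, Set.ncard_insert_of_notMem, Set.ncard_pair]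
  · exact fun h => htx (smul_left_cancel t h).symm
  · simp only [Set.mem_insert_iff, Set.mem_singleton_iff, not_or]
    exact ⟨htx.symm, httx.symm⟩
  · simp only [Set.mem_insert_iff, Set.mem_singleton_iff, not_or]
    exact ⟨hxa.symm, htxa.symm, httxa.symm⟩

namespace Qutrit

open Matrix NumberField IsDedekindDomain BruhatTits

/-! ### The number of neighbours -/

theorem Γ_smul_adj (g : Γ) (x y : TVertex) (h : T.Adj x y) : T.Adj (g • x) (g • y) := by
  obtain ⟨g, rfl⟩ := QuotientGroup.mk_surjective g
  exact smul_adj (toLocal g) h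

theorem t₁_smul_v₁ : t₁ • v₁ = v₁ :=
  diag_smul_v₁ (A := 1) (B := 0) (by rw [loc_rootξ, πO]; ring) (by rw [loc_one]; ring)

theorem loc_t₂ : loc (rootξ ^ 8) = 1 - πO * (-ξO ^ 8) := by
  rw [loc_rootξ_pow]
  exact one_sub_ξO_pow_eight

theorem t₂_smul_v₁ : t₂ • v₁ = v₁ :=
  diag_smul_v₁ (A := 1) (by rw [loc_rootξ, πO]; ring) loc_t₂

theorem t₂_smul_v₂ : t₂ • v₂ = v₂ :=
  diag_smul_v₂ (A := 1) (C := -ξO ^ 8) (by rw [loc_rootξ, πO]; ring) loc_t₂ (by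
    rw [πO]
    linear_combination -ξO_pow_nine)

theorem loc_t₃ : loc (rootξ ^ 3) = 1 - πO ^ 3 * cofactorζ := by
  rw [loc_rootξ_pow]
  linear_combination -one_sub_ζ_eq

theorem t₃_smul_v₂ : t₃ • v₂ = v₂ := diag_smul_v₂' loc_t₃

theorem t₃_smul_v₃ : t₃ • v₃ = v₃ := diag_smul_v₃' loc_t₃

theorem pow_smul_eq {t : Γ} {s : TVertex} (h : t • s = s) (k : ℕ) : t ^ k • s = s :=
  pow_mem (MulAction.mem_stabilizer_iff.2 h) k

theorem not_eq_π_mul {x : Eπ} {y : Oπ} (hx : x = 1) : x ≠ π * y := by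
  intro h
  refine not_πO_dvd_one ⟨y, Subtype.ext ?_⟩
  push_cast
  rw [coe_πO, ← h, hx]

theorem v₂_ne_v₀ : v₂ ≠ v₀ := by
  have h0 := π_ne_zero
  intro h
  have hx : vec (1 / π) 0 0 ∈ top isUniformizer_π v₂ := mem_top_v₂.2 ⟨1, 0, 0, by simp⟩
  rw [h] at hx
  obtain ⟨p, q, r, hp⟩ := mem_top_v₀.1 hx
  exact not_eq_π_mul (y := p) rfl (by rw [← (vec_injective hp).1]; field_simp)

theorem t₁_smul_v₂_ne : t₁ • v₂ ≠ v₂ := by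
  have h0 := π_ne_zero
  intro h
  have hx : vec (1 / π) 0 0 ∈ top isUniformizer_π v₂ := mem_top_v₂.2 ⟨1, 0, 0, by simp⟩
  have h1 := diag_smul_mem_top ![rootξ, 1, 1] hx
  rw [show diag ![rootξ, 1, 1] • v₂ = v₂ from h, diag_vec, loc_one, loc_rootξ] at h1
  obtain ⟨p, q, r, hp⟩ := mem_top_v₂.1 h1
  refine not_eq_π_mul (y := -r) rfl ?_
  have := (vec_injective hp).2.2
  push_cast
  rw [mul_neg, ← this, π_eq]
  rw [π_eq] at h0
  field_simp
  push_cast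
  ring

theorem v₃_ne_v₁ : v₃ ≠ v₁ := by
  have h0 := π_ne_zero
  intro h
  have hx : vec (1 / π ^ 2) 0 0 ∈ top isUniformizer_π v₃ := mem_top_v₃.2 ⟨1, 0, 0, by simp⟩
  rw [h] at hx
  obtain ⟨p, q, r, hp⟩ := mem_top_v₁.1 hx
  have := (vec_injective hp).1
  field_simp at this
  exact not_eq_π_mul (y := p) rfl this

theorem t₂_smul_v₃_ne : t₂ • v₃ ≠ v₃ := by
  have h0 := π_ne_zero
  intro h
  have hx : vec (1 / π ^ 2) 0 0 ∈ top isUniformizer_π v₃ := mem_top_v₃.2 ⟨1, 0, 0, by simp⟩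
  have h1 := diag_smul_mem_top ![rootξ, rootξ ^ 8, 1] hx
  rw [show diag ![rootξ, rootξ ^ 8, 1] • v₃ = v₃ from h, diag_vec, loc_one, loc_t₂] at h1
  obtain ⟨p, q, r, hp⟩ := mem_top_v₃.1 h1
  have := (vec_injective hp).2.1
  push_cast at this
  rw [coe_πO] at this
  field_simp at this
  have h9 := coe_eq ξO_pow_nine
  push_cast at h9
  have h8 : -(ξO : Eπ) ^ 8 = π * q := mul_left_cancel₀ h0 (by linear_combination this)
  refine not_eq_π_mul (y := -q * ξO) rfl ?_
  push_cast
  linear_combination (-ξO : Eπ) * h8 - h9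

theorem H_smul_v₂_mem : vec (1 / π ^ 2) 0 0 ∈ top isUniformizer_π (H • v₂) := by
  have h0 := π_ne_zero
  have hx : vec 0 0 (π * cofactorSqrt) ∈ top isUniformizer_π v₂ :=
    mem_top_v₂.2 ⟨0, 0, cofactorSqrt, by simp⟩
  have h1 := mulVec_mem_top (mkU₃R matH star_mul_matH matH_mem) hx
  rw [toLocal_H_vec] at h1
  have hc := coe_eq cofactorSqrt_mul
  push_cast at hc
  have e₁ : -(ξO : Eπ) ^ 3 * 0 + cofactorInv / π ^ 3 * (π * cofactorSqrt) = 1 / π ^ 2 := by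
    field_simp
    linear_combination hc
  have e₂ : -(π ^ 3 * (cofactorSqrt : Eπ)) * 0 - (1 - (ξO : Eπ) ^ 3) * 0 = 0 := by ring
  rw [e₁, e₂] at h1
  exact h1

theorem H_smul_v₂_ne : H • v₂ ≠ v₂ := by
  have h0 := π_ne_zero
  intro h
  have hx := H_smul_v₂_mem
  rw [h] at hx
  obtain ⟨p, q, r, hp⟩ := mem_top_v₂.1 hx
  have := (vec_injective hp).1
  field_simp at this
  exact not_eq_π_mul (y := p) rfl this

theorem adj_H_smul_v₂ : T.Adj v₃ (H • v₂) := by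
  have := Γ_smul_adj H v₃ v₂ adj₂₃.symm
  rwa [H_smul_v₃] at this

/-- The self-dual lattice of `H • v₂` contains `π⁻²(1,1,1)`. Were it fixed, the product of this
vector with its image under `t₃` would be integral; but that product is `2ξ² cofactorζ / π` up to
integral terms. -/
theorem t₃_smul_H_smul_v₂_ne : t₃ • H • v₂ ≠ H • v₂ := by
  have h0 := π_ne_zero
  intro h
  have hx := H_smul_v₂_mem
  have h1 := diag_smul_mem_top ![1, 1, rootξ ^ 3] hx
  rw [show diag ![1, 1, rootξ ^ 3] • H • v₂ = H • v₂ from h, diag_vec, loc_one, loc_t₃] at h1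
  rw [← (incident_v₃ adj_H_smul_v₂).1] at h1
  have h2 := h1 _ hx
  rw [star_vec_dotProduct] at h2
  have hs : star (1 / π ^ 2) = (ξO : Eπ) ^ 2 / π ^ 2 := by
    rw [one_div, star_inv₀, star_pow, ← inv_pow, inv_star_π]
    field_simp
  have h3 : (3 : Eπ) = π ^ 6 * cofactorThree := by
    rw [← coe_πO]
    exact coe_eq three_eq
  rw [hs, h3, star_zero] at h2
  have hτ : πO ∣ cofactorζ - 1 := ⟨πO ^ 3 * cofactorThree * (1 - πO), by rw [cofactorζ]; ring⟩
  have hdvd : πO ∣ 2 * (ξO ^ 2 * cofactorζ) := by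
    refine ⟨⟨_, h2⟩ - cofactorThree * πO ^ 2 * ξO ^ 2 * (1 - πO ^ 3 * cofactorζ), Subtype.ext ?_⟩
    rw [two_mul]
    push_cast
    rw [coe_πO]
    field_simp
    ring
  refine not_πO_dvd_two ?_
  convert (hdvd.sub (((dvd_ξO_pow_sub_one 2).mul_right cofactorζ).mul_left 2)).sub (hτ.mul_left 2)
    using 1
  ring

theorem ncard_neighbours_v₀ : {y | T.Adj v₀ y}.ncard = 4 := by
  have h : {y | T.Adj v₀ y} =
      Set.range fun ε : ℤˣ × ℤˣ => diag ![sgn ε.1, sgn ε.2, 1] • v₁ := by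
    ext y
    refine ⟨fun h => exists_smul_v₁_eq h, ?_⟩
    rintro ⟨ε, rfl⟩
    have := Γ_smul_adj (diag ![sgn ε.1, sgn ε.2, 1]) _ _ adj₀₁
    rwa [diag_smul_v₀] at this
  rw [h, ← Set.image_univ, Set.ncard_image_of_injective _ smul_v₁_injective, Set.ncard_univ,
    Nat.card_eq_fintype_card]
  rfl

theorem ncard_neighbours_v₁ : {y | T.Adj v₁ y}.ncard = 4 := by
  refine ncard_eq_four_of_orbit t₁_pow_nine (diag_smul_v₀ _) v₂_ne_v₀ t₁_smul_v₂_ne fun y => ⟨?_, ?_⟩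
  · exact fun h => or_iff_not_imp_left.2 (exists_pow_smul_v₂_eq h)
  · rintro (rfl | ⟨k, -, rfl⟩)
    · exact adj₀₁.symm
    · have := Γ_smul_adj (t₁ ^ k) _ _ adj₁₂
      rwa [pow_smul_eq t₁_smul_v₁] at this

theorem ncard_neighbours_v₂ : {y | T.Adj v₂ y}.ncard = 4 := by
  refine ncard_eq_four_of_orbit t₂_pow_nine t₂_smul_v₁ v₃_ne_v₁ t₂_smul_v₃_ne fun y => ⟨?_, ?_⟩
  · exact fun h => or_iff_not_imp_left.2 (exists_pow_smul_v₃_eq h)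
  · rintro (rfl | ⟨k, -, rfl⟩)
    · exact adj₁₂.symm
    · have := Γ_smul_adj (t₂ ^ k) _ _ adj₂₃
      rwa [pow_smul_eq t₂_smul_v₂] at this

theorem ncard_neighbours_v₃ : {y | T.Adj v₃ y}.ncard = 4 := by
  refine ncard_eq_four_of_orbit t₃_pow_nine t₃_smul_v₂ H_smul_v₂_ne t₃_smul_H_smul_v₂_ne
    fun y => ⟨?_, ?_⟩
  · exact fun h => or_iff_not_imp_left.2 (exists_pow_smul_H_smul_v₂_eq h)
  · rintro (rfl | ⟨k, -, rfl⟩)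
    · exact adj₂₃.symm
    · have := Γ_smul_adj (t₃ ^ k) _ _ adj_H_smul_v₂
      rwa [pow_smul_eq t₃_smul_v₃] at this

theorem isRootedTree : IsRootedTree T (radius isUniformizer_π) v₀ := isRootedTree_tree isUniformizer_π

theorem smul_base_ne {y : TVertex} (hy : y ≠ v₀) (hr : radius isUniformizer_π y ≤ 3) (g : Γ) :
    g • v₀ ≠ y := by
  rintro rfl
  exact hy (smul_base_eq_of_radius_le hr)

theorem isSegmentAction : IsSegmentAction Γ T (radius isUniformizer_π) v₀ v₁ v₂ v₃ := by
  have hT := isRootedTree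
  have e₀ := hT.root_eq
  have e₁ := hT.adj _ _ adj₀₁
  have e₂ := hT.step_away adj₀₁ adj₁₂ (by omega) v₂_ne_v₀
  have e₃ := hT.step_away adj₁₂ adj₂₃ e₂ v₃_ne_v₁
  refine ⟨hT, Γ_smul_adj, adj₀₁, adj₁₂, adj₂₃, v₃_ne_v₁, ?_, ?_, ?_, ?_, ?_, ?_, ?_⟩
  · exact smul_base_ne adj₀₁.ne' (by omega)
  · exact smul_base_ne v₂_ne_v₀ (by omega)
  · refine smul_base_ne ?_ (by omega)
    intro h
    rw [h] at e₃
    omega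
  · intro y hy
    obtain ⟨ε, rfl⟩ := exists_smul_v₁_eq hy
    exact ⟨_, diag_smul_v₀ _, rfl⟩
  · intro y hy hne
    obtain ⟨k, -, rfl⟩ := exists_pow_smul_v₂_eq hy hne
    exact ⟨_, pow_smul_eq (diag_smul_v₀ _) k, pow_smul_eq t₁_smul_v₁ k, rfl⟩
  · intro y hy hne
    obtain ⟨k, -, rfl⟩ := exists_pow_smul_v₃_eq hy hne
    exact ⟨_, pow_smul_eq (diag_smul_v₀ _) k, pow_smul_eq t₂_smul_v₁ k, pow_smul_eq t₂_smul_v₂ k, rfl⟩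
  · intro y hy
    rcases eq_or_ne y v₂ with rfl | hne
    · exact ⟨1, one_smul _ _, (one_smul _ _).symm⟩
    · obtain ⟨k, -, rfl⟩ := exists_pow_smul_H_smul_v₂_eq hy hne
      refine ⟨t₃ ^ k * H, ?_, (mul_smul _ _ _).symm⟩
      rw [mul_smul, H_smul_v₃, pow_smul_eq t₃_smul_v₃]

end Qutrit

end

/-! ### The path to `H • v₀` and the amalgam -/

theorem mainTheorem5 :
    ∃ p : Qutrit.T.Walk Qutrit.v₀ (Qutrit.H • Qutrit.v₀),
      p.IsPath ∧
      (∀ q : Qutrit.T.Walk Qutrit.v₀ (Qutrit.H • Qutrit.v₀), q.IsPath → q = p) ∧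
      p.length = 6 ∧
      ∃ C₀ C₃ C_D : Subgroup Qutrit.Γ,
        C₀ = MulAction.stabilizer Qutrit.Γ Qutrit.v₀ ∧
        C₃ = MulAction.stabilizer Qutrit.Γ (p.getVert 3) ∧
        C_D = ⨅ j : Fin 4, MulAction.stabilizer Qutrit.Γ (p.getVert j) ∧
        C_D = C₀ ⊓ C₃ ∧
        Nat.card C₀ = 1944 ∧ Nat.card C₃ = 216 ∧ Nat.card C_D = 54 ∧
        IsAmalgamatedProduct C₀ C₃ C_D := by
  have S := Qutrit.isSegmentAction
  have r₀ := S.tree.root_eq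
  have r₁ := S.radius₁
  have r₂ := S.radius₂
  have r₃ := S.radius₃
  have adj₂ : Qutrit.T.Adj (Qutrit.H • Qutrit.v₂) (Qutrit.H • Qutrit.v₁) :=
    Qutrit.Γ_smul_adj _ _ _ Qutrit.adj₁₂.symm
  have adj₁ : Qutrit.T.Adj (Qutrit.H • Qutrit.v₁) (Qutrit.H • Qutrit.v₀) :=
    Qutrit.Γ_smul_adj _ _ _ Qutrit.adj₀₁.symm
  have r₄ := S.tree.step_away S.adj₂₃ Qutrit.adj_H_smul_v₂ (by omega) Qutrit.H_smul_v₂_ne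
  have r₅ := S.tree.step_away Qutrit.adj_H_smul_v₂ adj₂ r₄ (S.smul₁_ne₃ _)
  have r₆ := S.tree.step_away adj₂ adj₁ r₅ fun h =>
    Qutrit.v₂_ne_v₀ (MulAction.injective Qutrit.H h).symm
  rw [r₃] at r₄
  rw [r₄] at r₅
  rw [r₅] at r₆
  -- `H` fixes `v₃`, so the segment continues with its own image under `H`, traversed backwards. The
  -- radii along this walk are 0, 1, ..., 6, which makes it a path.
  let p : Qutrit.T.Walk Qutrit.v₀ (Qutrit.H • Qutrit.v₀) :=
    .cons S.adj₀₁ (.cons S.adj₁₂ (.cons S.adj₂₃ (.cons Qutrit.adj_H_smul_v₂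
      (.cons adj₂ (.cons adj₁ .nil)))))
  have hp : p.IsPath := by
    refine SimpleGraph.Walk.IsPath.mk' (List.Nodup.of_map (BruhatTits.radius Qutrit.isUniformizer_π) ?_)
    simp [p, r₀, r₁, r₂, r₃, r₄, r₅, r₆]
  have hD : ⨅ j : Fin 4, MulAction.stabilizer Qutrit.Γ (p.getVert j) =
      MulAction.stabilizer Qutrit.Γ Qutrit.v₀ ⊓ MulAction.stabilizer Qutrit.Γ Qutrit.v₃ := by
    rw [← S.iInf_stabilizer]
    refine iInf_congr fun j => ?_
    fin_cases j <;> rfl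
  have h₀ := Qutrit.card_stabilizer_base
  have hcD := S.card_stabilizer_root Qutrit.ncard_neighbours_v₀ Qutrit.ncard_neighbours_v₁
    Qutrit.ncard_neighbours_v₂
  have hc₃ := S.card_stabilizer_third Qutrit.ncard_neighbours_v₃
  refine ⟨p, hp, fun q hq => ?_, rfl, _, _, _, rfl, rfl, rfl, hD, h₀, ?_, ?_, ?_⟩
  -- Reversed, both paths end at the root, where `path_unique` applies.
  · exact SimpleGraph.Walk.reverse_injective
      (S.tree.path_unique _ _ hq.reverse hp.reverse)
  -- From `1944 = 36 · |C_D|` one gets `|C_D| = 54`, and `|C₃| = 4 · 54`.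
  · change Nat.card (MulAction.stabilizer Qutrit.Γ Qutrit.v₃) = 216
    omega
  · rw [hD]
    omega
  · rw [hD]
    exact S.isAmalgamatedProduct
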